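/- Work in Kohlenbach's higher-order arithmetic: classical many-sorted logic over the finite types ($0$ is the type of natural numbers, $\sigma\to\tau$ the type of mappings, $1=0\to 0$, $2=1\to 0$), with prime formulas $s=_0t$, $s<_0t$ at type $0$ only, and with equality at higher types defined pointwise. The system $\mathsf{RCA}_0^\omega$ consists of the axioms of an ordered semi-ring for $0,1,<,+,\times$ at type $0$, the defining axioms of the combinators $\Pi,\Sigma$ and of the recursor $\mathbf R_0$, the axiom of extensionality at all types, induction for quantifier-free formulas, and $\mathsf{QF\text{-}AC}^{1,0}$, where $\mathsf{QF\text{-}AC}^{\sigma,\tau}$ is the schema $(\forall x^\sigma)(\exists y^\tau)A(x,y)\to(\exists Y^{\sigma\to\tau})(\forall x^\sigma)A(x,Y(x))$ for quantifier-free $A$ (parameters of any type allowed). The system $\mathsf{ACA}_0^\omega$ is $\mathsf{RCA}_0^\omega$ plus the axiom $(\mu^2)$: there is $\mu^2$ such that for all $f^1$, if $f(n)=0$ for some $n$, then $\mu(f)$ is the least such $n$, and $\mu(f)=0$ otherwise. $\mathsf{IND}$ is induction for all formulas. Real numbers are given by fast-converging Cauchy sequences of (codes of) rational numbers, i.e.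 $|q_n-q_{n+i}|<2^{-n}$ for all $n,i$, with the usual $=_{\mathbb R}$ and $<_{\mathbb R}$; functions on $[0,1]$ respect $=_{\mathbb R}$. A family $(a_x)_{x\in[0,1]}$ of reals is \emph{summable} if the net $F\mapsto\sum_{x\in F}a_x$ has a limit in $\mathbb R$, where $F$ ranges over the finite sequences of reals in $[0,1]$ without repetitions, ordered by inclusion. Consider the following statements. $\mathsf{SUM}'$: if $(a_x)_{x\in[0,1]}$ is summable and non-negative, then there is a sequence $(y_i)_{i\in\mathbb N}$ of reals in $[0,1]$ such that $a_y=_{\mathbb R}0$ for every $y\in[0,1]$ with $(\forall i\in\mathbb N)(y\neq_{\mathbb R}y_i)$. $\mathsf{NBI}$: there is no bijection from $[0,1]$ to $\mathbb N$. \textbf{Theorem.} The system $\mathsf{ACA}_0^\omega+\mathsf{IND}$ proves $\mathsf{SUM}'\to\mathsf{NBI}$, and the system $\mathsf{ACA}_0^\omega$ proves $\mathsf{QF\text{-}AC}^{0,1}\to\mathsf{SUM}'$, i.e. $\mathsf{ACA}_0^\omega+\mathsf{QF\text{-}AC}^{0,1}$ proves $\mathsf{SUM}'$. -/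

import Mathlib

namespace HOArith

/-! ## Many-sorted classical logic over the finite types -/

/-- The finite types: `nat` is the type `0`, and `σ ⇒ τ` is the type of mappings from `σ` to `τ`. -/
inductive Ty : Type
  | nat : Ty
  | arr : Ty → Ty → Ty

infixr:60 "⇒" => Ty.arr

/-- Typed de Bruijn variables: `Var Γ τ` is the type of the positions in `Γ` that hold `τ`. -/
inductive Var : List Ty → Ty → Type
  | zero {Γ : List Ty} {σ : Ty} : Var (σ :: Γ) σ
  | succ {Γ : List Ty} {σ τ : Ty} : Var Γ τ → Var (σ :: Γ) τ

/-- Terms over a family `C` of typed constant symbols, with free variables in `Γ`. -/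
inductive Tm (C : Ty → Type) (Γ : List Ty) : Ty → Type
  | var {τ : Ty} : Var Γ τ → Tm C Γ τ
  | cst {τ : Ty} : C τ → Tm C Γ τ
  | app {σ τ : Ty} : Tm C Γ (σ ⇒ τ) → Tm C Γ σ → Tm C Γ τ

infixl:80 "⬝" => Tm.app

/-- Formulas.  The prime formulas are equations and inequalities between terms of type `0`. -/
inductive Fm (C : Ty → Type) : List Ty → Type
  | bot {Γ : List Ty} : Fm C Γ
  | eq {Γ : List Ty} : Tm C Γ Ty.nat → Tm C Γ Ty.nat → Fm C Γ
  | lt {Γ : List Ty} : Tm C Γ Ty.nat → Tm C Γ Ty.nat → Fm C Γ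
  | imp {Γ : List Ty} : Fm C Γ → Fm C Γ → Fm C Γ
  | all {Γ : List Ty} (σ : Ty) : Fm C (σ :: Γ) → Fm C Γ

infix:50 "≐" => Fm.eq
infix:50 "≺" => Fm.lt
infixr:30 "⟹" => Fm.imp

section Logic

variable {C : Ty → Type} {Γ Δ : List Ty} {σ τ : Ty}

/-- Simultaneous substitution in a term. -/
def Tm.subst (s : (ρ : Ty) → Var Γ ρ → Tm C Δ ρ) : {τ : Ty} → Tm C Γ τ → Tm C Δ τ
  | _, .var v => s _ v
  | _, .cst c => .cst c
  | _, .app f a => .app (f.subst s) (a.subst s)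

/-- Weakening: the same term in a context with one more variable. -/
def Tm.wk (t : Tm C Γ τ) : Tm C (σ :: Γ) τ :=
  t.subst fun _ v => .var v.succ

/-- The extension of a substitution under a binder. -/
def up (s : (ρ : Ty) → Var Γ ρ → Tm C Δ ρ) : (ρ : Ty) → Var (σ :: Γ) ρ → Tm C (σ :: Δ) ρ
  | _, .zero => .var .zero
  | _, .succ v => (s _ v).wk

/-- The substitution of `t` for the most recent variable. -/
def inst (t : Tm C Γ σ) : (ρ : Ty) → Var (σ :: Γ) ρ → Tm C Γ ρ
  | _, .zero => t
  | _, .succ v => .var v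

/-- The substitution for the empty context. -/
def noVar : (ρ : Ty) → Var [] ρ → Tm C Γ ρ := fun _ v => nomatch v

/-- Simultaneous, capture-free substitution in a formula. -/
def Fm.subst : {Γ Δ : List Ty} → ((ρ : Ty) → Var Γ ρ → Tm C Δ ρ) → Fm C Γ → Fm C Δ
  | _, _, _, .bot => .bot
  | _, _, s, .eq a b => .eq (a.subst s) (b.subst s)
  | _, _, s, .lt a b => .lt (a.subst s) (b.subst s)
  | _, _, s, .imp φ ψ => .imp (φ.subst s) (ψ.subst s)
  | _, _, s, .all σ φ => .all σ (φ.subst (up s))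

/-- Weakening of a formula. -/
def Fm.wk (φ : Fm C Γ) : Fm C (σ :: Γ) :=
  φ.subst fun _ v => .var v.succ

/-- A sentence, read in an arbitrary context. -/
def Fm.lift (φ : Fm C []) : Fm C Γ :=
  φ.subst noVar

/-- The universal closure of a formula. -/
def Fm.close : {Γ : List Ty} → Fm C Γ → Fm C []
  | [], φ => φ
  | σ :: _, φ => Fm.close (.all σ φ)

/-- Quantifier-free formulas. -/
def Fm.QF : {Γ : List Ty} → Fm C Γ → Prop
  | _, .bot => True
  | _, .eq _ _ => True
  | _, .lt _ _ => True
  | _, .imp φ ψ => φ.QF ∧ ψ.QF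
  | _, .all _ _ => False

/-! The remaining connectives, with their classical definitions. -/

def Fm.neg (φ : Fm C Γ) : Fm C Γ := φ ⟹ .bot
def Fm.or (φ ψ : Fm C Γ) : Fm C Γ := φ.neg ⟹ ψ
def Fm.and (φ ψ : Fm C Γ) : Fm C Γ := (φ ⟹ ψ.neg).neg
def Fm.ex (σ : Ty) (φ : Fm C (σ :: Γ)) : Fm C Γ := (Fm.all σ φ.neg).neg

/-- Derivability from a set `T` of sentences: natural deduction for classical many-sorted
predicate logic with equality at type `0`.  The list contains the open assumptions. -/
inductive Derives (T : Set (Fm C [])) : {Γ : List Ty} → List (Fm C Γ) → Fm C Γ → Prop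
  | thy {Γ : List Ty} {H : List (Fm C Γ)} {φ : Fm C []} : φ ∈ T → Derives T H φ.lift
  | hyp {Γ : List Ty} {H : List (Fm C Γ)} {φ : Fm C Γ} : φ ∈ H → Derives T H φ
  | impI {Γ : List Ty} {H : List (Fm C Γ)} {φ ψ : Fm C Γ} :
      Derives T (φ :: H) ψ → Derives T H (φ ⟹ ψ)
  | impE {Γ : List Ty} {H : List (Fm C Γ)} {φ ψ : Fm C Γ} :
      Derives T H (φ ⟹ ψ) → Derives T H φ → Derives T H ψ
  | raa {Γ : List Ty} {H : List (Fm C Γ)} {φ : Fm C Γ} :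
      Derives T (φ.neg :: H) .bot → Derives T H φ
  | allI {Γ : List Ty} {H : List (Fm C Γ)} {σ : Ty} {φ : Fm C (σ :: Γ)} :
      Derives T (H.map Fm.wk) φ → Derives T H (.all σ φ)
  | allE {Γ : List Ty} {H : List (Fm C Γ)} {σ : Ty} {φ : Fm C (σ :: Γ)} (t : Tm C Γ σ) :
      Derives T H (.all σ φ) → Derives T H (φ.subst (inst t))
  | eqRefl {Γ : List Ty} {H : List (Fm C Γ)} (t : Tm C Γ Ty.nat) : Derives T H (t ≐ t)
  | eqSubst {Γ : List Ty} {H : List (Fm C Γ)} {s t : Tm C Γ Ty.nat} (φ : Fm C (Ty.nat :: Γ)) :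
      Derives T H (s ≐ t) → Derives T H (φ.subst (inst s)) → Derives T H (φ.subst (inst t))

/-- The theory `T` proves the sentence `φ`. -/
def Proves (T : Set (Fm C [])) (φ : Fm C []) : Prop := Derives T [] φ

/-- Equality at a finite type, defined pointwise from equality at type `0`. -/
def eqTy : (τ : Ty) → {Γ : List Ty} → Tm C Γ τ → Tm C Γ τ → Fm C Γ
  | .nat, _, s, t => s ≐ t
  | .arr σ τ, _, s, t => .all σ (eqTy τ (s.wk ⬝ .var .zero) (t.wk ⬝ .var .zero))

end Logic

/-! ## The language of higher-order arithmetic -/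

/-- The constants: `0`, `1`, `+`, `×`, the combinators `Π` and `Σ`, and the recursors. -/
inductive Const : Ty → Type
  | zero : Const Ty.nat
  | one : Const Ty.nat
  | add : Const (Ty.nat ⇒ Ty.nat ⇒ Ty.nat)
  | mul : Const (Ty.nat ⇒ Ty.nat ⇒ Ty.nat)
  | combK (σ τ : Ty) : Const (σ ⇒ τ ⇒ σ)
  | combS (σ τ ρ : Ty) : Const ((σ ⇒ τ ⇒ ρ) ⇒ (σ ⇒ τ) ⇒ σ ⇒ ρ)
  | recr (σ : Ty) : Const ((Ty.nat ⇒ σ ⇒ σ) ⇒ σ ⇒ Ty.nat ⇒ σ)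

abbrev Term (Γ : List Ty) (τ : Ty) : Type := Tm Const Γ τ
abbrev Formula (Γ : List Ty) : Type := Fm Const Γ
abbrev Sentence : Type := Formula []

/-- The type `1`. -/
abbrev Ty.one : Ty := Ty.nat ⇒ Ty.nat
/-- The type `2`. -/
abbrev Ty.two : Ty := Ty.one ⇒ Ty.nat

section Arithmetic

variable {Γ : List Ty} {σ τ ρ : Ty}

/-! The variables bound by the innermost binder, the next one, and so on. -/

abbrev v0 : Term (σ :: Γ) σ := .var .zero
abbrev v1 {σ₀ : Ty} : Term (σ₀ :: σ :: Γ) σ := .var (.succ .zero)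
abbrev v2 {σ₀ σ₁ : Ty} : Term (σ₀ :: σ₁ :: σ :: Γ) σ := .var (.succ (.succ .zero))
abbrev v3 {σ₀ σ₁ σ₂ : Ty} : Term (σ₀ :: σ₁ :: σ₂ :: σ :: Γ) σ :=
  .var (.succ (.succ (.succ .zero)))

def zero : Term Γ Ty.nat := .cst .zero
def one : Term Γ Ty.nat := .cst .one
def add (s t : Term Γ Ty.nat) : Term Γ Ty.nat := .cst .add ⬝ s ⬝ t
def mul (s t : Term Γ Ty.nat) : Term Γ Ty.nat := .cst .mul ⬝ s ⬝ t
def K (σ τ : Ty) : Term Γ (σ ⇒ τ ⇒ σ) := .cst (.combK σ τ)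
def S (σ τ ρ : Ty) : Term Γ ((σ ⇒ τ ⇒ ρ) ⇒ (σ ⇒ τ) ⇒ σ ⇒ ρ) := .cst (.combS σ τ ρ)
/-- Primitive recursion `R₀(f, m, n)`. -/
def rec0 (f : Term Γ (Ty.nat ⇒ Ty.nat ⇒ Ty.nat)) (m n : Term Γ Ty.nat) : Term Γ Ty.nat :=
  .cst (.recr Ty.nat) ⬝ f ⬝ m ⬝ n

def two : Term Γ Ty.nat := add one one
def suc (t : Term Γ Ty.nat) : Term Γ Ty.nat := add t one

/-- `λ`-abstraction of the most recent variable, defined from the combinators. -/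
def lam : {τ : Ty} → Term (σ :: Γ) τ → Term Γ (σ ⇒ τ)
  | _, .var .zero => S σ (σ ⇒ σ) σ ⬝ K σ (σ ⇒ σ) ⬝ K σ σ
  | _, .var (.succ v) => K _ σ ⬝ .var v
  | _, .cst c => K _ σ ⬝ .cst c
  | _, .app f a => S σ _ _ ⬝ lam f ⬝ lam a

end Arithmetic

/-! ## The formal systems -/

/-- `0, 1, <, +, ×` form a (commutative, strictly ordered) semi-ring. -/
inductive OrderedSemiring : Sentence → Prop
  | add_assoc : OrderedSemiring
      (Fm.close (Γ := [.nat, .nat, .nat]) (add (add v0 v1) v2 ≐ add v0 (add v1 v2)))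
  | add_comm : OrderedSemiring (Fm.close (Γ := [.nat, .nat]) (add v0 v1 ≐ add v1 v0))
  | add_zero : OrderedSemiring (Fm.close (Γ := [.nat]) (add v0 zero ≐ v0))
  | mul_assoc : OrderedSemiring
      (Fm.close (Γ := [.nat, .nat, .nat]) (mul (mul v0 v1) v2 ≐ mul v0 (mul v1 v2)))
  | mul_comm : OrderedSemiring (Fm.close (Γ := [.nat, .nat]) (mul v0 v1 ≐ mul v1 v0))
  | mul_one : OrderedSemiring (Fm.close (Γ := [.nat]) (mul v0 one ≐ v0))
  | mul_zero : OrderedSemiring (Fm.close (Γ := [.nat]) (mul v0 zero ≐ zero))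
  | mul_add : OrderedSemiring
      (Fm.close (Γ := [.nat, .nat, .nat]) (mul v0 (add v1 v2) ≐ add (mul v0 v1) (mul v0 v2)))
  | lt_irrefl : OrderedSemiring (Fm.close (Γ := [.nat]) (Fm.neg (v0 ≺ v0)))
  | lt_trans : OrderedSemiring
      (Fm.close (Γ := [.nat, .nat, .nat]) ((v0 ≺ v1) ⟹ (v1 ≺ v2) ⟹ (v0 ≺ v2)))
  | lt_total : OrderedSemiring
      (Fm.close (Γ := [.nat, .nat]) (Fm.or (v0 ≺ v1) (Fm.or (v0 ≐ v1) (v1 ≺ v0))))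
  | zero_lt_one : OrderedSemiring ((zero : Term [] Ty.nat) ≺ one)
  | add_lt_add : OrderedSemiring
      (Fm.close (Γ := [.nat, .nat, .nat]) ((v0 ≺ v1) ⟹ (add v0 v2 ≺ add v1 v2)))
  | mul_lt_mul : OrderedSemiring
      (Fm.close (Γ := [.nat, .nat, .nat])
        ((v0 ≺ v1) ⟹ (zero ≺ v2) ⟹ (mul v0 v2 ≺ mul v1 v2)))

/-- The substitution `n ↦ n + 1`. -/
def sucSubst {Γ : List Ty} : (ρ : Ty) → Var (Ty.nat :: Γ) ρ → Term (Ty.nat :: Γ) ρ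
  | _, .zero => suc v0
  | _, .succ v => .var v.succ

/-- The induction formula `A(0) → (∀ n)(A(n) → A(n+1)) → (∀ n) A(n)`. -/
def indFm {Γ : List Ty} (A : Formula (Ty.nat :: Γ)) : Formula Γ :=
  A.subst (inst zero) ⟹ Fm.all .nat (A ⟹ A.subst sucSubst) ⟹ Fm.all .nat A

/-- The substitution `y ↦ Y(x)` from the context `y, x, …` to the context `x, Y, …`. -/
def choiceSubst {Γ : List Ty} {σ τ : Ty} :
    (ρ : Ty) → Var (τ :: σ :: Γ) ρ → Term (σ :: (σ ⇒ τ) :: Γ) ρ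
  | _, .zero => v1 ⬝ v0
  | _, .succ .zero => v0
  | _, .succ (.succ v) => .var v.succ.succ

/-- The choice formula `(∀ x)(∃ y) A(x, y) → (∃ Y)(∀ x) A(x, Y(x))`. -/
def acFm {Γ : List Ty} (σ τ : Ty) (A : Formula (τ :: σ :: Γ)) : Formula Γ :=
  Fm.all σ (Fm.ex τ A) ⟹ Fm.ex (σ ⇒ τ) (Fm.all σ (A.subst choiceSubst))

/-- Induction for all formulas, with parameters of any type. -/
inductive IND : Sentence → Prop
  | mk {Γ : List Ty} (A : Formula (Ty.nat :: Γ)) : IND (indFm A).close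

/-- Induction for quantifier-free formulas, with parameters of any type. -/
inductive QFIND : Sentence → Prop
  | mk {Γ : List Ty} (A : Formula (Ty.nat :: Γ)) : A.QF → QFIND (indFm A).close

/-- The quantifier-free axiom of choice `QF-AC^{σ,τ}`, with parameters of any type. -/
inductive QFAC (σ τ : Ty) : Sentence → Prop
  | mk {Γ : List Ty} (A : Formula (τ :: σ :: Γ)) : A.QF → QFAC σ τ (acFm σ τ A).close

/-- Kohlenbach's base theory `RCA₀^ω`. -/
inductive RCA0 : Sentence → Prop
  | basic {φ : Sentence} : OrderedSemiring φ → RCA0 φ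
  | combK (σ τ : Ty) : RCA0
      (Fm.close (Γ := [σ, τ]) (eqTy σ (K σ τ ⬝ v0 ⬝ v1) v0))
  | combS (σ τ ρ : Ty) : RCA0
      (Fm.close (Γ := [σ ⇒ τ ⇒ ρ, σ ⇒ τ, σ])
        (eqTy ρ (S σ τ ρ ⬝ v0 ⬝ v1 ⬝ v2) (v0 ⬝ v2 ⬝ (v1 ⬝ v2))))
  | rec_zero : RCA0
      (Fm.close (Γ := [Ty.nat ⇒ Ty.nat ⇒ Ty.nat, .nat]) (rec0 v0 v1 zero ≐ v1))
  | rec_succ : RCA0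
      (Fm.close (Γ := [Ty.nat ⇒ Ty.nat ⇒ Ty.nat, .nat, .nat])
        (rec0 v0 v1 (suc v2) ≐ v0 ⬝ v2 ⬝ rec0 v0 v1 v2))
  | ext (ρ τ : Ty) : RCA0
      (Fm.close (Γ := [ρ, ρ, ρ ⇒ τ]) (eqTy ρ v0 v1 ⟹ eqTy τ (v2 ⬝ v0) (v2 ⬝ v1)))
  | ind {φ : Sentence} : QFIND φ → RCA0 φ
  | choice {φ : Sentence} : QFAC Ty.one Ty.nat φ → RCA0 φ

/-- `(μ²)`: Feferman's search functional exists. -/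
def muTwo : Sentence :=
  Fm.ex Ty.two (Fm.all Ty.one (Fm.and
    (Fm.ex .nat (v1 ⬝ v0 ≐ zero) ⟹
      Fm.and (v0 ⬝ (v1 ⬝ v0) ≐ zero)
        (Fm.all .nat ((v0 ≺ v2 ⬝ v1) ⟹ Fm.neg (v1 ⬝ v0 ≐ zero))))
    (Fm.all .nat (Fm.neg (v1 ⬝ v0 ≐ zero)) ⟹ (v1 ⬝ v0 ≐ zero))))

/-- `ACA₀^ω`, that is, `RCA₀^ω + (μ²)`. -/
def ACA0 : Set Sentence := {φ | RCA0 φ} ∪ {muTwo}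

/-! ## Rational and real numbers -/

section Reals

variable {Γ : List Ty}

/-- The predecessor. -/
def prd (t : Term Γ Ty.nat) : Term Γ Ty.nat := rec0 (lam (lam v1)) zero t

/-- Cut-off subtraction. -/
def monus (s t : Term Γ Ty.nat) : Term Γ Ty.nat := rec0 (lam (lam (prd v0))) s t

/-- The triangular number `0 + 1 + ⋯ + n`. -/
def tri (n : Term Γ Ty.nat) : Term Γ Ty.nat := rec0 (lam (lam (add v0 (suc v1)))) zero n

/-- The largest `r` with `tri r ≤ c`: in the step from `c` to `c + 1` the value `r` grows by
`1 ∸ (tri (r + 1) ∸ (c + 1))`. -/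
def triRoot (c : Term Γ Ty.nat) : Term Γ Ty.nat :=
  rec0 (lam (lam (add v0 (monus one (monus (tri (suc v0)) (suc v1)))))) zero c

/-- Cantor's pairing function. -/
def pair (a b : Term Γ Ty.nat) : Term Γ Ty.nat := add (tri (add a b)) b
def snd (c : Term Γ Ty.nat) : Term Γ Ty.nat := monus c (tri (triRoot c))
def fst (c : Term Γ Ty.nat) : Term Γ Ty.nat := monus (triRoot c) (snd c)

/-- The code of the rational number `(p - n) / (r + 1)`. -/
def mkQ (p n r : Term Γ Ty.nat) : Term Γ Ty.nat := pair (pair p n) r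
def qPos (c : Term Γ Ty.nat) : Term Γ Ty.nat := fst (fst c)
def qNeg (c : Term Γ Ty.nat) : Term Γ Ty.nat := snd (fst c)
def qDen (c : Term Γ Ty.nat) : Term Γ Ty.nat := suc (snd c)

/-- Addition of rational numbers; the third entry is the predecessor of the new denominator. -/
def qAdd (c d : Term Γ Ty.nat) : Term Γ Ty.nat :=
  mkQ (add (mul (qPos c) (qDen d)) (mul (qPos d) (qDen c)))
    (add (mul (qNeg c) (qDen d)) (mul (qNeg d) (qDen c)))
    (prd (mul (qDen c) (qDen d)))

def qLt (c d : Term Γ Ty.nat) : Formula Γ :=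
  add (mul (qPos c) (qDen d)) (mul (qNeg d) (qDen c)) ≺
    add (mul (qPos d) (qDen c)) (mul (qNeg c) (qDen d))

def qLe (c d : Term Γ Ty.nat) : Formula Γ := (qLt d c).neg

def qZero : Term Γ Ty.nat := mkQ zero zero zero
def qOne : Term Γ Ty.nat := mkQ one zero zero

/-- `2^n`. -/
def pow2 (n : Term Γ Ty.nat) : Term Γ Ty.nat := rec0 (lam (lam (add v0 v0))) one n
/-- The rational number `2^(-n)`. -/
def qEps (n : Term Γ Ty.nat) : Term Γ Ty.nat := mkQ one zero (prd (pow2 n))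
/-- The rational number `2^(-n+1)`. -/
def qTwoEps (n : Term Γ Ty.nat) : Term Γ Ty.nat := mkQ two zero (prd (pow2 n))

/-- `|c - d| < e` for rational numbers. -/
def qDistLt (c d e : Term Γ Ty.nat) : Formula Γ := Fm.and (qLt c (qAdd d e)) (qLt d (qAdd c e))
/-- `|c - d| ≤ e` for rational numbers. -/
def qDistLe (c d e : Term Γ Ty.nat) : Formula Γ := Fm.and (qLe c (qAdd d e)) (qLe d (qAdd c e))

/-- `x` is a real number: `(∀ n, i)(|x(n) - x(n+i)| < 2^(-n))`. -/
def isReal (x : Term Γ Ty.one) : Formula Γ :=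
  Fm.all .nat (Fm.all .nat (qDistLt (x.wk.wk ⬝ v1) (x.wk.wk ⬝ add v1 v0) (qEps v1)))

/-- `x =_ℝ y`: `(∀ n)(|x(n) - y(n)| ≤ 2^(-n+1))`. -/
def rEq (x y : Term Γ Ty.one) : Formula Γ :=
  Fm.all .nat (qDistLe (x.wk ⬝ v0) (y.wk ⬝ v0) (qTwoEps v0))

/-- `x <_ℝ y`: `(∃ n)(x(n) + 2^(-n+1) < y(n))`. -/
def rLt (x y : Term Γ Ty.one) : Formula Γ :=
  Fm.ex .nat (qLt (qAdd (x.wk ⬝ v0) (qTwoEps v0)) (y.wk ⬝ v0))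

def rLe (x y : Term Γ Ty.one) : Formula Γ := (rLt y x).neg

/-- A rational number as a (constant sequence, hence a) real number. -/
def ofQ (c : Term Γ Ty.nat) : Term Γ Ty.one := lam c.wk

/-- Addition of real numbers. -/
def rAdd (x y : Term Γ Ty.one) : Term Γ Ty.one :=
  lam (qAdd (x.wk ⬝ suc v0) (y.wk ⬝ suc v0))

/-- `|x - y| < e` for real numbers. -/
def rDistLt (x y e : Term Γ Ty.one) : Formula Γ := Fm.and (rLt x (rAdd y e)) (rLt y (rAdd x e))

/-- `x ∈ [0,1]`. -/
def inUnit (x : Term Γ Ty.one) : Formula Γ :=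
  Fm.and (isReal x) (Fm.and (rLe (ofQ qZero) x) (rLe x (ofQ qOne)))

/-! ## Unordered sums

A finite sequence of reals is given by its length `n` of type `0` and by a sequence `w` of type
`0 → 1`, of which only `w(0), …, w(n-1)` matter. -/

/-- The type of sequences of objects of type `1`. -/
abbrev Ty.seq : Ty := Ty.nat ⇒ Ty.one

/-- `⟨w(0), …, w(n-1)⟩` is a finite sequence of reals in `[0,1]` without repetitions. -/
def isFin (n : Term Γ Ty.nat) (w : Term Γ Ty.seq) : Formula Γ :=
  Fm.and
    (Fm.all .nat ((v0 ≺ n.wk) ⟹ inUnit (w.wk ⬝ v0)))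
    (Fm.all .nat (Fm.all .nat ((v1 ≺ n.wk.wk) ⟹ (v0 ≺ n.wk.wk) ⟹ Fm.neg (v1 ≐ v0) ⟹
      Fm.neg (rEq (w.wk.wk ⬝ v1) (w.wk.wk ⬝ v0)))))

/-- Every entry of `⟨w(0), …, w(n-1)⟩` equals an entry of `⟨w'(0), …, w'(n'-1)⟩`. -/
def isSub (n : Term Γ Ty.nat) (w : Term Γ Ty.seq) (n' : Term Γ Ty.nat) (w' : Term Γ Ty.seq) :
    Formula Γ :=
  Fm.all .nat ((v0 ≺ n.wk) ⟹
    Fm.ex .nat (Fm.and (v0 ≺ n'.wk.wk) (rEq (w.wk.wk ⬝ v1) (w'.wk.wk ⬝ v0))))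

/-- The real number `∑_{i<n} a(w(i))`.  Its `k`-th approximation is the sum of the `(k+n)`-th
approximations of the summands, which makes it converge fast because `n ≤ 2^n`. -/
def finSum (a : Term Γ (Ty.one ⇒ Ty.one)) (n : Term Γ Ty.nat) (w : Term Γ Ty.seq) :
    Term Γ Ty.one :=
  lam (rec0
    (lam (lam (qAdd v0 (a.wk.wk.wk ⬝ (w.wk.wk.wk ⬝ v1) ⬝ add v2 n.wk.wk.wk))))
    qZero n.wk)

/-- `a` is (represents) a function from `[0,1]` to `ℝ`. -/
def isRealFun (a : Term Γ (Ty.one ⇒ Ty.one)) : Formula Γ :=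
  Fm.and
    (Fm.all Ty.one (inUnit v0 ⟹ isReal (a.wk ⬝ v0)))
    (Fm.all Ty.one (Fm.all Ty.one (inUnit v1 ⟹ inUnit v0 ⟹ rEq v1 v0 ⟹
      rEq (a.wk.wk ⬝ v1) (a.wk.wk ⬝ v0))))

/-- `a(x) ≥ 0` for `x` in `[0,1]`. -/
def isNonneg (a : Term Γ (Ty.one ⇒ Ty.one)) : Formula Γ :=
  Fm.all Ty.one (inUnit v0 ⟹ rLe (ofQ qZero) (a.wk ⬝ v0))

/-- The real `b` is the limit of the net of the sums `∑_{x ∈ F} a(x)`, where `F` ranges over the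
finite sequences without repetitions, ordered by inclusion: for every `ε > 0` there is
`F₀ = (n₀, w₀)` such that all `F = (n, w)` with `F₀ ⊆ F` satisfy `|∑_{x ∈ F} a(x) - b| < ε`. -/
def isNetLimit (a : Term Γ (Ty.one ⇒ Ty.one)) (b : Term Γ Ty.one) : Formula Γ :=
  Fm.all Ty.one (isReal v0 ⟹ rLt (ofQ qZero) v0 ⟹
    Fm.ex .nat (Fm.ex Ty.seq (Fm.and (isFin v1 v0)
      (Fm.all .nat (Fm.all Ty.seq (isFin v1 v0 ⟹ isSub v3 v2 v1 v0 ⟹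
        rDistLt (finSum a.wk.wk.wk.wk.wk v1 v0) b.wk.wk.wk.wk.wk
          (.var (.succ (.succ (.succ (.succ .zero)))))))))))

/-- The family `(a_x)_{x ∈ [0,1]}` is summable. -/
def isSummable (a : Term Γ (Ty.one ⇒ Ty.one)) : Formula Γ :=
  Fm.ex Ty.one (Fm.and (isReal v0) (isNetLimit a.wk v0))

end Reals

/-- `SUM'`: if `(a_x)_{x ∈ [0,1]}` is summable and non-negative, then there is a sequence
`(y_i)` in `[0,1]` such that `a_z = 0` for every `z` in `[0,1]` that differs from all `y_i`. -/
def SUM' : Sentence :=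
  Fm.all (Ty.one ⇒ Ty.one) (isRealFun v0 ⟹ isNonneg v0 ⟹ isSummable v0 ⟹
    Fm.ex Ty.seq (Fm.and
      (Fm.all .nat (inUnit (v1 ⬝ v0)))
      (Fm.all Ty.one (inUnit v0 ⟹ Fm.all .nat (Fm.neg (rEq v1 (v2 ⬝ v0))) ⟹
        rEq (v2 ⬝ v0) (ofQ qZero)))))

/-- `NBI`: there is no bijection from `[0,1]` to `ℕ`. -/
def NBI : Sentence :=
  Fm.neg (Fm.ex Ty.two (Fm.and
    -- a function on the reals in `[0,1]`
    (Fm.all Ty.one (Fm.all Ty.one (inUnit v1 ⟹ inUnit v0 ⟹ rEq v1 v0 ⟹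
      (v2 ⬝ v1 ≐ v2 ⬝ v0))))
    (Fm.and
      -- injective
      (Fm.all Ty.one (Fm.all Ty.one (inUnit v1 ⟹ inUnit v0 ⟹ (v2 ⬝ v1 ≐ v2 ⬝ v0) ⟹
        rEq v1 v0)))
      -- surjective
      (Fm.all .nat (Fm.ex Ty.one (Fm.and (inUnit v0) (v2 ⬝ v0 ≐ v1)))))))

end HOArith

/-! Derivability is proved semantically. By the completeness theorem `proves_of_sat` it is enough to
check each sentence in every structure that satisfies the theory, with equality at type 0 read as
identity and all functions extensional. The theorem is proved by Henkin's construction; the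
extensionality axioms make pointwise equality a congruence on the closed terms, so that they can be
collapsed to such a structure.

A model may be nonstandard, so the arithmetic and analysis are redone inside it. Its numbers form an
ordered semiring, over which the fractions `Frac` serve as the rationals, and reals are sequences of
codes in the model. Induction and recursion apply only to functions represented by elements of the
model, which is what `Internal` records. By `(μ²)` the internal predicates are closed under
numerical quantifiers (`Internal.exists_least`), so quantifier-free induction becomes induction for
arithmetical predicates with parameters of any type (`nat_induction`).

For `SUM'`, let b be the limit. For each n some finite sequence has a sum above b - 2^(-n), and
`QF-AC^{0,1}` chooses such sequences for all n at once, each coded as a single object of type 1. No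
finite sum exceeds b, since any finite sequence can be merged with one from the definition of the
limit (`approxSum_le_of_isNetLimit`). Appending to the n-th sequence a point z that lies in none of
them gives a_z ≤ 2^(-n); hence a_z = 0, and the sequence wanted lists all the chosen entries
(`model_sum'`).

For `NBI`, a bijection Y from [0,1] to the numbers would make the family 2^(-Y(x)) summable with
limit 2 (`isNetLimit_of_bijection`): a finite sequence containing preimages of all numbers below N
has a sum between 2 - 2·2^(-N) and 2, by the geometric series and injectivity. Finding these
preimages as one finite sequence is where `IND` is needed. No member of the family is 0, so `SUM'`
would enumerate [0,1], against Cantor's diagonal argument (`exists_not_rEq`). -/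

namespace HOArith

/-! ## Substitution for variables and constants -/

section Bind

variable {C C₁ C₂ : Ty → Type} {Γ Δ Θ : List Ty} {σ τ : Ty}

/-- Simultaneous replacement of the constants and of the variables of a term. -/
def Tm.bind (g : (ρ : Ty) → C ρ → Tm C₁ Δ ρ) (s : (ρ : Ty) → Var Γ ρ → Tm C₁ Δ ρ) :
    {τ : Ty} → Tm C Γ τ → Tm C₁ Δ τ
  | _, .var v => s _ v
  | _, .cst c => g _ c
  | _, .app f a => .app (f.bind g s) (a.bind g s)

/-- Simultaneous replacement of the constants and of the free variables of a formula. -/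
def Fm.bind : {Γ Δ : List Ty} → ((ρ : Ty) → C ρ → Tm C₁ Δ ρ) →
    ((ρ : Ty) → Var Γ ρ → Tm C₁ Δ ρ) → Fm C Γ → Fm C₁ Δ
  | _, _, _, _, .bot => .bot
  | _, _, g, s, .eq a b => .eq (a.bind g s) (b.bind g s)
  | _, _, g, s, .lt a b => .lt (a.bind g s) (b.bind g s)
  | _, _, g, s, .imp φ ψ => .imp (φ.bind g s) (ψ.bind g s)
  | _, _, g, s, .all σ φ => .all σ (φ.bind (fun ρ c => (g ρ c).wk) (up s))

/-- Substitution is the case of `bind` that fixes the constants. Through it the single composition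
law `Fm.bind_bind` gives all the laws that mix `bind` and `subst`. -/
theorem Tm.bind_cst (s : (ρ : Ty) → Var Γ ρ → Tm C Δ ρ) (t : Tm C Γ τ) :
    t.bind (fun _ c => .cst c) s = t.subst s := by
  induction t with
  | var v => rfl
  | cst c => rfl
  | app f a hf ha => simp [Tm.bind, Tm.subst, hf, ha]

theorem Fm.bind_cst (φ : Fm C Γ) (s : (ρ : Ty) → Var Γ ρ → Tm C Δ ρ) :
    φ.bind (fun _ c => .cst c) s = φ.subst s := by
  induction φ generalizing Δ with
  | bot => rfl
  | eq a b => simp [Fm.bind, Fm.subst, Tm.bind_cst]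
  | lt a b => simp [Fm.bind, Fm.subst, Tm.bind_cst]
  | imp φ ψ h₁ h₂ => simp [Fm.bind, Fm.subst, h₁, h₂]
  | all σ φ h => simpa [Fm.bind, Fm.subst, Tm.wk, Tm.subst] using h (up s)

theorem Tm.bind_bind (g : (ρ : Ty) → C ρ → Tm C₁ Δ ρ) (s : (ρ : Ty) → Var Γ ρ → Tm C₁ Δ ρ)
    (g' : (ρ : Ty) → C₁ ρ → Tm C₂ Θ ρ) (s' : (ρ : Ty) → Var Δ ρ → Tm C₂ Θ ρ) (t : Tm C Γ τ) :
    (t.bind g s).bind g' s' =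
      t.bind (fun ρ c => (g ρ c).bind g' s') (fun ρ v => (s ρ v).bind g' s') := by
  induction t with
  | var v => rfl
  | cst c => rfl
  | app f a hf ha => simp [Tm.bind, hf, ha]

theorem Tm.bind_wk (g : (ρ : Ty) → C ρ → Tm C₁ Δ ρ) (s : (ρ : Ty) → Var Γ ρ → Tm C₁ Δ ρ)
    (t : Tm C Γ τ) :
    (t.wk (σ := σ)).bind (fun ρ c => (g ρ c).wk) (up s) = (t.bind g s).wk := by
  simp only [Tm.wk, ← Tm.bind_cst, Tm.bind_bind]
  simp only [Tm.bind, up, Tm.wk, ← Tm.bind_cst]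

theorem up_bind (g : (ρ : Ty) → C ρ → Tm C₁ Δ ρ) (s : (ρ : Ty) → Var Γ ρ → Tm C₁ Δ ρ)
    (s₀ : (ρ : Ty) → Var Θ ρ → Tm C Γ ρ) :
    (fun ρ v => (up (σ := σ) s₀ ρ v).bind (fun ρ c => (g ρ c).wk) (up s)) =
      up (fun ρ v => (s₀ ρ v).bind g s) := by
  funext ρ v
  cases v with
  | zero => rfl
  | succ v => exact Tm.bind_wk g s _

theorem Fm.bind_bind (φ : Fm C Γ) (g : (ρ : Ty) → C ρ → Tm C₁ Δ ρ)
    (s : (ρ : Ty) → Var Γ ρ → Tm C₁ Δ ρ)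
    (g' : (ρ : Ty) → C₁ ρ → Tm C₂ Θ ρ) (s' : (ρ : Ty) → Var Δ ρ → Tm C₂ Θ ρ) :
    (φ.bind g s).bind g' s' =
      φ.bind (fun ρ c => (g ρ c).bind g' s') (fun ρ v => (s ρ v).bind g' s') := by
  induction φ generalizing Δ Θ with
  | bot => rfl
  | eq a b => simp [Fm.bind, Tm.bind_bind]
  | lt a b => simp [Fm.bind, Tm.bind_bind]
  | imp φ ψ h₁ h₂ => simp [Fm.bind, h₁, h₂]
  | all σ φ h => simp only [Fm.bind, h, up_bind, Tm.bind_wk]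

theorem Fm.bind_subst (φ : Fm C Γ) (s : (ρ : Ty) → Var Γ ρ → Tm C Δ ρ)
    (g' : (ρ : Ty) → C ρ → Tm C₂ Θ ρ) (s' : (ρ : Ty) → Var Δ ρ → Tm C₂ Θ ρ) :
    (φ.subst s).bind g' s' = φ.bind g' (fun ρ v => (s ρ v).bind g' s') := by
  rw [← Fm.bind_cst, Fm.bind_bind]; rfl

theorem Fm.subst_bind (φ : Fm C Γ) (g : (ρ : Ty) → C ρ → Tm C₁ Δ ρ)
    (s : (ρ : Ty) → Var Γ ρ → Tm C₁ Δ ρ) (s' : (ρ : Ty) → Var Δ ρ → Tm C₁ Θ ρ) :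
    (φ.bind g s).subst s' =
      φ.bind (fun ρ c => (g ρ c).subst s') (fun ρ v => (s ρ v).subst s') := by
  rw [← Fm.bind_cst, Fm.bind_bind]; simp only [Tm.bind_cst]

theorem Tm.subst_wk_inst (a : Tm C Γ τ) (t : Tm C Γ σ) : a.wk.subst (inst t) = a := by
  induction a with
  | var v => rfl
  | cst c => rfl
  | app f a hf ha => simp only [Tm.wk, Tm.subst] at hf ha ⊢; rw [hf, ha]

theorem Fm.bind_wk (φ : Fm C Γ) (g : (ρ : Ty) → C ρ → Tm C₁ Δ ρ)
    (s : (ρ : Ty) → Var Γ ρ → Tm C₁ Δ ρ) :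
    (φ.wk (σ := σ)).bind (fun ρ c => (g ρ c).wk) (up s) = (φ.bind g s).wk := by
  rw [Fm.wk, Fm.bind_subst, Fm.wk, Fm.subst_bind]; rfl

theorem Fm.bind_inst (φ : Fm C (σ :: Γ)) (t : Tm C Γ σ) (g : (ρ : Ty) → C ρ → Tm C₁ Δ ρ)
    (s : (ρ : Ty) → Var Γ ρ → Tm C₁ Δ ρ) :
    (φ.subst (inst t)).bind g s =
      (φ.bind (fun ρ c => (g ρ c).wk) (up s)).subst (inst (t.bind g s)) := by
  rw [Fm.bind_subst, Fm.subst_bind]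
  congr 1
  · funext ρ c; exact (Tm.subst_wk_inst _ _).symm
  · funext ρ v
    cases v with
    | zero => rfl
    | succ v => exact (Tm.subst_wk_inst _ _).symm

theorem Fm.bind_lift (φ : Fm C []) (g : (ρ : Ty) → C ρ → Tm C₁ Δ ρ)
    (s : (ρ : Ty) → Var Γ ρ → Tm C₁ Δ ρ) : (φ.lift).bind g s = φ.bind g noVar := by
  rw [Fm.lift, Fm.bind_subst]
  congr 1
  funext ρ v; cases v

theorem Fm.subst_lift (φ : Fm C []) (s : (ρ : Ty) → Var Γ ρ → Tm C Δ ρ) :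
    (φ.lift).subst s = φ.lift := by
  rw [← Fm.bind_cst, Fm.bind_lift, Fm.bind_cst]; rfl

theorem Tm.subst_var (t : Tm C Γ τ) : t.subst (fun _ v => .var v) = t := by
  induction t with
  | var v => rfl
  | cst c => rfl
  | app f a hf ha => simp [Tm.subst, hf, ha]

theorem up_var : up (σ := σ) (fun ρ (v : Var Γ ρ) => (.var v : Tm C Γ ρ)) = fun _ v => .var v := by
  funext ρ v
  cases v <;> rfl

theorem Fm.subst_var (φ : Fm C Γ) : φ.subst (fun _ v => .var v) = φ := by
  induction φ with
  | bot => rfl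
  | eq a b => simp [Fm.subst, Tm.subst_var]
  | lt a b => simp [Fm.subst, Tm.subst_var]
  | imp φ ψ h₁ h₂ => simp [Fm.subst, h₁, h₂]
  | all σ φ h => simp [Fm.subst, up_var, h]

theorem Fm.lift_nil (φ : Fm C []) : (φ.lift : Fm C []) = φ := by
  have : (noVar : (ρ : Ty) → Var [] ρ → Tm C [] ρ) = fun _ v => .var v := by
    funext ρ v; cases v
  rw [Fm.lift, this, Fm.subst_var]

/-- Derivations are preserved when the hypotheses are weakened. -/
theorem Derives.weaken {T : Set (Fm C [])} {H : List (Fm C Γ)} {φ : Fm C Γ}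
    (h : Derives T H φ) : ∀ {H' : List (Fm C Γ)}, H ⊆ H' → Derives T H' φ := by
  induction h with
  | thy h => intro H' _; exact .thy h
  | hyp h => intro H' hs; exact .hyp (hs h)
  | impI _ ih => intro H' hs; exact .impI (ih (List.cons_subset_cons _ hs))
  | impE _ _ ih₁ ih₂ => intro H' hs; exact .impE (ih₁ hs) (ih₂ hs)
  | raa _ ih => intro H' hs; exact .raa (ih (List.cons_subset_cons _ hs))
  | allI _ ih => intro H' hs; exact .allI (ih (List.map_subset _ hs))
  | allE t _ ih => intro H' hs; exact .allE t (ih hs)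
  | eqRefl t => intro H' _; exact .eqRefl t
  | eqSubst φ _ _ ih₁ ih₂ => intro H' hs; exact .eqSubst φ (ih₁ hs) (ih₂ hs)

/-- Derivations are preserved when constants and variables are replaced by terms. -/
theorem Derives.bind {T : Set (Fm C [])} {T' : Set (Fm C₁ [])} {H : List (Fm C Γ)} {φ : Fm C Γ}
    (h : Derives T H φ) : ∀ {Δ : List Ty} (g : (ρ : Ty) → C ρ → Tm C₁ Δ ρ)
      (s : (ρ : Ty) → Var Γ ρ → Tm C₁ Δ ρ)
      (_ : ∀ φ ∈ T, ∃ ψ ∈ T', φ.bind g noVar = ψ.lift),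
      Derives T' (H.map (Fm.bind g s)) (φ.bind g s) := by
  induction h with
  | thy h =>
    intro Δ g s hT
    obtain ⟨ψ, hψ, e⟩ := hT _ h
    rw [Fm.bind_lift, e]
    exact .thy hψ
  | hyp h => intro Δ g s _; exact .hyp (List.mem_map_of_mem h)
  | impI _ ih => intro Δ g s hT; exact .impI (ih g s hT)
  | impE _ _ ih₁ ih₂ => intro Δ g s hT; exact .impE (ih₁ g s hT) (ih₂ g s hT)
  | raa _ ih => intro Δ g s hT; exact .raa (ih g s hT)
  | @allI Γ H σ φ _ ih =>
    intro Δ g s hT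
    refine .allI ?_
    -- The image of an axiom is a lifted sentence, which weakening does not change, so `hT` passes
    -- to the context with one more variable.
    have := ih (fun ρ c => (g ρ c).wk (σ := σ)) (up s) fun φ hφ => by
      obtain ⟨ψ, hψ, e⟩ := hT φ hφ
      refine ⟨ψ, hψ, ?_⟩
      have e' := congrArg (Fm.wk (σ := σ)) e
      rw [Fm.wk, Fm.wk, Fm.subst_lift, Fm.subst_bind] at e'
      rw [← e']
      congr 1
      funext ρ v; cases v
    simpa only [List.map_map, Function.comp_def, Fm.bind_wk] using this
  | allE t _ ih => intro Δ g s hT; rw [Fm.bind_inst]; exact .allE _ (ih g s hT)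
  | eqRefl t => intro Δ g s _; exact .eqRefl _
  | eqSubst φ _ _ ih₁ ih₂ =>
    intro Δ g s hT
    have h₂ := ih₂ g s hT
    rw [Fm.bind_inst] at h₂ ⊢
    exact .eqSubst _ (ih₁ g s hT) h₂

end Bind

/-! ## Structures -/

/-- Structures for the many-sorted language; the prime formulas are interpreted by relations. -/
structure Str (C : Ty → Type) where
  car : Ty → Type
  app : {σ τ : Ty} → car (σ ⇒ τ) → car σ → car τ
  cst : {τ : Ty} → C τ → car τ
  eqv : car .nat → car .nat → Prop
  lt : car .nat → car .nat → Prop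

section Semantics

variable {C : Ty → Type} {Γ Δ : List Ty} {σ τ : Ty}

/-- Assignments. -/
abbrev Env (M : Str C) (Γ : List Ty) : Type := (ρ : Ty) → Var Γ ρ → M.car ρ

/-- The empty assignment. -/
def Env.nil {M : Str C} : Env M [] := fun _ v => nomatch v

/-- The extension of an assignment by a value of the most recent variable. -/
def Env.cons {M : Str C} (x : M.car σ) (e : Env M Γ) : Env M (σ :: Γ)
  | _, .zero => x
  | _, .succ v => e _ v

/-- The value of a term. -/
def Tm.eval {M : Str C} (e : Env M Γ) : {τ : Ty} → Tm C Γ τ → M.car τ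
  | _, .var v => e _ v
  | _, .cst c => M.cst c
  | _, .app f a => M.app (f.eval e) (a.eval e)

/-- Satisfaction. -/
def Fm.Sat {M : Str C} : {Γ : List Ty} → Env M Γ → Fm C Γ → Prop
  | _, _, .bot => False
  | _, e, .eq a b => M.eqv (a.eval e) (b.eval e)
  | _, e, .lt a b => M.lt (a.eval e) (b.eval e)
  | _, e, .imp φ ψ => φ.Sat e → ψ.Sat e
  | _, e, .all σ φ => ∀ x : M.car σ, φ.Sat (Env.cons x e)

theorem Tm.eval_subst {M : Str C} (s : (ρ : Ty) → Var Γ ρ → Tm C Δ ρ) (e : Env M Δ)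
    (t : Tm C Γ τ) : (t.subst s).eval e = t.eval (fun ρ v => (s ρ v).eval e) := by
  induction t with
  | var v => rfl
  | cst c => rfl
  | app f a hf ha => simp [Tm.eval, Tm.subst, hf, ha]

@[simp] theorem Tm.eval_wk {M : Str C} (e : Env M Γ) (x : M.car σ) (t : Tm C Γ τ) :
    t.wk.eval (Env.cons x e) = t.eval e := Tm.eval_subst _ _ _

theorem Fm.sat_subst {M : Str C} (φ : Fm C Γ) (s : (ρ : Ty) → Var Γ ρ → Tm C Δ ρ)
    (e : Env M Δ) : (φ.subst s).Sat e ↔ φ.Sat (fun ρ v => (s ρ v).eval e) := by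
  induction φ generalizing Δ with
  | bot => rfl
  | eq a b => simp [Fm.subst, Fm.Sat, Tm.eval_subst]
  | lt a b => simp [Fm.subst, Fm.Sat, Tm.eval_subst]
  | imp φ ψ h₁ h₂ => simp [Fm.subst, Fm.Sat, h₁, h₂]
  | all σ φ h =>
    simp only [Fm.subst, Fm.Sat, h]
    refine forall_congr' fun x => ?_
    have : (fun ρ v => (up s ρ v).eval (Env.cons x e)) =
        Env.cons x (fun ρ v => (s ρ v).eval e) := by
      funext ρ v
      cases v with
      | zero => rfl
      | succ v => exact Tm.eval_wk _ _ _
    rw [this]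

theorem Fm.sat_close {M : Str C} (φ : Fm C Γ) :
    φ.close.Sat (Env.nil : Env M []) ↔ ∀ e : Env M Γ, φ.Sat e := by
  induction Γ with
  | nil =>
    refine ⟨fun h e => ?_, fun h => h _⟩
    have : e = Env.nil := by funext ρ v; cases v
    exact this ▸ h
  | cons σ Γ ih =>
    rw [Fm.close, ih]
    refine ⟨fun h e => ?_, fun h e x => h _⟩
    have : e = Env.cons (e _ .zero) (fun ρ v => e ρ v.succ) := by
      funext ρ v; cases v <;> rfl
    rw [this]
    exact h _ _

/-- Pointwise equality in a structure. -/
def Str.Eqv (M : Str C) : (τ : Ty) → M.car τ → M.car τ → Prop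
  | .nat, a, b => M.eqv a b
  | .arr σ τ, f, g => ∀ x : M.car σ, M.Eqv τ (M.app f x) (M.app g x)

theorem sat_eqTy {M : Str C} (e : Env M Γ) (s t : Tm C Γ τ) :
    (eqTy τ s t).Sat e ↔ M.Eqv τ (s.eval e) (t.eval e) := by
  induction τ generalizing Γ with
  | nat => rfl
  | arr σ τ _ ih =>
    simp only [eqTy, Fm.Sat, Str.Eqv, ih]
    refine forall_congr' fun x => ?_
    simp [Tm.eval, Env.cons]

/-- Structures in which equality is the identity and all functions are extensional. -/
structure Str.IsExt (M : Str C) : Prop where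
  eqv_iff : ∀ a b, M.eqv a b ↔ a = b
  ext : ∀ {σ τ : Ty} (f g : M.car (σ ⇒ τ)), (∀ x, M.app f x = M.app g x) → f = g

/-- The condition under which the extensional collapse of a structure exists. -/
structure Str.IsCongr (M : Str C) : Prop where
  refl : ∀ a, M.eqv a a
  symm : ∀ a b, M.eqv a b → M.eqv b a
  trans : ∀ a b c, M.eqv a b → M.eqv b c → M.eqv a c
  lt : ∀ a b c d, M.eqv a b → M.eqv c d → M.lt a c → M.lt b d
  app : ∀ {σ τ : Ty} (f : M.car (σ ⇒ τ)) (a b : M.car σ), M.Eqv σ a b →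
    M.Eqv τ (M.app f a) (M.app f b)

theorem Str.IsCongr.equivalence {M : Str C} (h : M.IsCongr) (τ : Ty) :
    Equivalence (M.Eqv τ) := by
  induction τ with
  | nat => exact ⟨h.refl, fun {a b} => h.symm a b, fun {a b c} => h.trans a b c⟩
  | arr σ τ _ ih =>
    exact ⟨fun f x => ih.refl _, fun hf x => ih.symm (hf x), fun h₁ h₂ x => ih.trans (h₁ x) (h₂ x)⟩

/-- Pointwise equality as a setoid. -/
def Str.IsCongr.setoid {M : Str C} (h : M.IsCongr) (τ : Ty) : Setoid (M.car τ) :=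
  ⟨M.Eqv τ, h.equivalence τ⟩

/-- The extensional collapse. -/
def Str.IsCongr.collapse {M : Str C} (h : M.IsCongr) : Str C where
  car τ := Quotient (h.setoid τ)
  app {σ τ} := Quotient.map₂ (sa := h.setoid (σ ⇒ τ)) (sb := h.setoid σ) (sc := h.setoid τ) M.app
    fun f _ hf _ b hb => (h.equivalence τ).trans (h.app f _ _ hb) (hf b)
  cst c := Quotient.mk _ (M.cst c)
  eqv a b := a = b
  lt := Quotient.lift₂ (s₁ := h.setoid .nat) (s₂ := h.setoid .nat) M.lt fun _ _ _ _ h₁ h₂ =>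
    propext ⟨h.lt _ _ _ _ h₁ h₂, h.lt _ _ _ _ (h.symm _ _ h₁) (h.symm _ _ h₂)⟩

theorem Str.IsCongr.collapse_isExt {M : Str C} (h : M.IsCongr) : h.collapse.IsExt where
  eqv_iff _ _ := Iff.rfl
  ext {σ τ} f g hfg := by
    induction f using Quotient.ind
    induction g using Quotient.ind
    exact Quotient.sound (s := h.setoid (σ ⇒ τ)) fun x =>
      Quotient.exact (s := h.setoid τ) (hfg (Quotient.mk _ x))

theorem Str.IsCongr.collapse_eval {M : Str C} (h : M.IsCongr) (e : Env M Γ) (t : Tm C Γ τ) :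
    t.eval (M := h.collapse) (fun ρ v => Quotient.mk (h.setoid ρ) (e ρ v)) =
      Quotient.mk (h.setoid τ) (t.eval e) := by
  induction t with
  | var v => rfl
  | cst c => rfl
  | app f a hf ha => simp only [Tm.eval, hf, ha]; rfl

theorem Str.IsCongr.collapse_sat {M : Str C} (h : M.IsCongr) (φ : Fm C Γ) (e : Env M Γ) :
    φ.Sat (M := h.collapse) (fun ρ v => Quotient.mk (h.setoid ρ) (e ρ v)) ↔ φ.Sat e := by
  induction φ with
  | bot => rfl
  | eq a b =>
    simp only [Fm.Sat, h.collapse_eval]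
    exact Quotient.eq (r := h.setoid .nat)
  | lt a b => simp only [Fm.Sat, h.collapse_eval]; rfl
  | imp φ ψ h₁ h₂ => simp only [Fm.Sat, h₁, h₂]
  | @all Γ σ φ ih =>
    have key : ∀ x : M.car σ, Env.cons (M := h.collapse) (Quotient.mk (h.setoid σ) x)
        (fun ρ v => Quotient.mk (h.setoid ρ) (e ρ v)) =
        fun ρ v => Quotient.mk (h.setoid ρ) (Env.cons x e ρ v) := by
      intro x; funext ρ v; cases v <;> rfl
    simp only [Fm.Sat]
    refine ⟨fun hx x => ?_, fun hx x => ?_⟩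
    · rw [← ih, ← key]; exact hx _
    · induction x using Quotient.ind with
      | _ x => rw [key, ih]; exact hx x

end Semantics
end HOArith

namespace HOArith

/-! ## Countability of the language -/

/-- A numerical code of a type. -/
def Ty.code : Ty → ℕ
  | .nat => 0
  | .arr σ τ => Nat.pair σ.code τ.code + 1

theorem Ty.code_injective : Function.Injective Ty.code := by
  intro σ
  induction σ with
  | nat => intro τ h; cases τ <;> simp_all [Ty.code]
  | arr σ₁ σ₂ h₁ h₂ =>
    intro τ h
    cases τ with
    | nat => simp [Ty.code] at h
    | arr τ₁ τ₂ =>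
      simp only [Ty.code, Nat.add_right_cancel_iff, Nat.pair_eq_pair] at h
      rw [h₁ h.1, h₂ h.2]

section Code

variable {C : Ty → Type} {Γ : List Ty} {σ τ : Ty}

/-- The position of a variable. -/
def Var.code : {Γ : List Ty} → {τ : Ty} → Var Γ τ → ℕ
  | _, _, .zero => 0
  | _, _, .succ v => v.code + 1

theorem Var.code_injective (v : Var Γ σ) (w : Var Γ τ) (h : v.code = w.code) :
    (⟨σ, v⟩ : Σ ρ, Var Γ ρ) = ⟨τ, w⟩ := by
  induction v with
  | zero =>
    cases w with
    | zero => rfl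
    | succ w => simp [Var.code] at h
  | succ v ih =>
    cases w with
    | zero => simp [Var.code] at h
    | succ w =>
      have := ih w (by simpa [Var.code] using h)
      obtain ⟨rfl, h'⟩ := Sigma.mk.inj this
      rw [eq_of_heq h']

/-- A numerical code of a term. -/
def Tm.code (cd : (Σ ρ, C ρ) → ℕ) : {τ : Ty} → Tm C Γ τ → ℕ
  | _, .var v => Nat.pair 0 v.code
  | τ, .cst c => Nat.pair 1 (cd ⟨τ, c⟩)
  | _, .app f a => Nat.pair 2 (Nat.pair (f.code cd) (a.code cd))

theorem Tm.code_injective {cd : (Σ ρ, C ρ) → ℕ} (hcd : Function.Injective cd)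
    (s : Tm C Γ σ) (t : Tm C Γ τ) (h : s.code cd = t.code cd) :
    (⟨σ, s⟩ : Σ ρ, Tm C Γ ρ) = ⟨τ, t⟩ := by
  induction s generalizing τ with
  | var v =>
    cases t <;> simp only [Tm.code, Nat.pair_eq_pair] at h <;> try omega
    obtain ⟨rfl, h'⟩ := Sigma.mk.inj (Var.code_injective _ _ h.2)
    rw [eq_of_heq h']
  | cst c =>
    cases t <;> simp only [Tm.code, Nat.pair_eq_pair] at h <;> try omega
    obtain ⟨rfl, h'⟩ := Sigma.mk.inj (hcd h.2)
    rw [eq_of_heq h']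
  | app f a hf ha =>
    cases t <;> simp only [Tm.code, Nat.pair_eq_pair] at h <;> try omega
    obtain ⟨e, hf'⟩ := Sigma.mk.inj (hf _ h.2.1)
    cases e
    obtain ⟨_, ha'⟩ := Sigma.mk.inj (ha _ h.2.2)
    rw [eq_of_heq hf', eq_of_heq ha']

/-- A numerical code of a formula. -/
def Fm.code (cd : (Σ ρ, C ρ) → ℕ) : {Γ : List Ty} → Fm C Γ → ℕ
  | _, .bot => Nat.pair 0 0
  | _, .eq a b => Nat.pair 1 (Nat.pair (a.code cd) (b.code cd))
  | _, .lt a b => Nat.pair 2 (Nat.pair (a.code cd) (b.code cd))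
  | _, .imp φ ψ => Nat.pair 3 (Nat.pair (φ.code cd) (ψ.code cd))
  | _, .all σ φ => Nat.pair 4 (Nat.pair σ.code (φ.code cd))

theorem Fm.code_injective {cd : (Σ ρ, C ρ) → ℕ} (hcd : Function.Injective cd)
    (φ ψ : Fm C Γ) (h : φ.code cd = ψ.code cd) : φ = ψ := by
  have ht : ∀ {Γ : List Ty} (s t : Tm C Γ .nat), s.code cd = t.code cd → s = t := by
    intro Γ s t h
    obtain ⟨_, h'⟩ := Sigma.mk.inj (Tm.code_injective hcd s t h)
    exact eq_of_heq h'
  induction φ with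
  | bot => cases ψ <;> simp only [Fm.code, Nat.pair_eq_pair] at h <;> first | omega | rfl
  | eq a b =>
    cases ψ <;> simp only [Fm.code, Nat.pair_eq_pair] at h <;> try omega
    rw [ht _ _ h.2.1, ht _ _ h.2.2]
  | lt a b =>
    cases ψ <;> simp only [Fm.code, Nat.pair_eq_pair] at h <;> try omega
    rw [ht _ _ h.2.1, ht _ _ h.2.2]
  | imp φ ψ h₁ h₂ =>
    cases ‹Fm C _› <;> simp only [Fm.code, Nat.pair_eq_pair] at h <;> try omega
    rw [h₁ _ h.2.1, h₂ _ h.2.2]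
  | all σ φ ih =>
    cases ψ <;> simp only [Fm.code, Nat.pair_eq_pair] at h <;> try omega
    cases Ty.code_injective h.2.1
    rw [ih _ h.2.2]

/-- Countability lets all sentences be treated one by one along `ℕ`, so that only finitely many
constants are in use at each stage and a fresh one is available. -/
theorem Fm.countable (hC : Countable (Σ ρ, C ρ)) : Countable (Fm C Γ) := by
  obtain ⟨cd, hcd⟩ := hC
  exact ⟨⟨Fm.code cd, fun φ ψ h => Fm.code_injective hcd φ ψ h⟩⟩

end Code

/-- A numerical code of a constant. -/
def Const.code : {τ : Ty} → Const τ → ℕ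
  | _, .zero => Nat.pair 0 0
  | _, .one => Nat.pair 1 0
  | _, .add => Nat.pair 2 0
  | _, .mul => Nat.pair 3 0
  | _, .combK σ τ => Nat.pair 4 (Nat.pair σ.code τ.code)
  | _, .combS σ τ ρ => Nat.pair 5 (Nat.pair σ.code (Nat.pair τ.code ρ.code))
  | _, .recr σ => Nat.pair 6 σ.code

instance : Countable (Σ ρ, Const ρ) := by
  refine ⟨⟨fun c => c.2.code, ?_⟩⟩
  rintro ⟨σ, c⟩ ⟨τ, d⟩ h
  cases c <;> cases d <;> simp only [Const.code, Nat.pair_eq_pair] at h <;>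
    first
    | omega
    | rfl
    | (rw [Ty.code_injective h.2])
    | (rw [Ty.code_injective h.2.1, Ty.code_injective h.2.2])
    | (rw [Ty.code_injective h.2.1, Ty.code_injective h.2.2.1, Ty.code_injective h.2.2.2])

/-! ## Completeness -/

section Henkin

variable {C : Ty → Type} {Γ Δ : List Ty} {σ τ : Ty}

/-- The language with countably many new constants of each type. -/
abbrev WithHenkin (C : Ty → Type) (τ : Ty) : Type := C τ ⊕ ℕ

instance [Countable (Σ ρ, C ρ)] : Countable (Σ ρ, WithHenkin C ρ) := by
  obtain ⟨cd, hcd⟩ := ‹Countable (Σ ρ, C ρ)›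
  refine ⟨⟨fun c => match c with
    | ⟨ρ, .inl c⟩ => Nat.pair 0 (cd ⟨ρ, c⟩)
    | ⟨ρ, .inr n⟩ => Nat.pair 1 (Nat.pair ρ.code n), ?_⟩⟩
  rintro ⟨σ, c | n⟩ ⟨τ, d | m⟩ h <;> simp only [Nat.pair_eq_pair] at h <;> try omega
  · obtain ⟨rfl, h'⟩ := Sigma.mk.inj (hcd h.2)
    rw [eq_of_heq h']
  · cases Ty.code_injective h.2.1
    rw [h.2.2]

/-- The constants of the original language. -/
def oldCst (ρ : Ty) (c : C ρ) : Tm (WithHenkin C) Γ ρ := .cst (.inl c)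

/-- A sentence of the original language, read in the extended one. -/
def Fm.emb (φ : Fm C []) : Fm (WithHenkin C) [] := φ.bind oldCst noVar

/-- A strict upper bound for the numbers of the new constants in a term. -/
def Tm.bound : {τ : Ty} → Tm (WithHenkin C) Γ τ → ℕ
  | _, .var _ => 0
  | _, .cst (.inl _) => 0
  | _, .cst (.inr n) => n + 1
  | _, .app f a => max f.bound a.bound

/-- A strict upper bound for the numbers of the new constants in a formula. -/
def Fm.bound : {Γ : List Ty} → Fm (WithHenkin C) Γ → ℕ
  | _, .bot => 0
  | _, .eq a b => max a.bound b.bound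
  | _, .lt a b => max a.bound b.bound
  | _, .imp φ ψ => max φ.bound ψ.bound
  | _, .all _ φ => φ.bound

open Classical in
/-- The replacement of the new constant of type `σ` with number `n` by the term `t`. -/
noncomputable def replaceCst (n : ℕ) (t : Tm (WithHenkin C) Δ σ) (ρ : Ty) :
    WithHenkin C ρ → Tm (WithHenkin C) Δ ρ
  | .inl c => .cst (.inl c)
  | .inr m => if h : σ = ρ ∧ n = m then h.1 ▸ t else .cst (.inr m)

/-- The bound is strict, so the constant with number `n` does not occur and its replacement has no
effect. -/
theorem Tm.bind_replaceCst {n : ℕ} (t : Tm (WithHenkin C) Δ σ)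
    (s : (ρ : Ty) → Var Γ ρ → Tm (WithHenkin C) Δ ρ) (a : Tm (WithHenkin C) Γ τ)
    (h : a.bound ≤ n) : a.bind (replaceCst n t) s = a.subst s := by
  induction a with
  | var v => rfl
  | cst c =>
    cases c with
    | inl c => rfl
    | inr m =>
      simp only [Tm.bind, Tm.subst, replaceCst]
      exact dif_neg fun h' => by simp [Tm.bound, h'.2] at h
  | app f a hf ha =>
    simp only [Tm.bound, max_le_iff] at h
    simp only [Tm.bind, Tm.subst, hf h.1, ha h.2]

theorem replaceCst_wk (n : ℕ) (t : Tm (WithHenkin C) Δ σ) :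
    (fun ρ c => (replaceCst n t ρ c).wk) = replaceCst n (t.wk (σ := τ)) := by
  funext ρ c
  cases c with
  | inl c => rfl
  | inr m =>
    simp only [replaceCst]
    split_ifs with h
    · obtain ⟨rfl, _⟩ := h; rfl
    · rfl

theorem Fm.bind_replaceCst {n : ℕ} (φ : Fm (WithHenkin C) Γ) (t : Tm (WithHenkin C) Δ σ)
    (s : (ρ : Ty) → Var Γ ρ → Tm (WithHenkin C) Δ ρ)
    (h : φ.bound ≤ n) : φ.bind (replaceCst n t) s = φ.subst s := by
  induction φ generalizing Δ with
  | bot => rfl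
  | eq a b =>
    simp only [Fm.bound, max_le_iff] at h
    simp only [Fm.bind, Fm.subst, Tm.bind_replaceCst t s _ h.1, Tm.bind_replaceCst t s _ h.2]
  | lt a b =>
    simp only [Fm.bound, max_le_iff] at h
    simp only [Fm.bind, Fm.subst, Tm.bind_replaceCst t s _ h.1, Tm.bind_replaceCst t s _ h.2]
  | imp φ ψ h₁ h₂ =>
    simp only [Fm.bound, max_le_iff] at h
    simp only [Fm.bind, Fm.subst, h₁ t s h.1, h₂ t s h.2]
  | all σ φ ih =>
    simp only [Fm.bind, Fm.subst, replaceCst_wk]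
    rw [ih _ _ h]

variable (T : Set (Fm C []))

/-- Derivability in the extended language. -/
abbrev HDerives (H : List (Fm (WithHenkin C) Γ)) (φ : Fm (WithHenkin C) Γ) : Prop :=
  Derives (Fm.emb '' T) H φ

variable {T}

/-- A new constant that does not occur can be generalized. -/
theorem HDerives.generalize {H : List (Fm (WithHenkin C) [])} {φ : Fm (WithHenkin C) [σ]} {n : ℕ}
    (hH : ∀ ψ ∈ H, ψ.bound ≤ n) (hφ : φ.bound ≤ n)
    (h : HDerives T H (φ.subst (inst (.cst (.inr n))))) : HDerives T H (.all σ φ) := by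
  refine .allI ?_
  have hv : ∀ Δ : List Ty, ∀ s s' : (ρ : Ty) → Var [] ρ → Tm (WithHenkin C) Δ ρ, s = s' := by
    intro Δ s s'; funext ρ v; cases v
  -- The fresh constant is replaced by the new variable in the whole derivation. The hypotheses are
  -- merely weakened, and the instance of `φ` turns back into `φ`.
  have key := h.bind (T' := Fm.emb '' T) (replaceCst n (.var .zero : Tm (WithHenkin C) [σ] σ))
    noVar fun ψ hψ => by
      refine ⟨ψ, hψ, ?_⟩
      obtain ⟨χ, _, rfl⟩ := hψ
      rw [Fm.emb, Fm.bind_bind, Fm.lift, Fm.subst_bind]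
      congr 1
      exact hv _ _ _
  have e₁ : H.map (Fm.bind (replaceCst n (.var .zero : Tm (WithHenkin C) [σ] σ)) noVar) =
      H.map Fm.wk := by
    refine List.map_congr_left fun ψ hψ => ?_
    rw [Fm.bind_replaceCst ψ _ _ (hH ψ hψ), Fm.wk, hv _ noVar]
  have e₂ : (φ.subst (inst (.cst (.inr n)))).bind
      (replaceCst n (.var .zero : Tm (WithHenkin C) [σ] σ)) noVar = φ := by
    rw [Fm.bind_subst]
    have : (fun ρ v => (inst (.cst (.inr n)) ρ v).bind
        (replaceCst n (.var .zero : Tm (WithHenkin C) [σ] σ)) noVar) =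
        fun ρ (v : Var [σ] ρ) => (.var v : Tm (WithHenkin C) [σ] ρ) := by
      funext ρ v
      cases v with
      | zero => simp [inst, Tm.bind, replaceCst]
      | succ v => cases v
    rw [this, Fm.bind_replaceCst φ _ _ hφ, Fm.subst_var]
  rwa [e₁, e₂] at key

variable (T) in
open Classical in
/-- One step in the construction of a maximal consistent set with witnesses. -/
noncomputable def henkinStep (H : List (Fm (WithHenkin C) [])) :
    Fm (WithHenkin C) [] → List (Fm (WithHenkin C) [])
  | .all σ ψ =>
    if HDerives T (.all σ ψ :: H) .bot then
      -- The sum of the strict bounds exceeds the number of every new constant used so far, so the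
      -- constant for the counterexample is fresh.
      (ψ.subst (inst (.cst (.inr ((Fm.all σ ψ :: H).map Fm.bound).sum)))).neg ::
        (Fm.all σ ψ).neg :: H
    else .all σ ψ :: H
  | φ => if HDerives T (φ :: H) .bot then φ.neg :: H else φ :: H

variable (T) in
/-- The stages of the construction of a maximal consistent set with witnesses. -/
noncomputable def henkinChain (e : ℕ → Fm (WithHenkin C) []) (H : List (Fm (WithHenkin C) [])) :
    ℕ → List (Fm (WithHenkin C) [])
  | 0 => H
  | n + 1 => henkinStep T (henkinChain e H n) (e n)

theorem HDerives.of_neg {H : List (Fm (WithHenkin C) [])} {φ : Fm (WithHenkin C) []}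
    (h₁ : HDerives T (φ :: H) .bot) (h₂ : HDerives T (φ.neg :: H) .bot) : HDerives T H .bot :=
  .impE (.impI h₁) (.raa h₂)

theorem subset_henkinStep (H : List (Fm (WithHenkin C) [])) (φ : Fm (WithHenkin C) []) :
    H ⊆ henkinStep T H φ := by
  intro ψ hψ
  cases φ <;> simp only [henkinStep] <;> split_ifs <;> simp [hψ]

theorem mem_henkinStep (H : List (Fm (WithHenkin C) [])) (φ : Fm (WithHenkin C) []) :
    φ ∈ henkinStep T H φ ∨ φ.neg ∈ henkinStep T H φ := by
  cases φ <;> simp only [henkinStep] <;> split_ifs <;> simp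

/-- In the critical case a contradiction from the negated instance would prove the instance at a
fresh constant; generalizing it proves the universal formula, whose negation is also assumed. -/
theorem henkinStep_consistent {H : List (Fm (WithHenkin C) [])} (φ : Fm (WithHenkin C) [])
    (hH : ¬ HDerives T H .bot) : ¬ HDerives T (henkinStep T H φ) .bot := by
  cases φ with
  | all σ ψ =>
    simp only [henkinStep]
    split_ifs with h
    · intro h'
      refine hH (HDerives.of_neg h ?_)
      refine .impE (.hyp (φ := (Fm.all σ ψ).neg) (by simp)) (HDerives.generalize ?_ ?_ (.raa h'))
      · intro χ hχ
        rcases List.mem_cons.1 hχ with rfl | hχ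
        · simp [Fm.neg, Fm.bound]
        · simp only [List.map_cons, List.sum_cons]
          exact le_add_left (List.single_le_sum (by simp) _ (List.mem_map_of_mem hχ))
      · simp [Fm.bound]
    · exact h
  | _ =>
    simp only [henkinStep]
    split_ifs with h
    · exact fun h' => hH (HDerives.of_neg h h')
    · exact h

/-- Maximal consistent sets with witnesses. -/
structure IsHenkin (T : Set (Fm C [])) (W : Set (Fm (WithHenkin C) [])) : Prop where
  closed : ∀ {H : List (Fm (WithHenkin C) [])} {φ : Fm (WithHenkin C) []},
    (∀ ψ ∈ H, ψ ∈ W) → HDerives T H φ → φ ∈ W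
  bot : Fm.bot ∉ W
  neg : ∀ φ, φ ∈ W ∨ φ.neg ∈ W
  witness : ∀ {σ : Ty} (ψ : Fm (WithHenkin C) [σ]), (∀ t, ψ.subst (inst t) ∈ W) → .all σ ψ ∈ W

/-- Lindenbaum's argument: the set is the union of the stages. Finitely many hypotheses all lie in
one stage, whence closure under derivability, and a rejected universal sentence left a refuted
instance behind, whence the witness property. -/
theorem exists_isHenkin [Countable (Σ ρ, C ρ)] {H : List (Fm (WithHenkin C) [])}
    (hH : ¬ HDerives T H .bot) : ∃ W, IsHenkin T W ∧ ∀ φ ∈ H, φ ∈ W := by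
  have := Fm.countable (Γ := []) (C := WithHenkin C) inferInstance
  have : Nonempty (Fm (WithHenkin C) []) := ⟨.bot⟩
  obtain ⟨e, he⟩ := exists_surjective_nat (Fm (WithHenkin C) [])
  set c := henkinChain T e H with hc
  have mono : Monotone fun n => {φ | φ ∈ c n} :=
    monotone_nat_of_le_succ fun n φ hφ => subset_henkinStep _ _ hφ
  have cons : ∀ n, ¬ HDerives T (c n) .bot := by
    intro n
    induction n with
    | zero => exact hH
    | succ n ih => exact henkinStep_consistent _ ih
  have dec : ∀ φ, (∃ n, φ ∈ c n) ∨ ∃ n, φ.neg ∈ c n := by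
    intro φ
    obtain ⟨n, rfl⟩ := he φ
    exact (mem_henkinStep (T := T) (c n) (e n)).imp (fun h => ⟨n + 1, h⟩) (fun h => ⟨n + 1, h⟩)
  have common : ∀ L : List (Fm (WithHenkin C) []), (∀ ψ ∈ L, ∃ n, ψ ∈ c n) → ∃ n, L ⊆ c n := by
    intro L
    induction L with
    | nil => exact fun _ => ⟨0, by simp⟩
    | cons φ L ih =>
      intro h
      obtain ⟨n, hn⟩ := ih fun ψ hψ => h ψ (List.mem_cons_of_mem _ hψ)
      obtain ⟨m, hm⟩ := h φ (by simp)
      refine ⟨max n m, List.cons_subset.2 ⟨mono (le_max_right n m) hm, ?_⟩⟩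
      exact fun ψ hψ => mono (le_max_left n m) (hn hψ)
  have closed : ∀ {L : List (Fm (WithHenkin C) [])} {φ : Fm (WithHenkin C) []},
      (∀ ψ ∈ L, ∃ n, ψ ∈ c n) → HDerives T L φ → ∃ n, φ ∈ c n := by
    intro L φ hL hφ
    refine (dec φ).resolve_right fun ⟨n, hn⟩ => ?_
    obtain ⟨m, hm⟩ := common (φ.neg :: L) (List.forall_mem_cons.2 ⟨⟨n, hn⟩, hL⟩)
    exact cons m (.impE (.hyp (hm (a := φ.neg) (by simp))) (hφ.weaken fun ψ hψ => hm (by simp [hψ])))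
  have not_both : ∀ φ, (∃ n, φ ∈ c n) → (∃ n, φ.neg ∈ c n) → False := by
    intro φ h₁ h₂
    obtain ⟨m, hm⟩ := common [φ, φ.neg] (by simpa using ⟨h₁, h₂⟩)
    exact cons m (.impE (.hyp (hm (a := φ.neg) (by simp))) (.hyp (hm (by simp))))
  refine ⟨{φ | ∃ n, φ ∈ c n}, ⟨closed, ?_, dec, ?_⟩, fun φ hφ => ⟨0, hφ⟩⟩
  · rintro ⟨n, hn⟩
    exact cons n (.hyp hn)
  · intro σ ψ hψ
    obtain ⟨n, hn⟩ := he (.all σ ψ)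
    have hs : c (n + 1) = henkinStep T (c n) (.all σ ψ) := by rw [← hn]; rfl
    simp only [henkinStep] at hs
    split_ifs at hs with h
    · exact (not_both _ (hψ _) ⟨n + 1, by rw [hs]; exact List.mem_cons_self⟩).elim
    · exact ⟨n + 1, by rw [hs]; simp⟩

/-- The structure of closed terms. -/
def termStr (W : Set (Fm (WithHenkin C) [])) : Str C where
  car τ := Tm (WithHenkin C) [] τ
  app f a := f ⬝ a
  cst c := .cst (.inl c)
  eqv a b := (a ≐ b) ∈ W
  lt a b := (a ≺ b) ∈ W

theorem termStr_eval (W : Set (Fm (WithHenkin C) [])) (e : Env (termStr W) Γ) (t : Tm C Γ τ) :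
    t.eval e = t.bind oldCst e := by
  induction t with
  | var v => rfl
  | cst c => rfl
  | app f a hf ha => simp only [Tm.eval, hf, ha]; rfl

/-- The truth lemma. Maximality settles implications; since the universe consists of the closed
terms, the witness property settles quantifiers. -/
theorem termStr_sat {W : Set (Fm (WithHenkin C) [])} (hW : IsHenkin T W) (φ : Fm C Γ)
    (e : Env (termStr W) Γ) : φ.Sat e ↔ φ.bind oldCst e ∈ W := by
  induction φ with
  | bot => exact ⟨False.elim, hW.bot⟩
  | eq a b => simp only [Fm.Sat, termStr_eval]; rfl
  | lt a b => simp only [Fm.Sat, termStr_eval]; rfl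
  | imp φ ψ h₁ h₂ =>
    simp only [Fm.Sat, h₁, h₂, Fm.bind]
    refine ⟨fun h => ?_, fun h h' => ?_⟩
    · rcases hW.neg (φ.bind oldCst e) with h' | h'
      · exact hW.closed (H := [ψ.bind oldCst e]) (by simpa using h h') (.impI (.hyp (by simp)))
      · refine hW.closed (H := [(φ.bind oldCst e).neg]) (by simpa using h') (.impI (.raa ?_))
        exact .impE (.hyp (φ := (φ.bind oldCst e).neg) (by simp)) (.hyp (by simp))
    · refine hW.closed (H := [φ.bind oldCst e ⟹ ψ.bind oldCst e, φ.bind oldCst e])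
        (by simpa using ⟨h, h'⟩) ?_
      exact .impE (.hyp (by simp)) (.hyp (φ := φ.bind oldCst e) (by simp))
  | @all Γ σ φ ih =>
    have key : ∀ t : Tm (WithHenkin C) [] σ, φ.bind oldCst (Env.cons (M := termStr W) t e) =
        (φ.bind (fun ρ c => (oldCst ρ c).wk) (up e)).subst (inst t) := by
      intro t
      rw [Fm.subst_bind]
      congr 1
      funext ρ v
      cases v with
      | zero => rfl
      | succ v => exact (Tm.subst_wk_inst _ _).symm
    simp only [Fm.Sat, ih, Fm.bind]
    refine ⟨fun h => hW.witness _ fun t => key t ▸ h t, fun h t => ?_⟩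
    refine (key t).symm ▸ ?_
    exact hW.closed (H := [_]) (by simpa using h) (.allE t (.hyp (by simp)))

theorem termStr_model {W : Set (Fm (WithHenkin C) [])} (hW : IsHenkin T W) {φ : Fm C []}
    (hφ : φ ∈ T) : φ.Sat (Env.nil : Env (termStr W) []) := by
  rw [termStr_sat hW]
  refine hW.closed (H := []) (by simp) ?_
  have : φ.bind oldCst (Env.nil : Env (termStr W) []) = φ.emb.lift := by
    rw [Fm.lift_nil, Fm.emb]
    congr 1
  rw [this]
  exact .thy ⟨φ, hφ, rfl⟩

/-- The logic has equality rules at type 0 only. That application respects pointwise equality at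
higher types is exactly the content of the extensionality axioms in `hT`. -/
theorem termStr_isCongr {W : Set (Fm (WithHenkin C) [])} (hW : IsHenkin T W)
    (hT : ∀ ρ τ : Ty, Fm.close (Γ := [ρ, ρ, ρ ⇒ τ])
      (eqTy ρ (.var .zero) (.var (.succ .zero)) ⟹
        eqTy τ (.var (.succ (.succ .zero)) ⬝ .var .zero)
          (.var (.succ (.succ .zero)) ⬝ .var (.succ .zero))) ∈ T) : (termStr W).IsCongr := by
  have rw_eq : ∀ (φ : Fm (WithHenkin C) [.nat]) (a b : Tm (WithHenkin C) [] .nat),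
      (a ≐ b) ∈ W → φ.subst (inst a) ∈ W → φ.subst (inst b) ∈ W := by
    intro φ a b hab ha
    refine hW.closed (H := [a ≐ b, φ.subst (inst a)]) (by simpa using ⟨hab, ha⟩) ?_
    exact .eqSubst (s := a) φ (.hyp (by simp)) (.hyp (by simp))
  have refl : ∀ a : Tm (WithHenkin C) [] .nat, (a ≐ a) ∈ W :=
    fun a => hW.closed (H := []) (by simp) (.eqRefl a)
  have symm : ∀ a b : Tm (WithHenkin C) [] .nat, (a ≐ b) ∈ W → (b ≐ a) ∈ W := by
    intro a b hab
    have := rw_eq (.var .zero ≐ a.wk) a b hab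
    simp only [Fm.subst, Tm.subst_wk_inst] at this
    exact this (refl a)
  have trans : ∀ a b c : Tm (WithHenkin C) [] .nat, (a ≐ b) ∈ W → (b ≐ c) ∈ W → (a ≐ c) ∈ W := by
    intro a b c hab hbc
    have := rw_eq (a.wk ≐ .var .zero) b c hbc
    simp only [Fm.subst, Tm.subst_wk_inst] at this
    exact this hab
  have lt : ∀ a b c d : Tm (WithHenkin C) [] .nat, (a ≐ b) ∈ W → (c ≐ d) ∈ W → (a ≺ c) ∈ W →
      (b ≺ d) ∈ W := by
    intro a b c d hab hcd hac
    have h₁ := rw_eq (.var .zero ≺ c.wk) a b hab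
    have h₂ := rw_eq (b.wk ≺ .var .zero) c d hcd
    simp only [Fm.subst, Tm.subst_wk_inst] at h₁ h₂
    exact h₂ (h₁ hac)
  refine ⟨refl, symm, trans, lt, ?_⟩
  intro σ τ f a b hab
  have h := (Fm.sat_close _).1 (termStr_model hW (hT σ τ))
    (Env.cons (M := termStr W) a
      (Env.cons (M := termStr W) b (Env.cons (M := termStr W) f Env.nil)))
  simp only [Fm.Sat, sat_eqTy] at h
  exact h hab

/-- Completeness with respect to extensional structures. -/
theorem proves_of_sat [Countable (Σ ρ, C ρ)] (hC : ∀ ρ, Nonempty (Tm C [] ρ))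
    (hT : ∀ ρ τ : Ty, Fm.close (Γ := [ρ, ρ, ρ ⇒ τ])
      (eqTy ρ (.var .zero) (.var (.succ .zero)) ⟹
        eqTy τ (.var (.succ (.succ .zero)) ⬝ .var .zero)
          (.var (.succ (.succ .zero)) ⬝ .var (.succ .zero))) ∈ T) (φ : Fm C [])
    (h : ∀ M : Str C, M.IsExt → (∀ ψ ∈ T, ψ.Sat (Env.nil : Env M [])) →
      φ.Sat (Env.nil : Env M [])) : Proves T φ := by
  by_contra hφ
  have hcon : ¬ HDerives T [φ.emb.neg] .bot := by
    intro hd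
    apply hφ
    -- Sending the new constants to arbitrary closed terms turns a derivation in the extended
    -- language into one in the original language.
    let g : (ρ : Ty) → WithHenkin C ρ → Tm C [] ρ := fun ρ c => match c with
      | .inl c => .cst c
      | .inr _ => (hC ρ).some
    have key : ∀ ψ : Fm C [], ψ.emb.bind g noVar = ψ := by
      intro ψ
      rw [Fm.emb, Fm.bind_bind]
      have : ψ.bind (fun _ c => .cst c) noVar = (ψ.lift : Fm C []) := Fm.bind_cst _ _
      rw [Fm.lift_nil] at this
      refine Eq.trans ?_ this
      congr 1
      funext ρ v; cases v
    have := (Derives.raa hd).bind (T' := T) g noVar (by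
      rintro _ ⟨ψ, hψ, rfl⟩
      exact ⟨ψ, hψ, by rw [key, Fm.lift_nil]⟩)
    rwa [key] at this
  obtain ⟨W, hW, hmem⟩ := exists_isHenkin hcon
  have hc := termStr_isCongr hW hT
  have collapse : ∀ ψ : Fm C [], ψ.Sat (Env.nil : Env hc.collapse []) ↔
      ψ.Sat (Env.nil : Env (termStr W) []) := by
    intro ψ
    rw [← hc.collapse_sat]
    have : (Env.nil : Env hc.collapse []) =
        fun ρ v => Quotient.mk (hc.setoid ρ) ((Env.nil : Env (termStr W) []) ρ v) := by
      funext ρ v; cases v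
    rw [this]
  have hs := h hc.collapse hc.collapse_isExt fun ψ hψ => (collapse ψ).2 (termStr_model hW hψ)
  rw [collapse, termStr_sat hW] at hs
  refine hW.bot (hW.closed (H := [φ.emb.neg, φ.emb]) ?_ ?_)
  · have : φ.bind oldCst (Env.nil : Env (termStr W) []) = φ.emb := by
      rw [Fm.emb]
      congr 1
    rw [this] at hs
    simpa using ⟨hmem _ (by simp), hs⟩
  · exact .impE (.hyp (φ := φ.emb.neg) (by simp)) (.hyp (by simp))

end Henkin
end HOArith

namespace HOArith

/-! ## Evaluation in structures for higher-order arithmetic -/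

section Evaluation

variable {M : Str Const} {Γ : List Ty} {σ τ : Ty}

instance : CoeFun (M.car (σ ⇒ τ)) (fun _ => M.car σ → M.car τ) :=
  ⟨M.app⟩

instance : Zero (M.car .nat) := ⟨M.cst .zero⟩
instance : One (M.car .nat) := ⟨M.cst .one⟩
instance : Add (M.car .nat) := ⟨fun a b => (M.cst .add : M.car (.nat ⇒ .nat ⇒ .nat)) a b⟩
instance : Mul (M.car .nat) := ⟨fun a b => (M.cst .mul : M.car (.nat ⇒ .nat ⇒ .nat)) a b⟩
instance : LT (M.car .nat) := ⟨M.lt⟩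

/-- The recursor of the model. -/
def Str.recN (M : Str Const) (f : M.car (.nat ⇒ .nat ⇒ .nat)) (m n : M.car .nat) : M.car .nat :=
  (M.cst (.recr .nat) : M.car ((.nat ⇒ .nat ⇒ .nat) ⇒ .nat ⇒ .nat ⇒ .nat)) f m n

@[simp] theorem eval_zero (e : Env M Γ) : (zero : Term Γ .nat).eval e = 0 := rfl
@[simp] theorem eval_one (e : Env M Γ) : (one : Term Γ .nat).eval e = 1 := rfl
@[simp] theorem eval_add (e : Env M Γ) (s t : Term Γ .nat) :
    (add s t).eval e = s.eval e + t.eval e := rfl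
@[simp] theorem eval_mul (e : Env M Γ) (s t : Term Γ .nat) :
    (mul s t).eval e = s.eval e * t.eval e := rfl
@[simp] theorem eval_suc (e : Env M Γ) (t : Term Γ .nat) : (suc t).eval e = t.eval e + 1 := rfl
@[simp] theorem eval_two (e : Env M Γ) : (two : Term Γ .nat).eval e = 1 + 1 := rfl
@[simp] theorem eval_rec0 (e : Env M Γ) (f : Term Γ (.nat ⇒ .nat ⇒ .nat)) (m n : Term Γ .nat) :
    (rec0 f m n).eval e = M.recN (f.eval e) (m.eval e) (n.eval e) := rfl
@[simp] theorem eval_app (e : Env M Γ) (f : Term Γ (σ ⇒ τ)) (t : Term Γ σ) :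
    (f ⬝ t).eval e = f.eval e (t.eval e) := rfl
@[simp] theorem eval_var (e : Env M Γ) (v : Var Γ τ) : (.var v : Term Γ τ).eval e = e τ v := rfl
@[simp] theorem cons_zero (e : Env M Γ) (x : M.car σ) : Env.cons x e σ .zero = x := rfl
@[simp] theorem cons_succ (e : Env M Γ) (x : M.car σ) (v : Var Γ τ) :
    Env.cons x e τ v.succ = e τ v := rfl

@[simp] theorem sat_bot (e : Env M Γ) : Fm.Sat e (.bot : Formula Γ) ↔ False := Iff.rfl
@[simp] theorem sat_lt (e : Env M Γ) (s t : Term Γ .nat) :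
    Fm.Sat e (s ≺ t) ↔ s.eval e < t.eval e := Iff.rfl
@[simp] theorem sat_imp (e : Env M Γ) (φ ψ : Formula Γ) :
    Fm.Sat e (φ ⟹ ψ) ↔ (φ.Sat e → ψ.Sat e) := Iff.rfl
@[simp] theorem sat_all (e : Env M Γ) (φ : Formula (σ :: Γ)) :
    Fm.Sat e (.all σ φ) ↔ ∀ x : M.car σ, φ.Sat (Env.cons x e) := Iff.rfl
@[simp] theorem sat_neg (e : Env M Γ) (φ : Formula Γ) : Fm.Sat e φ.neg ↔ ¬ φ.Sat e := Iff.rfl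
@[simp] theorem sat_or (e : Env M Γ) (φ ψ : Formula Γ) :
    Fm.Sat e (φ.or ψ) ↔ φ.Sat e ∨ ψ.Sat e := by
  simp only [Fm.or, sat_imp, sat_neg]; tauto
@[simp] theorem sat_and (e : Env M Γ) (φ ψ : Formula Γ) :
    Fm.Sat e (φ.and ψ) ↔ φ.Sat e ∧ ψ.Sat e := by
  simp only [Fm.and, sat_imp, sat_neg]; tauto
@[simp] theorem sat_ex (e : Env M Γ) (φ : Formula (σ :: Γ)) :
    Fm.Sat e (.ex σ φ) ↔ ∃ x : M.car σ, φ.Sat (Env.cons x e) := by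
  simp only [Fm.ex, sat_all, sat_neg, not_forall, not_not]

end Evaluation

/-! ## Models of `ACA₀^ω` -/

/-- Extensional models of `ACA₀^ω`. -/
class Model (M : Str Const) : Prop where
  isExt : M.IsExt
  sat : ∀ φ ∈ ACA0, φ.Sat (Env.nil : Env M [])

section Model

variable {M : Str Const} [Model M] {Γ : List Ty} {σ τ ρ : Ty}

theorem Model.eqv_iff (a b : M.car .nat) : M.eqv a b ↔ a = b := Model.isExt.eqv_iff a b

theorem Model.ext {f g : M.car (σ ⇒ τ)} (h : ∀ x, f x = g x) : f = g := Model.isExt.ext f g h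

theorem Model.ext₂ {f g : M.car (σ ⇒ τ ⇒ ρ)} (h : ∀ x y, f x y = g x y) : f = g :=
  Model.ext fun x => Model.ext fun y => h x y

theorem Model.eqvTy_iff (a b : M.car τ) : M.Eqv τ a b ↔ a = b := by
  induction τ with
  | nat => exact Model.eqv_iff a b
  | arr σ τ _ ih => exact ⟨fun h => Model.ext fun x => (ih _ _).1 (h x), fun h x => by rw [h, ih]⟩

@[simp] theorem sat_eq (e : Env M Γ) (s t : Term Γ .nat) :
    Fm.Sat e (s ≐ t) ↔ s.eval e = t.eval e := Model.eqv_iff _ _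
theorem Model.rca0 {φ : Formula Γ} (h : RCA0 φ.close) (e : Env M Γ) : φ.Sat e :=
  (Fm.sat_close _).1 (Model.sat _ (Or.inl h)) e

theorem combK_app (a : M.car σ) (b : M.car τ) : (M.cst (.combK σ τ) : M.car (σ ⇒ τ ⇒ σ)) a b = a := by
  have h := Model.rca0 (RCA0.combK σ τ) (Env.cons a (Env.cons b (Env.nil : Env M [])))
  rw [sat_eqTy, Model.eqvTy_iff] at h
  exact h

theorem combS_app (a : M.car (σ ⇒ τ ⇒ ρ)) (b : M.car (σ ⇒ τ)) (c : M.car σ) :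
    (M.cst (.combS σ τ ρ) : M.car ((σ ⇒ τ ⇒ ρ) ⇒ (σ ⇒ τ) ⇒ σ ⇒ ρ)) a b c = a c (b c) := by
  have h := Model.rca0 (RCA0.combS σ τ ρ)
    (Env.cons a (Env.cons b (Env.cons c (Env.nil : Env M []))))
  rw [sat_eqTy, Model.eqvTy_iff] at h
  exact h

-- Combinatory completeness: the equations for `Π` and `Σ` yield β-conversion by recursion along the
-- bracket abstraction.
@[simp] theorem eval_lam_app (t : Term (σ :: Γ) τ) (e : Env M Γ) (x : M.car σ) :
    (lam t).eval e x = t.eval (Env.cons x e) := by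
  induction t with
  | var v =>
    cases v with
    | zero => simp only [lam, Tm.eval, S, K, combS_app, combK_app]; rfl
    | succ v => simp only [lam, Tm.eval, K, combK_app]; rfl
  | cst c => simp only [lam, Tm.eval, K, combK_app]
  | app f a hf ha => simp only [lam, Tm.eval, S, combS_app, hf, ha]

/-! ### The ordered semiring of numbers -/

theorem basic₁ {φ : Formula [.nat]} (h : OrderedSemiring φ.close) (a : M.car .nat) :
    φ.Sat (Env.cons a (Env.nil : Env M [])) :=
  Model.rca0 (.basic h) _

theorem basic₂ {φ : Formula [.nat, .nat]} (h : OrderedSemiring φ.close) (a b : M.car .nat) :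
    φ.Sat (Env.cons a (Env.cons b (Env.nil : Env M []))) :=
  Model.rca0 (.basic h) _

theorem basic₃ {φ : Formula [.nat, .nat, .nat]} (h : OrderedSemiring φ.close) (a b c : M.car .nat) :
    φ.Sat (Env.cons a (Env.cons b (Env.cons c (Env.nil : Env M [])))) :=
  Model.rca0 (.basic h) _

instance : CommSemiring (M.car .nat) where
  add_assoc a b c := (Model.eqv_iff _ _).1 (basic₃ .add_assoc a b c)
  add_comm a b := (Model.eqv_iff _ _).1 (basic₂ .add_comm a b)
  add_zero a := (Model.eqv_iff _ _).1 (basic₁ .add_zero a)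
  zero_add a := ((Model.eqv_iff _ _).1 (basic₂ .add_comm 0 a)).trans
    ((Model.eqv_iff _ _).1 (basic₁ .add_zero a))
  mul_assoc a b c := (Model.eqv_iff _ _).1 (basic₃ .mul_assoc a b c)
  mul_comm a b := (Model.eqv_iff _ _).1 (basic₂ .mul_comm a b)
  mul_one a := (Model.eqv_iff _ _).1 (basic₁ .mul_one a)
  one_mul a := ((Model.eqv_iff _ _).1 (basic₂ .mul_comm 1 a)).trans
    ((Model.eqv_iff _ _).1 (basic₁ .mul_one a))
  mul_zero a := (Model.eqv_iff _ _).1 (basic₁ .mul_zero a)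
  zero_mul a := ((Model.eqv_iff _ _).1 (basic₂ .mul_comm 0 a)).trans
    ((Model.eqv_iff _ _).1 (basic₁ .mul_zero a))
  left_distrib a b c := (Model.eqv_iff _ _).1 (basic₃ .mul_add a b c)
  right_distrib a b c := by
    have comm : ∀ a b : M.car .nat, a * b = b * a :=
      fun a b => (Model.eqv_iff _ _).1 (basic₂ .mul_comm a b)
    rw [comm, comm a, comm b]
    exact (Model.eqv_iff _ _).1 (basic₃ .mul_add c a b)
  nsmul := nsmulRec

theorem nat_lt_total (a b : M.car .nat) : a < b ∨ a = b ∨ b < a := by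
  have h := basic₂ (M := M) .lt_total a b
  simp only [Fm.or, Fm.neg, Fm.Sat, Model.eqv_iff] at h
  change (¬ a < b) → (¬ a = b) → b < a at h
  tauto

open Classical in
noncomputable instance : LinearOrder (M.car .nat) where
  le a b := a < b ∨ a = b
  lt a b := a < b
  le_refl a := Or.inr rfl
  le_trans a b c := by
    rintro (h₁ | rfl) (h₂ | rfl)
    · exact Or.inl (basic₃ (M := M) .lt_trans a b c h₁ h₂)
    · exact Or.inl h₁
    · exact Or.inl h₂
    · exact Or.inr rfl
  le_antisymm a b := by
    rintro (h₁ | rfl) (h₂ | h₂)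
    · exact (basic₁ (M := M) .lt_irrefl a (basic₃ (M := M) .lt_trans a b a h₁ h₂)).elim
    · exact h₂.symm
    · rfl
    · rfl
  le_total a b := by
    rcases nat_lt_total a b with h | h | h
    · exact Or.inl (Or.inl h)
    · exact Or.inl (Or.inr h)
    · exact Or.inr (Or.inl h)
  lt_iff_le_not_ge a b := by
    have irr : ∀ a : M.car .nat, ¬ a < a := fun a => basic₁ (M := M) .lt_irrefl a
    have tr : ∀ a b c : M.car .nat, a < b → b < c → a < c := fun a b c =>
      basic₃ (M := M) .lt_trans a b c
    constructor
    · rintro h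
      refine ⟨Or.inl h, ?_⟩
      rintro (h' | rfl)
      · exact irr _ (tr _ _ _ h h')
      · exact irr _ h
    · rintro ⟨h | rfl, h'⟩
      · exact h
      · exact (h' (Or.inr rfl)).elim
  toDecidableLE := Classical.decRel _

instance : IsStrictOrderedRing (M.car .nat) := by
  have add_lt : ∀ a b c : M.car .nat, a < b → a + c < b + c :=
    fun a b c => basic₃ (M := M) .add_lt_add a b c
  have mul_lt : ∀ a b c : M.car .nat, a < b → 0 < c → a * c < b * c :=
    fun a b c => basic₃ (M := M) .mul_lt_mul a b c
  have zl : (0 : M.car .nat) < 1 := Model.sat (M := M) _ (Or.inl (.basic .zero_lt_one))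
  refine
    { add_le_add_left := ?_, le_of_add_le_add_left := ?_, zero_le_one := zl.le, exists_pair_ne :=
      ⟨0, 1, zl.ne⟩, mul_lt_mul_of_pos_left := ?_, mul_lt_mul_of_pos_right := ?_ }
  · intro a b h c
    rcases h.lt_or_eq with h | rfl
    · exact (add_lt _ _ _ h).le
    · exact le_rfl
  · intro a b c h
    by_contra h'
    have := add_lt _ _ a (not_le.1 h')
    rw [add_comm c, add_comm b] at this
    exact absurd h (not_le.2 this)
  · intro a ha b c h
    simpa only [mul_comm a] using mul_lt _ _ _ h ha
  · intro a ha b c h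
    exact mul_lt _ _ _ h ha

theorem recN_zero (f : M.car (.nat ⇒ .nat ⇒ .nat)) (m : M.car .nat) : M.recN f m 0 = m :=
  (Model.eqv_iff _ _).1 (Model.rca0 RCA0.rec_zero (Env.cons f (Env.cons m (Env.nil : Env M []))))

theorem recN_succ (f : M.car (.nat ⇒ .nat ⇒ .nat)) (m n : M.car .nat) :
    M.recN f m (n + 1) = f n (M.recN f m n) :=
  (Model.eqv_iff _ _).1 (Model.rca0 RCA0.rec_succ
    (Env.cons f (Env.cons m (Env.cons n (Env.nil : Env M [])))))

end Model
end HOArith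

namespace HOArith

section Internal

variable {M : Str Const} {X Y Z : Type} {σ τ ρ : Ty}

/-! ### Internal functions -/

/-- Types `X` with a notion of internal functions from `X` to the carriers of `M`. -/
class Obj (M : Str Const) (X : Type) where
  int : {τ : Ty} → (X → M.car τ) → Prop
  const : ∀ {τ : Ty} (c : M.car τ), int fun _ => c
  app : ∀ {σ τ : Ty} {f : X → M.car (σ ⇒ τ)} {g : X → M.car σ}, int f → int g →
    int fun x => f x (g x)

/-- Internal functions: those that pull back internal functions to internal functions. -/
@[fun_prop]
structure Internal (M : Str Const) [Obj M X] [Obj M Y] (f : X → Y) : Prop where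
  int_comp : ∀ {τ : Ty} (g : Y → M.car τ), Obj.int g → Obj.int fun x => g (f x)

instance : Obj M Unit := ⟨fun _ => True, fun _ => trivial, fun _ _ => trivial⟩

/-- Since every function out of `Prop` counts as internal, a predicate is internal exactly when all
definitions by cases on it, with constant values, are internal. -/
instance : Obj M Prop := ⟨fun _ => True, fun _ => trivial, fun _ _ => trivial⟩

@[fun_prop] theorem Internal.id [Obj M X] : Internal M fun x : X => x := ⟨fun _ h => h⟩

@[fun_prop] theorem Internal.const [Obj M X] [Obj M Y] (y : Y) : Internal M fun _ : X => y :=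
  ⟨fun _ _ => Obj.const _⟩

@[fun_prop] theorem Internal.comp [Obj M X] [Obj M Y] [Obj M Z] {f : Y → Z} {g : X → Y}
    (hf : Internal M f) (hg : Internal M g) : Internal M fun x => f (g x) :=
  ⟨fun _ h => hg.int_comp _ (hf.int_comp _ h)⟩

@[fun_prop] theorem Internal.not [Obj M X] {P : X → Prop} (hP : Internal M P) :
    Internal M fun x => ¬ P x := ⟨fun g _ => hP.int_comp (fun p => g (¬ p)) trivial⟩

theorem Internal.congr [Obj M X] {P Q : X → Prop} (hP : Internal M P) (h : ∀ x, P x ↔ Q x) :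
    Internal M Q := by
  rwa [← show P = Q from funext fun x => propext (h x)]

/-- The predecessor. -/
def Str.prd (M : Str Const) (n : M.car .nat) : M.car .nat :=
  (HOArith.prd (Γ := [.nat]) v0).eval (Env.cons n Env.nil)

theorem eval_prd {Γ : List Ty} (e : Env M Γ) (t : Term Γ .nat) :
    (HOArith.prd t).eval e = M.prd (t.eval e) := rfl

instance : Sub (M.car .nat) := ⟨fun a b => (monus v0 v1).eval (Env.cons a (Env.cons b Env.nil))⟩

@[simp] theorem eval_monus {Γ : List Ty} (e : Env M Γ) (s t : Term Γ .nat) :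
    (monus s t).eval e = s.eval e - t.eval e := by
  change M.recN _ _ _ = M.recN _ _ _
  congr 1

variable [Model M]

/-- Internal here means represented by an element of the model; `Π` represents constants and `Σ`
represents pointwise application. -/
instance : Obj M (M.car σ) where
  int {τ} f := ∃ F : M.car (σ ⇒ τ), ∀ x, F x = f x
  const {τ} c := ⟨(M.cst (.combK τ σ) : M.car (τ ⇒ σ ⇒ τ)) c, fun _ => combK_app _ _⟩
  app {σ' τ f g} := by
    rintro ⟨F, hF⟩ ⟨G, hG⟩
    exact ⟨(M.cst (.combS σ σ' τ) : M.car ((σ ⇒ σ' ⇒ τ) ⇒ (σ ⇒ σ') ⇒ σ ⇒ τ)) F G,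
      fun x => by rw [combS_app, hF, hG]⟩

/-- The finite types have no products, so the last argument is curried into the model and the
remaining ones stay in `X`. -/
instance [Obj M X] : Obj M (X × M.car σ) where
  int {τ} f := ∃ F : X → M.car (σ ⇒ τ), Obj.int F ∧ ∀ x y, F x y = f (x, y)
  const {τ} c := ⟨_, Obj.const ((M.cst (.combK τ σ) : M.car (τ ⇒ σ ⇒ τ)) c),
    fun _ _ => combK_app _ _⟩
  app {σ' τ f g} := by
    rintro ⟨F, hF, hF'⟩ ⟨G, hG, hG'⟩
    exact ⟨_, Obj.app (Obj.app (Obj.const (M.cst (.combS σ σ' τ) :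
      M.car ((σ ⇒ σ' ⇒ τ) ⇒ (σ ⇒ σ') ⇒ σ ⇒ τ))) hF) hG,
      fun x y => by rw [combS_app, hF', hG']⟩

variable [Obj M X] [Obj M Y]

theorem obj_int_id : Obj.int (M := M) fun x : M.car σ => x :=
  ⟨(M.cst (.combS σ (σ ⇒ σ) σ) : M.car ((σ ⇒ (σ ⇒ σ) ⇒ σ) ⇒ (σ ⇒ σ ⇒ σ) ⇒ σ ⇒ σ))
    (M.cst (.combK σ (σ ⇒ σ))) (M.cst (.combK σ σ)), fun x => by rw [combS_app, combK_app]⟩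

/-- When the values lie in a carrier, the functions to be pulled back are represented in the model,
so composing with them is a mere application. -/
theorem internal_iff {f : X → M.car σ} : Internal M f ↔ Obj.int f := by
  refine ⟨fun h => h.int_comp _ obj_int_id, fun h => ⟨fun {τ} g hg => ?_⟩⟩
  obtain ⟨G, hG⟩ := hg
  simp only [← hG]
  exact Obj.app (Obj.const G) h

@[fun_prop] theorem Internal.app {f : X → M.car (σ ⇒ τ)} {g : X → M.car σ} (hf : Internal M f)
    (hg : Internal M g) : Internal M fun x => f x (g x) := by
  rw [internal_iff] at *; exact Obj.app hf hg

@[fun_prop] theorem Internal.fst : Internal M (Prod.fst : X × M.car σ → X) := by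
  refine ⟨fun {τ} g hg => ?_⟩
  exact ⟨_, Obj.app (Obj.const (M.cst (.combK τ σ) : M.car (τ ⇒ σ ⇒ τ))) hg,
    fun x y => combK_app _ _⟩

@[fun_prop] theorem Internal.snd : Internal M (Prod.snd : X × M.car σ → M.car σ) := by
  rw [internal_iff]
  obtain ⟨F, hF⟩ := obj_int_id (M := M) (σ := σ)
  exact ⟨_, Obj.const F, fun _ y => hF y⟩

@[fun_prop] theorem Internal.prodMk {f : X → Y} {g : X → M.car σ} (hf : Internal M f)
    (hg : Internal M g) : Internal M fun x => (f x, g x) := by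
  refine ⟨fun {τ} h ⟨H, hH, hH'⟩ => ?_⟩
  simp only [← hH']
  exact Obj.app (hf.int_comp _ hH) (internal_iff.1 hg)

theorem Internal.exists_lam {f : X → M.car σ → M.car τ}
    (hf : Internal M fun p : X × M.car σ => f p.1 p.2) :
    ∃ F : X → M.car (σ ⇒ τ), Internal M F ∧ ∀ x y, F x y = f x y := by
  rw [internal_iff] at hf
  obtain ⟨F, hF, h⟩ := hf
  exact ⟨F, internal_iff.2 hF, h⟩

theorem Internal.exists_app {f : M.car σ → M.car τ} (hf : Internal M f) :
    ∃ F : M.car (σ ⇒ τ), ∀ x, F x = f x := internal_iff.1 hf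

theorem Internal.exists_app₂ {f : M.car σ → M.car τ → M.car ρ}
    (hf : Internal M fun p : M.car σ × M.car τ => f p.1 p.2) :
    ∃ F : M.car (σ ⇒ τ ⇒ ρ), ∀ x y, F x y = f x y := by
  obtain ⟨G, hG, h⟩ := hf.exists_lam
  obtain ⟨F, hF⟩ := hG.exists_app
  exact ⟨F, fun x y => by rw [hF, h]⟩

theorem Internal.exists_app₃ {υ : Ty} {f : M.car σ → M.car τ → M.car ρ → M.car υ}
    (hf : Internal M fun p : (M.car σ × M.car τ) × M.car ρ => f p.1.1 p.1.2 p.2) :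
    ∃ F : M.car (σ ⇒ τ ⇒ ρ ⇒ υ), ∀ x y z, F x y z = f x y z := by
  obtain ⟨G, hG, h⟩ := Internal.exists_lam (X := M.car σ × M.car τ)
    (f := fun p z => f p.1 p.2 z) hf
  obtain ⟨F, hF⟩ := Internal.exists_app₂ (f := fun x y => G (x, y)) hG
  exact ⟨F, fun x y z => by rw [hF, h]⟩

@[fun_prop] theorem Internal.add {f g : X → M.car .nat} (hf : Internal M f) (hg : Internal M g) :
    Internal M fun x => f x + g x := Internal.app (Internal.app (Internal.const _) hf) hg

@[fun_prop] theorem Internal.mul {f g : X → M.car .nat} (hf : Internal M f) (hg : Internal M g) :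
    Internal M fun x => f x * g x := Internal.app (Internal.app (Internal.const _) hf) hg

@[fun_prop] theorem Internal.recN {f : X → M.car (.nat ⇒ .nat ⇒ .nat)} {g h : X → M.car .nat}
    (hf : Internal M f) (hg : Internal M g) (hh : Internal M h) :
    Internal M fun x => M.recN (f x) (g x) (h x) :=
  Internal.app (Internal.app (Internal.app (Internal.const _) hf) hg) hh

/-! ### Predecessor and cut-off subtraction -/

/-- One instance of quantifier-free induction with four function parameters. It is all that is
needed until internal predicates have characteristic functions. -/
theorem nat_induction_of_app (f g h k : M.car .one) (h0 : f 0 < g 0 → h 0 = k 0)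
    (hs : ∀ n, (f n < g n → h n = k n) → f (n + 1) < g (n + 1) → h (n + 1) = k (n + 1))
    (n : M.car .nat) : f n < g n → h n = k n := by
  have H := Model.rca0 (M := M) (.ind (QFIND.mk (Γ := [.one, .one, .one, .one])
    ((v1 ⬝ v0 ≺ v2 ⬝ v0) ⟹ (v3 ⬝ v0 ≐ .var (.succ (.succ (.succ (.succ .zero)))) ⬝ v0))
    ⟨trivial, trivial⟩)) (Env.cons f (Env.cons g (Env.cons h (Env.cons k Env.nil))))
  simp only [indFm, sat_imp, sat_all, Fm.sat_subst, sat_lt, sat_eq, eval_app, eval_var, inst,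
    sucSubst, eval_zero, eval_suc, cons_zero, cons_succ] at H
  exact H h0 hs n

/-- Induction for implications between atomic formulas. -/
theorem nat_induction_atomic {f g h k : M.car .nat → M.car .nat} (hf : Internal M f)
    (hg : Internal M g) (hh : Internal M h) (hk : Internal M k) (h0 : f 0 < g 0 → h 0 = k 0)
    (hs : ∀ n, (f n < g n → h n = k n) → f (n + 1) < g (n + 1) → h (n + 1) = k (n + 1))
    (n : M.car .nat) : f n < g n → h n = k n := by
  obtain ⟨F, hF⟩ := hf.exists_app
  obtain ⟨G, hG⟩ := hg.exists_app
  obtain ⟨H, hH⟩ := hh.exists_app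
  obtain ⟨K, hK⟩ := hk.exists_app
  simp only [← hF, ← hG, ← hH, ← hK] at *
  exact nat_induction_of_app F G H K h0 hs n

/-- Induction for equations. -/
theorem nat_induction_eq {h k : M.car .nat → M.car .nat} (hh : Internal M h) (hk : Internal M k)
    (h0 : h 0 = k 0) (hs : ∀ n, h n = k n → h (n + 1) = k (n + 1)) (n : M.car .nat) :
    h n = k n :=
  nat_induction_atomic (f := fun _ => 0) (g := fun _ => 1) (by fun_prop) (by fun_prop) hh hk
    (fun _ => h0) (fun n hn _ => hs n (hn zero_lt_one)) n zero_lt_one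

@[simp] theorem prd_zero : M.prd 0 = 0 := recN_zero _ _

@[simp] theorem prd_succ (n : M.car .nat) : M.prd (n + 1) = n := by
  simp [Str.prd, HOArith.prd, recN_succ]

@[fun_prop] theorem Internal.prd {f : X → M.car .nat} (hf : Internal M f) :
    Internal M fun x => M.prd (f x) :=
  Internal.recN (Internal.const ((lam (lam v1)).eval (Env.nil : Env M []))) (Internal.const _) hf

theorem nat_sub_zero (a : M.car .nat) : a - 0 = a := recN_zero _ _

theorem nat_sub_succ (a b : M.car .nat) : a - (b + 1) = M.prd (a - b) := by
  change M.recN _ _ _ = M.prd (M.recN _ _ _)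
  exact (recN_succ _ _ _).trans (by rw [eval_lam_app, eval_lam_app, eval_prd]; rfl)

@[fun_prop] theorem Internal.sub {f g : X → M.car .nat} (hf : Internal M f) (hg : Internal M g) :
    Internal M fun x => f x - g x :=
  Internal.recN (Internal.const ((lam (lam (HOArith.prd v0))).eval (Env.nil : Env M []))) hf hg

theorem prd_add_one {n : M.car .nat} (h : 0 < n) : M.prd n + 1 = n :=
  nat_induction_atomic (f := fun _ => 0) (g := fun n => n) (h := fun n => M.prd n + 1)
    (k := fun n => n) (by fun_prop) (by fun_prop) (by fun_prop) (by fun_prop)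
    (fun h => (lt_irrefl _ h).elim) (fun n _ _ => by simp) n h

/-- That 0 is least is not an axiom. Induction is applied to the implication from `n < 0` to `0 =
1`, whose step holds because `n + 1 < 0` entails `n < 0`. -/
theorem nat_not_lt_zero (n : M.car .nat) : ¬ n < 0 := fun h =>
  zero_ne_one (nat_induction_atomic (f := fun n => n) (g := fun _ => 0) (h := fun _ => 0)
    (k := fun _ => (1 : M.car .nat)) (by fun_prop) (by fun_prop) (by fun_prop) (by fun_prop)
    (fun h => (lt_irrefl _ h).elim) (fun n hn h => hn ((lt_add_one n).trans h)) n h)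

theorem nat_zero_le (n : M.car .nat) : 0 ≤ n := not_lt.1 (nat_not_lt_zero n)

theorem nat_sub_add_cancel {a b : M.car .nat} (h : a ≤ b) : b - a + a = b := by
  -- Under a strict inequality the difference is positive, so the predecessor taken in the step
  -- really lowers it by one. The case of equality is left to `self`.
  have key : ∀ a : M.car .nat, a < b → b - a + a = b := by
    refine nat_induction_atomic (f := fun a => a) (g := fun _ => b) (h := fun a => b - a + a)
      (k := fun _ => b) (by fun_prop) (by fun_prop) (by fun_prop) (by fun_prop) ?_ ?_
    · intro _; rw [nat_sub_zero, add_zero]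
    · intro a ih h
      have h' := (lt_add_one a).trans h
      have e := ih h'
      have hp : 0 < b - a := by
        refine (nat_zero_le _).lt_of_ne fun h0 => ?_
        rw [← h0, zero_add] at e
        exact h'.ne e
      rw [nat_sub_succ, add_comm a 1, ← add_assoc, prd_add_one hp, e]
  have self : ∀ a : M.car .nat, a - a = 0 := by
    have succ : ∀ a b : M.car .nat, (a + 1) - (b + 1) = a - b := by
      intro a
      refine nat_induction_eq (by fun_prop) (by fun_prop) ?_ ?_
      · rw [nat_sub_succ, nat_sub_zero, nat_sub_zero, prd_succ]
      · intro b hb; rw [nat_sub_succ, hb, nat_sub_succ]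
    refine nat_induction_eq (by fun_prop) (by fun_prop) (nat_sub_zero _) ?_
    intro a ha; rw [succ, ha]
  rcases h.lt_or_eq with h | rfl
  · exact key a h
  · rw [self, zero_add]

theorem nat_sub_self (a : M.car .nat) : a - a = 0 := by
  have := nat_sub_add_cancel (le_refl a)
  simpa using this

theorem nat_sub_eq_zero {a b : M.car .nat} (h : a ≤ b) : a - b = 0 := by
  have key : ∀ c : M.car .nat, a - (a + c) = 0 := by
    refine nat_induction_eq (by fun_prop) (by fun_prop) (by rw [add_zero, nat_sub_self]) ?_
    intro c hc
    rw [← add_assoc, nat_sub_succ, hc, prd_zero]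
  rw [← nat_sub_add_cancel h, add_comm]
  exact key _

theorem nat_sub_pos {a b : M.car .nat} : 0 < b - a ↔ a < b := by
  refine ⟨fun h => not_le.1 fun h' => ?_, fun h => (nat_zero_le _).lt_of_ne fun h' => ?_⟩
  · rw [nat_sub_eq_zero h'] at h; exact lt_irrefl _ h
  · have := nat_sub_add_cancel h.le
    rw [← h', zero_add] at this
    exact h.ne this

/-- Discreteness of the order is not an axiom either; it holds because the positive number `b - a`
is a successor. -/
theorem nat_add_one_le {a b : M.car .nat} : a + 1 ≤ b ↔ a < b := by
  refine ⟨fun h => (lt_add_one a).trans_le h, fun h => ?_⟩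
  have h1 := prd_add_one (nat_sub_pos.2 h)
  have h2 := nat_sub_add_cancel h.le
  rw [← h2, ← h1, add_assoc, add_comm 1 a]
  exact le_add_of_nonneg_left (nat_zero_le _)

theorem nat_lt_add_one {a b : M.car .nat} : a < b + 1 ↔ a ≤ b := by
  rw [← not_le, nat_add_one_le, not_lt]

theorem nat_eq_zero_or_succ (n : M.car .nat) : n = 0 ∨ ∃ m, n = m + 1 := by
  rcases (nat_zero_le n).lt_or_eq with h | h
  · exact Or.inr ⟨_, (prd_add_one h).symm⟩
  · exact Or.inl h.symm

instance : CanonicallyOrderedAdd (M.car .nat) where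
  exists_add_of_le {a b} h := ⟨b - a, by rw [add_comm, nat_sub_add_cancel h]⟩
  le_add_self a b := le_add_of_nonneg_left (nat_zero_le b)
  le_self_add a b := le_add_of_nonneg_right (nat_zero_le b)

instance : OrderedSub (M.car .nat) where
  tsub_le_iff_right a b c := by
    rcases le_total a b with h | h
    · rw [nat_sub_eq_zero h]
      exact ⟨fun _ => h.trans le_add_self, fun _ => nat_zero_le _⟩
    · conv_rhs => rw [← nat_sub_add_cancel h]
      exact (add_le_add_iff_right b).symm

/-! ### Internal predicates -/

/-- Definition by cases at all types. Recursion equations are available only for values of type 0,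
where a recursion with a constant step decides the case; at arrow types the cases are distinguished
pointwise. -/
theorem obj_int_cond {c : X → M.car .nat} (hc : Obj.int c) {f g : X → M.car τ}
    (hf : Obj.int f) (hg : Obj.int g) :
    ∃ h : X → M.car τ, Obj.int h ∧ ∀ x, (c x = 0 → h x = f x) ∧ (c x ≠ 0 → h x = g x) := by
  rw [← internal_iff] at hc
  induction τ generalizing X with
  | nat =>
    rw [← internal_iff] at hf hg
    refine ⟨fun x => M.recN ((M.cst (.combK .one .nat) : M.car (.one ⇒ .nat ⇒ .one))
      ((M.cst (.combK .nat .nat) : M.car (.nat ⇒ .nat ⇒ .nat)) (g x))) (f x) (c x),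
      internal_iff.1 (by fun_prop), fun x => ⟨fun h => ?_, fun h => ?_⟩⟩
    · simp only [h, recN_zero]
    · obtain ⟨m, hm⟩ := (nat_eq_zero_or_succ (c x)).resolve_left h
      simp only [hm, recN_succ, combK_app]
  | arr σ τ _ ih =>
    rw [← internal_iff] at hf hg
    obtain ⟨h, hh, hh'⟩ := ih (X := X × M.car σ) (c := fun p => c p.1)
      (f := fun p => f p.1 p.2) (g := fun p => g p.1 p.2)
      (by fun_prop) (internal_iff.1 (by fun_prop)) (internal_iff.1 (by fun_prop))
    obtain ⟨H, hH, hH'⟩ := hh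
    refine ⟨H, hH, fun x => ⟨fun hx => Model.ext fun y => ?_, fun hx => Model.ext fun y => ?_⟩⟩
    · rw [hH']; exact (hh' (x, y)).1 hx
    · rw [hH']; exact (hh' (x, y)).2 hx

/-- A function of a truth value takes just two values, so composing it with `P` is a definition by
cases on `c`. -/
theorem internal_of_eq_zero {c : X → M.car .nat} (hc : Internal M c) {P : X → Prop}
    (h : ∀ x, P x ↔ c x = 0) : Internal M P := by
  refine ⟨fun {τ} g _ => ?_⟩
  obtain ⟨k, hk, hk'⟩ := obj_int_cond (internal_iff.1 hc) (Obj.const (g True))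
    (Obj.const (g False))
  convert hk using 2 with x
  by_cases hx : c x = 0
  · rw [(hk' x).1 hx, eq_true ((h x).2 hx)]
  · rw [(hk' x).2 hx, eq_false (mt (h x).1 hx)]

theorem Internal.exists_char {P : X → Prop} (hP : Internal M P) :
    ∃ c : X → M.car .nat, Internal M c ∧ ∀ x, P x ↔ c x = 0 := by
  classical
  refine ⟨fun x => if P x then 0 else 1, internal_iff.2 (hP.int_comp (fun p => if p then 0 else 1) trivial),
    fun x => ?_⟩
  by_cases h : P x <;> simp [h]

@[fun_prop] theorem Internal.ite {P : X → Prop} [∀ x, Decidable (P x)] {f g : X → M.car σ}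
    (hP : Internal M P) (hf : Internal M f) (hg : Internal M g) :
    Internal M fun x => if P x then f x else g x := by
  obtain ⟨c, hc, hc'⟩ := hP.exists_char
  rw [internal_iff] at *
  obtain ⟨h, hh, hh'⟩ := obj_int_cond hc hf hg
  convert hh using 2 with x
  by_cases hx : P x
  · rw [if_pos hx, (hh' x).1 ((hc' x).1 hx)]
  · rw [if_neg hx, (hh' x).2 (mt (hc' x).2 hx)]

@[fun_prop] theorem Internal.and {P Q : X → Prop} (hP : Internal M P) (hQ : Internal M Q) :
    Internal M fun x => P x ∧ Q x := by
  obtain ⟨c, hc, hc'⟩ := hP.exists_char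
  obtain ⟨d, hd, hd'⟩ := hQ.exists_char
  exact internal_of_eq_zero (c := fun x => c x + d x) (by fun_prop) fun x => by
    rw [hc', hd', add_eq_zero]

@[fun_prop] theorem Internal.or {P Q : X → Prop} (hP : Internal M P) (hQ : Internal M Q) :
    Internal M fun x => P x ∨ Q x := by
  have : Internal M fun x => ¬ (¬ P x ∧ ¬ Q x) := by fun_prop
  exact this.congr fun x => by tauto

@[fun_prop] theorem Internal.imp {P Q : X → Prop} (hP : Internal M P) (hQ : Internal M Q) :
    Internal M fun x => P x → Q x := by
  have : Internal M fun x => ¬ P x ∨ Q x := by fun_prop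
  exact this.congr fun x => imp_iff_not_or.symm

@[fun_prop] theorem Internal.lt {f g : X → M.car .nat} (hf : Internal M f) (hg : Internal M g) :
    Internal M fun x => f x < g x := by
  have : Internal M fun x => ¬ g x - f x = 0 :=
    Internal.not (internal_of_eq_zero (c := fun x => g x - f x) (by fun_prop) fun _ => Iff.rfl)
  exact this.congr fun x => by rw [← nat_sub_pos, pos_iff_ne_zero]

@[fun_prop] theorem Internal.le {f g : X → M.car .nat} (hf : Internal M f) (hg : Internal M g) :
    Internal M fun x => f x ≤ g x := by
  have : Internal M fun x => ¬ g x < f x := by fun_prop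
  exact this.congr fun x => not_lt

@[fun_prop] theorem Internal.eq {f g : X → M.car .nat} (hf : Internal M f) (hg : Internal M g) :
    Internal M fun x => f x = g x := by
  have : Internal M fun x => f x ≤ g x ∧ g x ≤ f x := by fun_prop
  exact this.congr fun x => le_antisymm_iff.symm

theorem exists_mu (M : Str Const) [Model M] : ∃ μ : M.car .two, ∀ f : M.car .one,
    (∃ n, f n = 0) → f (μ f) = 0 ∧ ∀ n < μ f, f n ≠ 0 := by
  have h := Model.sat (M := M) muTwo (Or.inr rfl)
  simp only [muTwo, sat_ex, sat_all, sat_and, sat_imp, sat_eq, sat_lt, sat_neg, eval_app, eval_var,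
    eval_zero, cons_zero, cons_succ] at h
  obtain ⟨μ, hμ⟩ := h
  exact ⟨μ, fun f => (hμ f).1⟩

/-- `(μ²)` is applied to the characteristic function of `P x`. This is how number quantifiers
preserve internality, and it also supplies internal choice functions with numerical values. -/
theorem Internal.exists_least {P : X → M.car .nat → Prop}
    (hP : Internal M fun p : X × M.car .nat => P p.1 p.2) :
    ∃ m : X → M.car .nat, Internal M m ∧
      ∀ x, (∃ n, P x n) → P x (m x) ∧ ∀ n < m x, ¬ P x n := by
  obtain ⟨μ, hμ⟩ := exists_mu M
  obtain ⟨c, hc, hc'⟩ := hP.exists_char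
  obtain ⟨F, hF, hF'⟩ := Internal.exists_lam (f := fun x n => c (x, n)) hc
  have key : ∀ x n, P x n ↔ F x n = 0 := fun x n => by rw [hF']; exact hc' (x, n)
  refine ⟨fun x => μ (F x), by fun_prop, fun x hx => ?_⟩
  simp only [key] at hx ⊢
  exact hμ _ hx

@[fun_prop] theorem Internal.exists {P : X → M.car .nat → Prop}
    (hP : Internal M fun p : X × M.car .nat => P p.1 p.2) :
    Internal M fun x => ∃ n, P x n := by
  obtain ⟨m, hm, hm'⟩ := hP.exists_least
  have : Internal M fun x => P x (m x) :=
    Internal.comp (f := fun p : X × M.car .nat => P p.1 p.2) (g := fun x => (x, m x)) hP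
      (by fun_prop)
  exact this.congr fun x => ⟨fun h => ⟨_, h⟩, fun h => (hm' x h).1⟩

@[fun_prop] theorem Internal.forall {P : X → M.car .nat → Prop}
    (hP : Internal M fun p : X × M.car .nat => P p.1 p.2) :
    Internal M fun x => ∀ n, P x n := by
  have : Internal M fun x => ¬ ∃ n, ¬ P x n := by fun_prop
  exact this.congr fun x => by simp

theorem Internal.env_nil (ρ : Ty) (v : Var [] ρ) :
    Internal M fun _ : X => (Env.nil : Env M []) ρ v := nomatch v

theorem Internal.env_cons {Γ : List Ty} {f : X → M.car σ} {e : X → Env M Γ} (hf : Internal M f)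
    (he : ∀ ρ v, Internal M fun x => e x ρ v) (ρ : Ty) (v : Var (σ :: Γ) ρ) :
    Internal M fun x => Env.cons (f x) (e x) ρ v := by
  cases v with
  | zero => exact hf
  | succ v => exact he _ v

/-- The value of a term is an internal function of the assignment. -/
theorem Internal.eval {Γ : List Ty} {e : X → Env M Γ}
    (he : ∀ ρ v, Internal M fun x => e x ρ v) (t : Term Γ τ) :
    Internal M fun x => t.eval (e x) := by
  induction t with
  | var v => exact he _ v
  | cst c => exact Internal.const _
  | app f a hf ha => exact Internal.app hf ha

/-- Induction for internal predicates. -/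
theorem nat_induction {P : M.car .nat → Prop} (hP : Internal M P) (h0 : P 0)
    (hs : ∀ n, P n → P (n + 1)) (n : M.car .nat) : P n := by
  obtain ⟨c, hc, hc'⟩ := hP.exists_char
  simp only [hc'] at *
  exact nat_induction_eq hc (by fun_prop) h0 hs n

end Internal
end HOArith

namespace HOArith

/-! ## The ordered ring of fractions of an ordered semiring -/

section Fractions

variable (N : Type) [CommSemiring N] [LinearOrder N] [IsStrictOrderedRing N]

/-- Representations of the fractions `(pos - neg) / den`. -/
structure PreFrac where
  pos : N
  neg : N
  den : N
  den_pos : 0 < den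

variable {N}

namespace PreFrac

instance : Preorder (PreFrac N) where
  le a b := a.pos * b.den + b.neg * a.den ≤ b.pos * a.den + a.neg * b.den
  le_refl a := le_rfl
  le_trans a b c h₁ h₂ := by
    -- Subtraction is not available in `N`, so both sides are scaled by the middle denominator and
    -- enlarged by the middle terms, which are cancelled afterwards.
    refine le_of_mul_le_mul_left ?_ b.den_pos
    refine le_of_add_le_add_right (a := b.neg * a.den * c.den + b.pos * a.den * c.den) ?_
    calc b.den * (a.pos * c.den + c.neg * a.den) + (b.neg * a.den * c.den + b.pos * a.den * c.den)
        = (a.pos * b.den + b.neg * a.den) * c.den + (b.pos * c.den + c.neg * b.den) * a.den := by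
          ring
      _ ≤ (b.pos * a.den + a.neg * b.den) * c.den + (c.pos * b.den + b.neg * c.den) * a.den :=
          add_le_add (mul_le_mul_of_nonneg_right h₁ c.den_pos.le)
            (mul_le_mul_of_nonneg_right h₂ a.den_pos.le)
      _ = _ := by ring

theorem le_def (a b : PreFrac N) :
    a ≤ b ↔ a.pos * b.den + b.neg * a.den ≤ b.pos * a.den + a.neg * b.den := Iff.rfl

theorem antisymmRel_iff (a b : PreFrac N) : AntisymmRel (· ≤ ·) a b ↔
    a.pos * b.den + b.neg * a.den = b.pos * a.den + a.neg * b.den := by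
  rw [AntisymmRel, le_def, le_def, le_antisymm_iff, add_comm (b.pos * a.den)]

instance : @Std.Total (PreFrac N) (· ≤ ·) where
  total a b := by
    rw [le_def, le_def, add_comm (b.pos * _)]
    exact le_total _ _

instance : Add (PreFrac N) :=
  ⟨fun a b => ⟨a.pos * b.den + b.pos * a.den, a.neg * b.den + b.neg * a.den, a.den * b.den,
    mul_pos a.den_pos b.den_pos⟩⟩

instance : Mul (PreFrac N) :=
  ⟨fun a b => ⟨a.pos * b.pos + a.neg * b.neg, a.pos * b.neg + a.neg * b.pos, a.den * b.den,
    mul_pos a.den_pos b.den_pos⟩⟩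

instance : Neg (PreFrac N) := ⟨fun a => ⟨a.neg, a.pos, a.den, a.den_pos⟩⟩
instance : Zero (PreFrac N) := ⟨⟨0, 0, 1, zero_lt_one⟩⟩
instance : One (PreFrac N) := ⟨⟨1, 0, 1, zero_lt_one⟩⟩

theorem add_def (a b : PreFrac N) : a + b = ⟨a.pos * b.den + b.pos * a.den,
    a.neg * b.den + b.neg * a.den, a.den * b.den, mul_pos a.den_pos b.den_pos⟩ := rfl
theorem mul_def (a b : PreFrac N) : a * b = ⟨a.pos * b.pos + a.neg * b.neg,
    a.pos * b.neg + a.neg * b.pos, a.den * b.den, mul_pos a.den_pos b.den_pos⟩ := rfl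
@[simp] theorem neg_pos (a : PreFrac N) : (-a).pos = a.neg := rfl
@[simp] theorem neg_neg (a : PreFrac N) : (-a).neg = a.pos := rfl
@[simp] theorem neg_den (a : PreFrac N) : (-a).den = a.den := rfl
theorem zero_def : (0 : PreFrac N) = ⟨0, 0, 1, zero_lt_one⟩ := rfl
theorem one_def : (1 : PreFrac N) = ⟨1, 0, 1, zero_lt_one⟩ := rfl

theorem add_le_add_right {a b : PreFrac N} (h : a ≤ b) (c : PreFrac N) : a + c ≤ b + c := by
  rw [le_def] at *
  simp only [add_def]
  calc _ = (a.pos * b.den + b.neg * a.den) * (c.den * c.den) +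
        (c.pos + c.neg) * (a.den * b.den * c.den) := by ring
    _ ≤ (b.pos * a.den + a.neg * b.den) * (c.den * c.den) +
        (c.pos + c.neg) * (a.den * b.den * c.den) :=
        add_le_add_left (mul_le_mul_of_nonneg_right h (mul_pos c.den_pos c.den_pos).le) _
    _ = _ := by ring

theorem add_comm_rel (a b : PreFrac N) : AntisymmRel (· ≤ ·) (a + b) (b + a) := by
  rw [antisymmRel_iff]; simp only [add_def]; ring

theorem mul_comm_rel (a b : PreFrac N) : AntisymmRel (· ≤ ·) (a * b) (b * a) := by
  rw [antisymmRel_iff]; simp only [mul_def]; ring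

theorem mul_congr_right {a b : PreFrac N} (h : AntisymmRel (· ≤ ·) a b) (c : PreFrac N) :
    AntisymmRel (· ≤ ·) (a * c) (b * c) := by
  rw [antisymmRel_iff] at *
  simp only [mul_def]
  calc _ = c.den * (c.pos * (a.pos * b.den + b.neg * a.den) +
        c.neg * (b.pos * a.den + a.neg * b.den)) := by ring
    _ = c.den * (c.pos * (b.pos * a.den + a.neg * b.den) +
        c.neg * (a.pos * b.den + b.neg * a.den)) := by rw [h]
    _ = _ := by ring

end PreFrac

variable (N) in
/-- The ring of fractions `(a - b) / d` over an ordered semiring. -/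
def Frac : Type := Antisymmetrization (PreFrac N) (· ≤ ·)

namespace Frac

/-- The class of a fraction. -/
def mk (a : PreFrac N) : Frac N := toAntisymmetrization (· ≤ ·) a

theorem mk_eq_mk {a b : PreFrac N} :
    mk a = mk b ↔ a.pos * b.den + b.neg * a.den = b.pos * a.den + a.neg * b.den := by
  rw [← PreFrac.antisymmRel_iff]
  exact Quotient.eq (r := AntisymmRel.setoid (PreFrac N) (· ≤ ·))

theorem ind {p : Frac N → Prop} (h : ∀ a, p (mk a)) (x : Frac N) : p x := Quotient.ind h x

open Classical in
noncomputable instance : LinearOrder (Frac N) :=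
  inferInstanceAs (LinearOrder (Antisymmetrization (PreFrac N) (· ≤ ·)))

theorem mk_le_mk {a b : PreFrac N} :
    mk a ≤ mk b ↔ a.pos * b.den + b.neg * a.den ≤ b.pos * a.den + a.neg * b.den := Iff.rfl

theorem mk_lt_mk {a b : PreFrac N} :
    mk a < mk b ↔ a.pos * b.den + b.neg * a.den < b.pos * a.den + a.neg * b.den := by
  rw [← not_le, mk_le_mk, not_le, add_comm (b.pos * _)]

instance : Add (Frac N) := ⟨Quotient.map₂ (· + ·) fun a a' ha b b' hb => by
  have h₁ : AntisymmRel (· ≤ ·) (a + b) (a' + b) :=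
    ⟨PreFrac.add_le_add_right ha.1 b, PreFrac.add_le_add_right ha.2 b⟩
  have h₂ : AntisymmRel (· ≤ ·) (b + a') (b' + a') :=
    ⟨PreFrac.add_le_add_right hb.1 a', PreFrac.add_le_add_right hb.2 a'⟩
  exact h₁.trans ((PreFrac.add_comm_rel _ _).trans (h₂.trans (PreFrac.add_comm_rel _ _)))⟩

instance : Mul (Frac N) := ⟨Quotient.map₂ (· * ·) fun _ a' ha b _ hb =>
  (PreFrac.mul_congr_right ha b).trans ((PreFrac.mul_comm_rel _ _).trans
    ((PreFrac.mul_congr_right hb a').trans (PreFrac.mul_comm_rel _ _)))⟩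

instance : Neg (Frac N) := ⟨Quotient.map (- ·) fun a b h => by
  have h' := (PreFrac.antisymmRel_iff a b).1 h
  refine (PreFrac.antisymmRel_iff _ _).2 ?_
  change a.neg * b.den + b.pos * a.den = b.neg * a.den + a.pos * b.den
  rw [add_comm, ← h', add_comm]⟩

instance : Zero (Frac N) := ⟨mk 0⟩
instance : One (Frac N) := ⟨mk 1⟩

theorem mk_add (a b : PreFrac N) : mk (a + b) = mk a + mk b := rfl
theorem mk_mul (a b : PreFrac N) : mk (a * b) = mk a * mk b := rfl
theorem mk_neg (a : PreFrac N) : mk (-a) = -mk a := rfl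
theorem mk_zero : mk (0 : PreFrac N) = 0 := rfl
theorem mk_one : mk (1 : PreFrac N) = 1 := rfl

instance : CommRing (Frac N) where
  add_assoc a b c := by
    induction a using ind; induction b using ind; induction c using ind
    simp only [← mk_add, mk_eq_mk, PreFrac.add_def]; ring
  zero_add a := by
    induction a using ind
    simp only [← mk_add, ← mk_zero, mk_eq_mk, PreFrac.add_def, PreFrac.zero_def]; ring
  add_zero a := by
    induction a using ind
    simp only [← mk_add, ← mk_zero, mk_eq_mk, PreFrac.add_def, PreFrac.zero_def]; ring
  add_comm a b := by
    induction a using ind; induction b using ind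
    simp only [← mk_add, mk_eq_mk, PreFrac.add_def]; ring
  left_distrib a b c := by
    induction a using ind; induction b using ind; induction c using ind
    simp only [← mk_add, ← mk_mul, mk_eq_mk, PreFrac.add_def, PreFrac.mul_def]; ring
  right_distrib a b c := by
    induction a using ind; induction b using ind; induction c using ind
    simp only [← mk_add, ← mk_mul, mk_eq_mk, PreFrac.add_def, PreFrac.mul_def]; ring
  zero_mul a := by
    induction a using ind
    simp only [← mk_mul, ← mk_zero, mk_eq_mk, PreFrac.mul_def, PreFrac.zero_def]; ring
  mul_zero a := by
    induction a using ind
    simp only [← mk_mul, ← mk_zero, mk_eq_mk, PreFrac.mul_def, PreFrac.zero_def]; ring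
  mul_assoc a b c := by
    induction a using ind; induction b using ind; induction c using ind
    simp only [← mk_mul, mk_eq_mk, PreFrac.mul_def]; ring
  one_mul a := by
    induction a using ind
    simp only [← mk_mul, ← mk_one, mk_eq_mk, PreFrac.mul_def, PreFrac.one_def]; ring
  mul_one a := by
    induction a using ind
    simp only [← mk_mul, ← mk_one, mk_eq_mk, PreFrac.mul_def, PreFrac.one_def]; ring
  neg_add_cancel a := by
    induction a using ind
    simp only [← mk_add, ← mk_neg, ← mk_zero, mk_eq_mk, PreFrac.add_def, PreFrac.zero_def]
    simp only [PreFrac.neg_pos, PreFrac.neg_neg, PreFrac.neg_den]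
    ring
  mul_comm a b := by
    induction a using ind; induction b using ind
    simp only [← mk_mul, mk_eq_mk, PreFrac.mul_def]; ring
  nsmul := nsmulRec
  zsmul := zsmulRec

theorem mk_pos {a : PreFrac N} : 0 < mk a ↔ a.neg < a.pos := by
  rw [← mk_zero, mk_lt_mk]
  simp [PreFrac.zero_def]

instance : Nontrivial (Frac N) :=
  ⟨0, 1, by rw [← mk_zero, ← mk_one, Ne, mk_eq_mk]; simp [PreFrac.zero_def, PreFrac.one_def]⟩

instance : IsOrderedAddMonoid (Frac N) where
  add_le_add_left a b h c := by
    induction a using ind; induction b using ind; induction c using ind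
    exact PreFrac.add_le_add_right h _

/-- A product of positive fractions is positive by the rearrangement inequality. Its proof writes
the larger of two elements as the smaller plus a remainder, hence the canonical order. -/
instance [CanonicallyOrderedAdd N] : IsStrictOrderedRing (Frac N) := by
  have : ZeroLEOneClass (Frac N) := ⟨by
    rw [← mk_zero, ← mk_one, mk_le_mk]; simp [PreFrac.zero_def, PreFrac.one_def]⟩
  refine IsStrictOrderedRing.of_mul_pos fun a b ha hb => ?_
  induction a using ind with | _ a
  induction b using ind with | _ b
  rw [← mk_mul]
  rw [mk_pos] at *
  simp only [PreFrac.mul_def]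
  rw [add_comm (a.pos * b.neg), add_comm (a.pos * b.pos)]
  exact mul_add_mul_lt_mul_add_mul ha hb

/-- The embedding of the semiring. -/
def of : N →+* Frac N where
  toFun a := mk ⟨a, 0, 1, zero_lt_one⟩
  map_zero' := rfl
  map_one' := rfl
  map_add' a b := by rw [← mk_add, mk_eq_mk]; simp [PreFrac.add_def]
  map_mul' a b := by rw [← mk_mul, mk_eq_mk]; simp [PreFrac.mul_def]

theorem of_lt_of {a b : N} : of a < of b ↔ a < b := by
  change mk _ < mk _ ↔ _
  rw [mk_lt_mk]; simp

theorem of_le_of {a b : N} : of a ≤ of b ↔ a ≤ b := by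
  change mk _ ≤ mk _ ↔ _
  rw [mk_le_mk]; simp

theorem of_mul_mk (a : PreFrac N) : of a.den * mk a = of a.pos - of a.neg := by
  rw [eq_sub_iff_add_eq]
  change mk _ * mk _ + mk _ = mk _
  rw [← mk_mul, ← mk_add, mk_eq_mk]
  simp [PreFrac.add_def, PreFrac.mul_def]
  ring

end Frac
end Fractions
end HOArith

namespace HOArith

section Codes

variable {M : Str Const} {Γ : List Ty}

/-! ### Pairing -/

/-- Triangular numbers. -/
def Str.tri (M : Str Const) (n : M.car .nat) : M.car .nat :=
  (HOArith.tri (Γ := [.nat]) v0).eval (Env.cons n Env.nil)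

/-- The index of the largest triangular number below `n`. -/
def Str.triRoot (M : Str Const) (n : M.car .nat) : M.car .nat :=
  (HOArith.triRoot (Γ := [.nat]) v0).eval (Env.cons n Env.nil)

/-- The powers of two. -/
def Str.pow2 (M : Str Const) (n : M.car .nat) : M.car .nat :=
  (HOArith.pow2 (Γ := [.nat]) v0).eval (Env.cons n Env.nil)

/-- Cantor's pairing function. -/
def Str.pair (M : Str Const) (a b : M.car .nat) : M.car .nat := M.tri (a + b) + b
/-- The second component of a pair. -/
def Str.snd (M : Str Const) (c : M.car .nat) : M.car .nat := c - M.tri (M.triRoot c)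
/-- The first component of a pair. -/
def Str.fst (M : Str Const) (c : M.car .nat) : M.car .nat := M.triRoot c - M.snd c

@[simp] theorem eval_tri (e : Env M Γ) (t : Term Γ .nat) :
    (HOArith.tri t).eval e = M.tri (t.eval e) := rfl
@[simp] theorem eval_triRoot (e : Env M Γ) (t : Term Γ .nat) :
    (HOArith.triRoot t).eval e = M.triRoot (t.eval e) := rfl
@[simp] theorem eval_pow2 (e : Env M Γ) (t : Term Γ .nat) :
    (HOArith.pow2 t).eval e = M.pow2 (t.eval e) := rfl
@[simp] theorem eval_pair (e : Env M Γ) (s t : Term Γ .nat) :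
    (pair s t).eval e = M.pair (s.eval e) (t.eval e) := by
  simp [pair, Str.pair]
@[simp] theorem eval_snd (e : Env M Γ) (t : Term Γ .nat) :
    (HOArith.snd t).eval e = M.snd (t.eval e) := by
  simp [HOArith.snd, Str.snd]
@[simp] theorem eval_fst (e : Env M Γ) (t : Term Γ .nat) :
    (HOArith.fst t).eval e = M.fst (t.eval e) := by
  simp [HOArith.fst, Str.fst]

@[simp] theorem eval_mkQ (e : Env M Γ) (p n r : Term Γ .nat) :
    (mkQ p n r).eval e = M.pair (M.pair (p.eval e) (n.eval e)) (r.eval e) := by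
  simp [mkQ]

variable [Model M] {X : Type} [Obj M X]

@[fun_prop] theorem Internal.tri {f : X → M.car .nat} (hf : Internal M f) :
    Internal M fun x => M.tri (f x) := Internal.eval (Internal.env_cons hf Internal.env_nil) _

@[fun_prop] theorem Internal.triRoot {f : X → M.car .nat} (hf : Internal M f) :
    Internal M fun x => M.triRoot (f x) := Internal.eval (Internal.env_cons hf Internal.env_nil) _

@[fun_prop] theorem Internal.pow2 {f : X → M.car .nat} (hf : Internal M f) :
    Internal M fun x => M.pow2 (f x) := Internal.eval (Internal.env_cons hf Internal.env_nil) _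

@[fun_prop] theorem Internal.pair {f g : X → M.car .nat} (hf : Internal M f) (hg : Internal M g) :
    Internal M fun x => M.pair (f x) (g x) := by
  unfold Str.pair; fun_prop

@[fun_prop] theorem Internal.unpair_snd {f : X → M.car .nat} (hf : Internal M f) :
    Internal M fun x => M.snd (f x) := by
  unfold Str.snd; fun_prop

@[fun_prop] theorem Internal.unpair_fst {f : X → M.car .nat} (hf : Internal M f) :
    Internal M fun x => M.fst (f x) := by
  unfold Str.fst; fun_prop

@[simp] theorem tri_zero : M.tri 0 = 0 := recN_zero _ _
theorem tri_succ (n : M.car .nat) : M.tri (n + 1) = M.tri n + (n + 1) :=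
  (recN_succ _ _ _).trans (by rw [eval_lam_app, eval_lam_app]; rfl)

@[simp] theorem pow2_zero : M.pow2 0 = 1 := recN_zero _ _
theorem pow2_succ (n : M.car .nat) : M.pow2 (n + 1) = M.pow2 n + M.pow2 n :=
  (recN_succ _ _ _).trans (by rw [eval_lam_app, eval_lam_app]; rfl)

@[simp] theorem triRoot_zero : M.triRoot 0 = 0 := recN_zero _ _
theorem triRoot_succ (n : M.car .nat) : M.triRoot (n + 1) =
    M.triRoot n + (1 - (M.tri (M.triRoot n + 1) - (n + 1))) :=
  (recN_succ _ _ _).trans (by rw [eval_lam_app, eval_lam_app, eval_add, eval_monus, eval_monus]; rfl)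

theorem tri_mono {a b : M.car .nat} (h : a ≤ b) : M.tri a ≤ M.tri b := by
  obtain ⟨c, rfl⟩ := exists_add_of_le h
  refine nat_induction (P := fun c => M.tri a ≤ M.tri (a + c)) (by fun_prop) (by simp) ?_ c
  intro c hc
  rw [← add_assoc, tri_succ]
  exact le_add_right hc

theorem triRoot_spec (n : M.car .nat) :
    M.tri (M.triRoot n) ≤ n ∧ n < M.tri (M.triRoot n + 1) := by
  refine nat_induction (P := fun n => M.tri (M.triRoot n) ≤ n ∧ n < M.tri (M.triRoot n + 1))
    (by fun_prop) ?_ ?_ n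
  · have := tri_succ (0 : M.car .nat)
    rw [zero_add] at this
    simp [this]
  · rintro n ⟨h₁, h₂⟩
    rw [triRoot_succ]
    -- The cut-off differences in the recursion increase the root by 1 exactly when the next
    -- triangular number has been reached, and by 0 otherwise.
    rcases le_or_gt (M.tri (M.triRoot n + 1)) (n + 1) with h | h
    · rw [tsub_eq_zero_of_le h, tsub_zero]
      refine ⟨h, ?_⟩
      rw [tri_succ (M.triRoot n + 1)]
      exact (nat_add_one_le.2 h₂).trans_lt (lt_add_of_pos_right _
        (add_pos_of_nonneg_of_pos (nat_zero_le _) one_pos))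
    · have : 1 ≤ M.tri (M.triRoot n + 1) - (n + 1) := by
        rw [← zero_add (1 : M.car .nat), nat_add_one_le]
        exact nat_sub_pos.2 (by simpa using h)
      rw [tsub_eq_zero_of_le this, add_zero]
      exact ⟨h₁.trans le_self_add, h⟩

theorem triRoot_unique {r n : M.car .nat} (h₁ : M.tri r ≤ n) (h₂ : n < M.tri (r + 1)) :
    M.triRoot n = r := by
  obtain ⟨h₃, h₄⟩ := triRoot_spec n
  rcases lt_trichotomy (M.triRoot n) r with h | h | h
  · exact absurd (h₄.trans_le ((tri_mono (nat_add_one_le.2 h)).trans h₁)) (lt_irrefl _)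
  · exact h
  · exact absurd (h₂.trans_le ((tri_mono (nat_add_one_le.2 h)).trans h₃)) (lt_irrefl _)

theorem triRoot_pair (a b : M.car .nat) : M.triRoot (M.pair a b) = a + b := by
  refine triRoot_unique le_self_add ?_
  rw [tri_succ, Str.pair]
  exact add_lt_add_right (nat_lt_add_one.2 le_add_self) _

@[simp] theorem snd_pair (a b : M.car .nat) : M.snd (M.pair a b) = b := by
  rw [Str.snd, triRoot_pair, Str.pair, add_tsub_cancel_left]

@[simp] theorem fst_pair (a b : M.car .nat) : M.fst (M.pair a b) = a := by
  rw [Str.fst, snd_pair, triRoot_pair, add_tsub_cancel_right]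

theorem pow2_pos (n : M.car .nat) : 0 < M.pow2 n := by
  refine nat_induction (P := fun n => 0 < M.pow2 n) (by fun_prop) (by simp) ?_ n
  intro n hn
  rw [pow2_succ]
  exact add_pos hn hn

theorem lt_pow2 (n : M.car .nat) : n < M.pow2 n := by
  refine nat_induction (P := fun n => n < M.pow2 n) (by fun_prop) (by simp) ?_ n
  intro n hn
  rw [pow2_succ]
  refine add_lt_add_of_lt_of_le hn ?_
  rw [← zero_add (1 : M.car .nat), nat_add_one_le]
  exact pow2_pos n

/-! ### Codes of rational numbers -/

/-- The ring of the rational numbers of the model. -/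
abbrev Str.Q (M : Str Const) [Model M] : Type := Frac (M.car .nat)

/-- The rational number with a given code. -/
noncomputable def Str.val (M : Str Const) [Model M] (c : M.car .nat) : M.Q :=
  Frac.mk ⟨M.fst (M.fst c), M.snd (M.fst c), M.snd c + 1,
    add_pos_of_nonneg_of_pos (nat_zero_le _) one_pos⟩

/-- The rational number `2^(-n)`. -/
noncomputable def Str.eps (M : Str Const) [Model M] (n : M.car .nat) : M.Q :=
  Frac.mk ⟨1, 0, M.pow2 n, pow2_pos n⟩

theorem val_pair (p n r : M.car .nat) : M.val (M.pair (M.pair p n) r) =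
    Frac.mk ⟨p, n, r + 1, add_pos_of_nonneg_of_pos (nat_zero_le _) one_pos⟩ := by
  simp [Str.val]

theorem val_pair_prd (p n d : M.car .nat) (hd : 0 < d) :
    M.val (M.pair (M.pair p n) (M.prd d)) = Frac.mk ⟨p, n, d, hd⟩ := by
  rw [val_pair]
  congr 2
  exact prd_add_one hd

theorem val_surjective (q : M.Q) : ∃ c, M.val c = q := by
  induction q using Frac.ind with
  | _ a => exact ⟨_, val_pair_prd a.pos a.neg a.den a.den_pos⟩

@[simp] theorem val_qAdd (e : Env M Γ) (c d : Term Γ .nat) :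
    M.val ((qAdd c d).eval e) = M.val (c.eval e) + M.val (d.eval e) := by
  simp only [qAdd, eval_mkQ, eval_prd, eval_mul, eval_add, qPos, qNeg, qDen, eval_suc, eval_fst,
    eval_snd]
  exact val_pair_prd _ _ _ (mul_pos (add_pos_of_nonneg_of_pos (nat_zero_le _) one_pos)
    (add_pos_of_nonneg_of_pos (nat_zero_le _) one_pos))

@[simp] theorem sat_qLt (e : Env M Γ) (c d : Term Γ .nat) :
    (qLt c d).Sat e ↔ M.val (c.eval e) < M.val (d.eval e) := by
  simp only [Str.val, Frac.mk_lt_mk, qLt, sat_lt, eval_add, eval_mul, qPos, qNeg, qDen, eval_suc,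
    eval_fst, eval_snd]

@[simp] theorem sat_qLe (e : Env M Γ) (c d : Term Γ .nat) :
    (qLe c d).Sat e ↔ M.val (c.eval e) ≤ M.val (d.eval e) := by
  simp only [qLe, sat_neg, sat_qLt, not_lt]

@[simp] theorem val_qZero (e : Env M Γ) : M.val ((qZero : Term Γ .nat).eval e) = 0 := by
  simp only [qZero, eval_mkQ, eval_zero, val_pair]
  rw [← Frac.mk_zero, Frac.mk_eq_mk]
  simp [PreFrac.zero_def]

@[simp] theorem val_qOne (e : Env M Γ) : M.val ((qOne : Term Γ .nat).eval e) = 1 := by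
  simp only [qOne, eval_mkQ, eval_zero, eval_one, val_pair]
  rw [← Frac.mk_one, Frac.mk_eq_mk]
  simp [PreFrac.one_def]

@[simp] theorem val_qEps (e : Env M Γ) (n : Term Γ .nat) :
    M.val ((qEps n).eval e) = M.eps (n.eval e) := by
  simp only [qEps, eval_mkQ, eval_zero, eval_one, eval_prd, eval_pow2]
  exact val_pair_prd _ _ _ (pow2_pos _)

@[simp] theorem val_qTwoEps (e : Env M Γ) (n : Term Γ .nat) :
    M.val ((qTwoEps n).eval e) = 2 * M.eps (n.eval e) := by
  simp only [qTwoEps, eval_mkQ, eval_zero, eval_two, eval_prd, eval_pow2]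
  rw [val_pair_prd _ _ _ (pow2_pos _), two_mul, Str.eps, ← Frac.mk_add, Frac.mk_eq_mk]
  simp only [PreFrac.add_def]
  ring

@[simp] theorem sat_qDistLt (e : Env M Γ) (c d r : Term Γ .nat) : (qDistLt c d r).Sat e ↔
    |M.val (c.eval e) - M.val (d.eval e)| < M.val (r.eval e) := by
  simp only [qDistLt, sat_and, sat_qLt, val_qAdd, abs_lt]
  constructor <;> rintro ⟨h₁, h₂⟩ <;> constructor <;> linarith

@[simp] theorem sat_qDistLe (e : Env M Γ) (c d r : Term Γ .nat) : (qDistLe c d r).Sat e ↔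
    |M.val (c.eval e) - M.val (d.eval e)| ≤ M.val (r.eval e) := by
  simp only [qDistLe, sat_and, sat_qLe, val_qAdd, abs_le]
  constructor <;> rintro ⟨h₁, h₂⟩ <;> constructor <;> linarith

@[simp] theorem eps_zero : M.eps 0 = 1 := by
  rw [Str.eps, ← Frac.mk_one, Frac.mk_eq_mk]
  simp [PreFrac.one_def]

theorem of_pow2_mul_eps (n : M.car .nat) : Frac.of (M.pow2 n) * M.eps n = 1 := by
  have := Frac.of_mul_mk (⟨1, 0, M.pow2 n, pow2_pos n⟩ : PreFrac (M.car .nat))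
  rwa [map_one, map_zero, sub_zero] at this

theorem eps_pos (n : M.car .nat) : 0 < M.eps n := by
  rw [Str.eps, Frac.mk_pos]; exact one_pos

theorem eps_succ (n : M.car .nat) : 2 * M.eps (n + 1) = M.eps n := by
  rw [two_mul, Str.eps, Str.eps, ← Frac.mk_add, Frac.mk_eq_mk]
  simp only [PreFrac.add_def, pow2_succ]
  ring

/-! ### Internal functions with rational values -/

theorem internal_val_lt {f g : X → M.car .nat} (hf : Internal M f) (hg : Internal M g) :
    Internal M fun x => M.val (f x) < M.val (g x) := by
  simp only [Str.val, Frac.mk_lt_mk]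
  fun_prop

/-- The rationals are not a carrier of the model, so internality of functions on them is tested on
codes. -/
instance : Obj M M.Q where
  int g := Obj.int fun c => g (M.val c)
  const c := Obj.const c
  app h₁ h₂ := Obj.app h₁ h₂

@[fun_prop] theorem Internal.val {f : X → M.car .nat} (hf : Internal M f) :
    Internal M fun x => M.val (f x) := ⟨fun g hg => hf.int_comp (fun c => g (M.val c)) hg⟩

/-- Codes are not unique, but the least code of a rational can be found internally from any of its
codes. Taking least codes is therefore internal on the rationals themselves, and can be composed
with `f`. -/
theorem Internal.exists_code {f : X → M.Q} (hf : Internal M f) :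
    ∃ c : X → M.car .nat, Internal M c ∧ ∀ x, f x = M.val (c x) := by
  have hP : Internal M fun p : M.car .nat × M.car .nat => M.val p.1 = M.val p.2 := by
    have : Internal M fun p : M.car .nat × M.car .nat =>
        ¬ M.val p.1 < M.val p.2 ∧ ¬ M.val p.2 < M.val p.1 :=
      Internal.and (Internal.not (internal_val_lt (by fun_prop) (by fun_prop)))
        (Internal.not (internal_val_lt (by fun_prop) (by fun_prop)))
    exact this.congr fun p => by rw [not_lt, not_lt, and_comm, le_antisymm_iff]
  obtain ⟨m, hm, hm'⟩ := Internal.exists_least (P := fun a b => M.val a = M.val b) hP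
  choose s hs using val_surjective (M := M)
  -- The least code depends only on the rational, so the external choice `s` of codes disappears.
  have key : ∀ a, m (s (M.val a)) = m a := by
    intro a
    obtain ⟨h₁, h₂⟩ := hm' a ⟨a, rfl⟩
    obtain ⟨h₃, h₄⟩ := hm' (s (M.val a)) ⟨a, hs _⟩
    rw [hs] at h₃
    refine le_antisymm (not_lt.1 fun h => h₄ _ h ?_) (not_lt.1 fun h => h₂ _ h h₃)
    rw [hs, h₁]
  refine ⟨fun x => m (s (f x)), ?_, fun x => ?_⟩
  · rw [internal_iff]
    refine hf.int_comp (fun q => m (s q)) ?_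
    change Obj.int fun c => m (s (M.val c))
    simp only [key]
    exact internal_iff.1 hm
  · rw [← (hm' (s (f x)) ⟨_, rfl⟩).1, hs]

@[fun_prop] theorem Internal.q_add {f g : X → M.Q} (hf : Internal M f) (hg : Internal M g) :
    Internal M fun x => f x + g x := by
  obtain ⟨c, hc, hc'⟩ := hf.exists_code
  obtain ⟨d, hd, hd'⟩ := hg.exists_code
  have : ∀ x, f x + g x = M.val (M.pair (M.pair
      (M.fst (M.fst (c x)) * (M.snd (d x) + 1) + M.fst (M.fst (d x)) * (M.snd (c x) + 1))
      (M.snd (M.fst (c x)) * (M.snd (d x) + 1) + M.snd (M.fst (d x)) * (M.snd (c x) + 1)))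
      (M.prd ((M.snd (c x) + 1) * (M.snd (d x) + 1)))) := by
    intro x
    rw [hc', hd', val_pair_prd _ _ _ (mul_pos (add_pos_of_nonneg_of_pos (nat_zero_le _) one_pos)
      (add_pos_of_nonneg_of_pos (nat_zero_le _) one_pos))]
    rfl
  simp only [this]
  fun_prop

@[fun_prop] theorem Internal.q_mul {f g : X → M.Q} (hf : Internal M f) (hg : Internal M g) :
    Internal M fun x => f x * g x := by
  obtain ⟨c, hc, hc'⟩ := hf.exists_code
  obtain ⟨d, hd, hd'⟩ := hg.exists_code
  have : ∀ x, f x * g x = M.val (M.pair (M.pair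
      (M.fst (M.fst (c x)) * M.fst (M.fst (d x)) + M.snd (M.fst (c x)) * M.snd (M.fst (d x)))
      (M.fst (M.fst (c x)) * M.snd (M.fst (d x)) + M.snd (M.fst (c x)) * M.fst (M.fst (d x))))
      (M.prd ((M.snd (c x) + 1) * (M.snd (d x) + 1)))) := by
    intro x
    rw [hc', hd', val_pair_prd _ _ _ (mul_pos (add_pos_of_nonneg_of_pos (nat_zero_le _) one_pos)
      (add_pos_of_nonneg_of_pos (nat_zero_le _) one_pos))]
    rfl
  simp only [this]
  fun_prop

@[fun_prop] theorem Internal.q_neg {f : X → M.Q} (hf : Internal M f) :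
    Internal M fun x => -f x := by
  have : Internal M fun x => (-1 : M.Q) * f x := by fun_prop
  simpa only [neg_one_mul] using this

@[fun_prop] theorem Internal.q_sub {f g : X → M.Q} (hf : Internal M f) (hg : Internal M g) :
    Internal M fun x => f x - g x := by
  simp only [sub_eq_add_neg]; fun_prop

@[fun_prop] theorem Internal.q_of {f : X → M.car .nat} (hf : Internal M f) :
    Internal M fun x => (Frac.of (f x) : M.Q) := by
  have : ∀ x, (Frac.of (f x) : M.Q) = M.val (M.pair (M.pair (f x) 0) (M.prd 1)) := by
    intro x
    rw [val_pair_prd _ _ _ one_pos]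
    rfl
  simp only [this]
  fun_prop

@[fun_prop] theorem Internal.eps {f : X → M.car .nat} (hf : Internal M f) :
    Internal M fun x => M.eps (f x) := by
  have : ∀ x, M.eps (f x) = M.val (M.pair (M.pair 1 0) (M.prd (M.pow2 (f x)))) := by
    intro x
    rw [val_pair_prd _ _ _ (pow2_pos _)]
    rfl
  simp only [this]
  fun_prop

@[fun_prop] theorem Internal.q_lt {f g : X → M.Q} (hf : Internal M f) (hg : Internal M g) :
    Internal M fun x => f x < g x := by
  obtain ⟨c, hc, hc'⟩ := hf.exists_code
  obtain ⟨d, hd, hd'⟩ := hg.exists_code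
  simp only [hc', hd']
  exact internal_val_lt hc hd

@[fun_prop] theorem Internal.q_le {f g : X → M.Q} (hf : Internal M f) (hg : Internal M g) :
    Internal M fun x => f x ≤ g x := by
  have : Internal M fun x => ¬ g x < f x := by fun_prop
  exact this.congr fun x => not_lt

@[fun_prop] theorem Internal.q_eq {f g : X → M.Q} (hf : Internal M f) (hg : Internal M g) :
    Internal M fun x => f x = g x := by
  have : Internal M fun x => f x ≤ g x ∧ g x ≤ f x := by fun_prop
  exact this.congr fun x => le_antisymm_iff.symm

@[fun_prop] theorem Internal.q_ite {P : X → Prop} [∀ x, Decidable (P x)] {f g : X → M.Q}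
    (hP : Internal M P) (hf : Internal M f) (hg : Internal M g) :
    Internal M fun x => if P x then f x else g x := by
  obtain ⟨c, hc, hc'⟩ := hf.exists_code
  obtain ⟨d, hd, hd'⟩ := hg.exists_code
  simp only [hc', hd', ← apply_ite M.val]
  fun_prop

@[fun_prop] theorem Internal.q_abs {f : X → M.Q} (hf : Internal M f) :
    Internal M fun x => |f x| := by
  classical
  have : ∀ x, |f x| = if 0 ≤ f x then f x else -f x := by
    intro x
    split_ifs with h
    · exact abs_of_nonneg h
    · exact abs_of_neg (not_le.1 h)
  simp only [this]
  fun_prop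

theorem eps_anti {m n : M.car .nat} (h : m ≤ n) : M.eps n ≤ M.eps m := by
  obtain ⟨c, rfl⟩ := exists_add_of_le h
  refine nat_induction (P := fun c => M.eps (m + c) ≤ M.eps m) (by fun_prop) (by simp) ?_ c
  intro c hc
  rw [← add_assoc]
  linarith [eps_succ (m + c), eps_pos (m + c + 1)]

theorem eps_add (m n : M.car .nat) : M.eps (m + n) = M.eps m * M.eps n := by
  refine nat_induction (P := fun n => M.eps (m + n) = M.eps m * M.eps n) (by fun_prop) (by simp)
    ?_ n
  intro n hn
  rw [← eps_succ (m + n), ← eps_succ n] at hn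
  rw [← add_assoc]
  linarith

/-- This rests on n < 2^n, and explains why a sum of n reals converges fast when each summand is
read n places further. -/
theorem of_mul_eps_lt (n k : M.car .nat) : Frac.of n * M.eps (k + n) < M.eps k := by
  have h₁ : (Frac.of n : M.Q) < Frac.of (M.pow2 n) := Frac.of_lt_of.2 (lt_pow2 n)
  calc Frac.of n * M.eps (k + n) < Frac.of (M.pow2 n) * M.eps (k + n) :=
        mul_lt_mul_of_pos_right h₁ (eps_pos _)
    _ = M.eps k * (Frac.of (M.pow2 n) * M.eps n) := by rw [eps_add]; ring
    _ = M.eps k := by rw [of_pow2_mul_eps, mul_one]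

end Codes
end HOArith

namespace HOArith
open Filter

/-- Extensional equality of sequences compares codes and not the rationals coded, so agreement of
values would not be enough. -/
theorem eval_qAdd_congr {M : Str Const} {Γ Δ : List Ty} (e : Env M Γ) (e' : Env M Δ) {c d : Term Γ .nat}
    {c' d' : Term Δ .nat} (hc : c.eval e = c'.eval e') (hd : d.eval e = d'.eval e') :
    (qAdd c d).eval e = (qAdd c' d').eval e' := by
  simp only [qAdd, eval_mkQ, eval_prd, eval_mul, eval_add, qPos, qNeg, qDen, eval_suc, eval_fst,
    eval_snd, hc, hd]

section Sums

variable {M : Str Const} [Model M] {Γ : List Ty} {X : Type} [Obj M X]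

/-! ### Finite sums of rational numbers -/

/-- A code of the sum of the first `n` rational numbers with codes in a sequence. -/
def Str.codeSum (M : Str Const) (F : M.car .one) (n : M.car .nat) : M.car .nat :=
  M.recN ((lam (lam (qAdd v0 (v2 ⬝ v1)))).eval (Env.cons F Env.nil))
    ((qZero : Term [] .nat).eval Env.nil) n

theorem val_codeSum_zero (F : M.car .one) : M.val (M.codeSum F 0) = 0 := by
  rw [Str.codeSum, recN_zero, val_qZero]

theorem val_codeSum_succ (F : M.car .one) (n : M.car .nat) :
    M.val (M.codeSum F (n + 1)) = M.val (M.codeSum F n) + M.val (F n) := by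
  rw [Str.codeSum, recN_succ, eval_lam_app, eval_lam_app, val_qAdd]
  rfl

@[fun_prop] theorem Internal.codeSum {F : X → M.car .one} {n : X → M.car .nat}
    (hF : Internal M F) (hn : Internal M n) : Internal M fun x => M.codeSum (F x) (n x) :=
  Internal.recN (Internal.eval (Internal.env_cons hF Internal.env_nil) _) (Internal.const _) hn

theorem val_codeSum_congr {F G : M.car .one} (h : ∀ i, M.val (F i) = M.val (G i))
    (n : M.car .nat) : M.val (M.codeSum F n) = M.val (M.codeSum G n) := by
  refine nat_induction (P := fun n => M.val (M.codeSum F n) = M.val (M.codeSum G n))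
    (by fun_prop) (by simp only [val_codeSum_zero]) ?_ n
  intro n hn
  rw [val_codeSum_succ, val_codeSum_succ, hn, h]

open Classical in
/-- The sum `∑_{i<n} s(i)` of an internal sequence of rational numbers. -/
noncomputable def Str.sum (M : Str Const) [Model M] (s : M.car .nat → M.Q) (n : M.car .nat) :
    M.Q :=
  -- All coding sequences give the same value, so the choice is immaterial; `0` is a default for
  -- sequences that are not internal.
  if h : ∃ F : M.car .one, ∀ i, M.val (F i) = s i then M.val (M.codeSum h.choose n) else 0

theorem sum_eq_codeSum {s : M.car .nat → M.Q} {F : M.car .one} (h : ∀ i, M.val (F i) = s i)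
    (n : M.car .nat) : M.sum s n = M.val (M.codeSum F n) := by
  have h' : ∃ F : M.car .one, ∀ i, M.val (F i) = s i := ⟨F, h⟩
  rw [Str.sum, dif_pos h']
  exact val_codeSum_congr (fun i => by rw [h'.choose_spec, h]) n

theorem Internal.exists_seq {s : M.car .nat → M.Q} (hs : Internal M s) :
    ∃ F : M.car .one, ∀ i, M.val (F i) = s i := by
  obtain ⟨c, hc, hc'⟩ := hs.exists_code
  obtain ⟨F, hF⟩ := hc.exists_app
  exact ⟨F, fun i => by rw [hF, hc']⟩

theorem sum_zero {s : M.car .nat → M.Q} (hs : Internal M s) : M.sum s 0 = 0 := by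
  obtain ⟨F, hF⟩ := hs.exists_seq
  rw [sum_eq_codeSum hF, val_codeSum_zero]

theorem sum_succ {s : M.car .nat → M.Q} (hs : Internal M s) (n : M.car .nat) :
    M.sum s (n + 1) = M.sum s n + s n := by
  obtain ⟨F, hF⟩ := hs.exists_seq
  rw [sum_eq_codeSum hF, sum_eq_codeSum hF, val_codeSum_succ, hF]

@[fun_prop] theorem Internal.sum {s : X → M.car .nat → M.Q} {n : X → M.car .nat}
    (hs : Internal M fun p : X × M.car .nat => s p.1 p.2) (hn : Internal M n) :
    Internal M fun x => M.sum (s x) (n x) := by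
  obtain ⟨c, hc, hc'⟩ := hs.exists_code
  obtain ⟨F, hF, hF'⟩ := Internal.exists_lam (f := fun x i => c (x, i)) hc
  have : ∀ x, M.sum (s x) (n x) = M.val (M.codeSum (F x) (n x)) := fun x =>
    sum_eq_codeSum (fun i => by rw [hF']; exact (hc' (x, i)).symm) _
  simp only [this]
  fun_prop

theorem sum_le_sum {s t : M.car .nat → M.Q} (hs : Internal M s) (ht : Internal M t)
    {n : M.car .nat} (h : ∀ i < n, s i ≤ t i) : M.sum s n ≤ M.sum t n := by
  refine nat_induction (P := fun m => m ≤ n → M.sum s m ≤ M.sum t m) (by fun_prop) ?_ ?_ n le_rfl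
  · intro _; rw [sum_zero hs, sum_zero ht]
  · intro m ih hm
    rw [sum_succ hs, sum_succ ht]
    exact add_le_add (ih (le_self_add.trans hm)) (h m (nat_add_one_le.1 hm))

theorem sum_congr {s t : M.car .nat → M.Q} (hs : Internal M s) (ht : Internal M t)
    {n : M.car .nat} (h : ∀ i < n, s i = t i) : M.sum s n = M.sum t n :=
  le_antisymm (sum_le_sum hs ht fun i hi => (h i hi).le)
    (sum_le_sum ht hs fun i hi => (h i hi).ge)

theorem sum_add {s t : M.car .nat → M.Q} (hs : Internal M s) (ht : Internal M t)
    (n : M.car .nat) : M.sum (fun i => s i + t i) n = M.sum s n + M.sum t n := by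
  have hst : Internal M fun i => s i + t i := by fun_prop
  refine nat_induction (P := fun n => M.sum (fun i => s i + t i) n = M.sum s n + M.sum t n)
    (by fun_prop) ?_ ?_ n
  · rw [sum_zero hs, sum_zero ht, sum_zero hst, add_zero]
  · intro n hn
    rw [sum_succ hs, sum_succ ht, sum_succ hst, hn]
    ring

theorem sum_const (c : M.Q) (n : M.car .nat) : M.sum (fun _ => c) n = Frac.of n * c := by
  refine nat_induction (P := fun n => M.sum (fun _ => c) n = Frac.of n * c)
    (by fun_prop) ?_ ?_ n
  · rw [sum_zero (by fun_prop), map_zero, zero_mul]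
  · intro n hn
    rw [sum_succ (by fun_prop), hn, map_add, map_one]
    ring

theorem abs_sum_sub_sum_le {s t : M.car .nat → M.Q} (hs : Internal M s) (ht : Internal M t)
    {n : M.car .nat} {c : M.Q} (h : ∀ i < n, |s i - t i| ≤ c) :
    |M.sum s n - M.sum t n| ≤ Frac.of n * c := by
  have h₁ : M.sum s n ≤ M.sum (fun i => t i + c) n :=
    sum_le_sum hs (by fun_prop) fun i hi => by linarith [(abs_le.1 (h i hi)).2]
  have h₂ : M.sum t n ≤ M.sum (fun i => s i + c) n :=
    sum_le_sum ht (by fun_prop) fun i hi => by linarith [(abs_le.1 (h i hi)).1]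
  rw [sum_add ht (by fun_prop), sum_const] at h₁
  rw [sum_add hs (by fun_prop), sum_const] at h₂
  rw [abs_le]
  constructor <;> linarith

open Classical in
theorem sum_single (c : M.Q) {j n : M.car .nat} (h : j < n) :
    M.sum (fun i => if i = j then c else 0) n = c := by
  have hs : Internal M fun i : M.car .nat => if i = j then c else 0 := by fun_prop
  have key := nat_induction (P := fun n => (n ≤ j → M.sum (fun i => if i = j then c else 0) n = 0) ∧
    (j < n → M.sum (fun i => if i = j then c else 0) n = c)) (by fun_prop) ?_ ?_ n
  · exact key.2 h
  · exact ⟨fun _ => sum_zero hs, fun h => (nat_not_lt_zero _ h).elim⟩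
  · rintro n ⟨h₁, h₂⟩
    rw [sum_succ hs]
    refine ⟨fun h => ?_, fun h => ?_⟩
    · have h' := nat_add_one_le.1 h
      rw [h₁ h'.le, if_neg h'.ne, add_zero]
    · rcases (nat_lt_add_one.1 h).lt_or_eq with h' | rfl
      · rw [h₂ h', if_neg h'.ne', add_zero]
      · rw [h₁ le_rfl, if_pos rfl, zero_add]

/-- The sum of a non-negative sequence bounds the sums along injections. -/
theorem sum_comp_le_of_injOn {s : M.car .nat → M.Q} {f : M.car .nat → M.car .nat}
    {n m : M.car .nat} (hs : Internal M s) (hf : Internal M f) (h0 : ∀ j < m, 0 ≤ s j)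
    (hm : ∀ i < n, f i < m) (hinj : ∀ i < n, ∀ j < n, f i = f j → i = j) :
    M.sum (fun i => s (f i)) n ≤ M.sum s m := by
  classical
  have hsf : Internal M fun i => s (f i) := by fun_prop
  -- The first `k` terms along `f` are rewritten as a sum over the fixed range `m`, restricted to
  -- the indices already hit. The restricted sum is then compared termwise.
  have key := nat_induction (P := fun k => k ≤ n → M.sum (fun i => s (f i)) k =
    M.sum (fun j => if ∃ i, i < k ∧ f i = j then s j else 0) m) (by fun_prop) ?_ ?_ n le_rfl
  · rw [key]
    refine sum_le_sum (by fun_prop) hs fun j hj => ?_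
    split_ifs
    · exact le_rfl
    · exact h0 j hj
  · intro _
    rw [sum_zero hsf]
    have : M.sum (fun j => if ∃ i, i < 0 ∧ f i = j then s j else 0) m = M.sum (fun _ => 0) m := by
      congr 1
      funext j
      rw [if_neg]
      rintro ⟨i, hi, _⟩
      exact nat_not_lt_zero _ hi
    rw [this, sum_const, mul_zero]
  · intro k ih hk
    have hkn := nat_add_one_le.1 hk
    -- The new term becomes a sum concentrated at the index `f k`, which injectivity shows was not
    -- hit before.
    rw [sum_succ hsf, ih hkn.le, ← sum_single (s (f k)) (hm k hkn),
      ← sum_add (by fun_prop) (by fun_prop)]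
    congr 1
    funext j
    by_cases hj : j = f k
    · subst hj
      rw [if_pos rfl, if_neg, if_pos ⟨k, lt_add_one k, rfl⟩, zero_add]
      rintro ⟨i, hi, he⟩
      exact hi.ne (hinj i (hi.trans hkn) k hkn he)
    · rw [if_neg hj, add_zero]
      refine if_congr ⟨fun ⟨i, hi, he⟩ => ⟨i, hi.trans (lt_add_one k), he⟩, fun ⟨i, hi, he⟩ => ?_⟩
        rfl rfl
      rcases (nat_lt_add_one.1 hi).lt_or_eq with h | rfl
      · exact ⟨i, h, he⟩
      · exact (hj he.symm).elim

end Sums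

/-! ### Real numbers -/

section Reals

variable {M : Str Const} [Model M] {Γ : List Ty} {X : Type} [Obj M X]

/-- Fast converging sequences. -/
def Str.IsReal (M : Str Const) [Model M] (x : M.car .one) : Prop :=
  ∀ n i, |M.val (x n) - M.val (x (n + i))| < M.eps n

/-- Equality of real numbers. -/
def Str.REq (M : Str Const) [Model M] (x y : M.car .one) : Prop :=
  ∀ n, |M.val (x n) - M.val (y n)| ≤ 2 * M.eps n

/-- The strict order of the real numbers. -/
def Str.RLt (M : Str Const) [Model M] (x y : M.car .one) : Prop :=
  ∃ n, M.val (x n) + 2 * M.eps n < M.val (y n)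

/-- The real numbers in the unit interval. -/
def Str.InUnit (M : Str Const) [Model M] (x : M.car .one) : Prop :=
  M.IsReal x ∧ ∀ n, 0 ≤ M.val (x n) + 2 * M.eps n ∧ M.val (x n) ≤ 1 + 2 * M.eps n

/-- The sum of two real numbers. -/
def Str.rAdd (M : Str Const) (x y : M.car .one) : M.car .one :=
  (HOArith.rAdd (Γ := [.one, .one]) v0 v1).eval (Env.cons x (Env.cons y Env.nil))

/-- Finite sums of real numbers. -/
def Str.finSum (M : Str Const) (a : M.car (.one ⇒ .one)) (n : M.car .nat) (w : M.car .seq) :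
    M.car .one :=
  (HOArith.finSum (Γ := [.one ⇒ .one, .nat, .seq]) v0 v1 v2).eval
    (Env.cons a (Env.cons n (Env.cons w Env.nil)))

@[simp] theorem eval_ofQ_app (e : Env M Γ) (c : Term Γ .nat) (n : M.car .nat) :
    (ofQ c).eval e n = c.eval e := by simp [ofQ]

@[simp] theorem eval_rAdd (e : Env M Γ) (x y : Term Γ .one) :
    (HOArith.rAdd x y).eval e = M.rAdd (x.eval e) (y.eval e) := by
  refine Model.ext fun n => ?_
  simp only [HOArith.rAdd, Str.rAdd, eval_lam_app]
  exact eval_qAdd_congr _ _ (by simp) (by simp)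

theorem val_rAdd (x y : M.car .one) (n : M.car .nat) :
    M.val (M.rAdd x y n) = M.val (x (n + 1)) + M.val (y (n + 1)) := by
  simp [Str.rAdd, HOArith.rAdd]

@[simp] theorem eval_finSum (e : Env M Γ) (a : Term Γ (.one ⇒ .one)) (n : Term Γ .nat)
    (w : Term Γ .seq) :
    (HOArith.finSum a n w).eval e = M.finSum (a.eval e) (n.eval e) (w.eval e) := by
  refine Model.ext fun k => ?_
  simp only [HOArith.finSum, Str.finSum, eval_lam_app, eval_rec0, Tm.eval_wk, eval_var, cons_zero,
    cons_succ, qZero, eval_mkQ, eval_zero]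
  refine congrArg (fun f => M.recN f _ _) (Model.ext₂ fun i r => ?_)
  simp only [eval_lam_app]
  exact eval_qAdd_congr _ _ (by simp) (by simp)

theorem val_finSum (a : M.car (.one ⇒ .one)) (n : M.car .nat) (w : M.car .seq) (k : M.car .nat) :
    M.val (M.finSum a n w k) = M.sum (fun i => M.val (a (w i) (k + n))) n := by
  have hs : Internal M fun i => M.val (a (w i) (k + n)) := by fun_prop
  simp only [Str.finSum, HOArith.finSum, eval_lam_app, eval_rec0, Tm.eval_wk, eval_var, cons_zero,
    cons_succ]
  set G := Tm.eval _ (lam _) with hG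
  refine nat_induction (P := fun m => M.val (M.recN G _ m) =
    M.sum (fun i => M.val (a (w i) (k + n))) m) (by fun_prop) ?_ ?_ n
  · rw [recN_zero, val_qZero, sum_zero hs]
  · intro m hm
    rw [recN_succ, sum_succ hs, ← hm, hG]
    simp

@[simp] theorem sat_isReal (e : Env M Γ) (x : Term Γ .one) :
    (isReal x).Sat e ↔ M.IsReal (x.eval e) := by
  simp [isReal, Str.IsReal]

@[simp] theorem sat_rEq (e : Env M Γ) (x y : Term Γ .one) :
    (rEq x y).Sat e ↔ M.REq (x.eval e) (y.eval e) := by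
  simp [rEq, Str.REq]

@[simp] theorem sat_rLt (e : Env M Γ) (x y : Term Γ .one) :
    (rLt x y).Sat e ↔ M.RLt (x.eval e) (y.eval e) := by
  simp [rLt, Str.RLt]

@[simp] theorem sat_rLe (e : Env M Γ) (x y : Term Γ .one) :
    (rLe x y).Sat e ↔ ¬ M.RLt (y.eval e) (x.eval e) := by
  simp [rLe]

@[simp] theorem sat_inUnit (e : Env M Γ) (x : Term Γ .one) :
    (inUnit x).Sat e ↔ M.InUnit (x.eval e) := by
  simp only [inUnit, sat_and, sat_isReal, sat_rLe, Str.InUnit, Str.RLt, eval_ofQ_app, val_qZero,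
    val_qOne, not_exists, not_lt, forall_and]

@[simp] theorem sat_rDistLt (e : Env M Γ) (x y r : Term Γ .one) : (rDistLt x y r).Sat e ↔
    M.RLt (x.eval e) (M.rAdd (y.eval e) (r.eval e)) ∧
      M.RLt (y.eval e) (M.rAdd (x.eval e) (r.eval e)) := by
  simp [rDistLt]

@[fun_prop] theorem Internal.isReal {f : X → M.car .one} (hf : Internal M f) :
    Internal M fun x => M.IsReal (f x) := by
  unfold Str.IsReal; fun_prop

@[fun_prop] theorem Internal.rEq {f g : X → M.car .one} (hf : Internal M f) (hg : Internal M g) :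
    Internal M fun x => M.REq (f x) (g x) := by
  unfold Str.REq; fun_prop

@[fun_prop] theorem Internal.rLt {f g : X → M.car .one} (hf : Internal M f) (hg : Internal M g) :
    Internal M fun x => M.RLt (f x) (g x) := by
  unfold Str.RLt; fun_prop

@[fun_prop] theorem Internal.inUnit {f : X → M.car .one} (hf : Internal M f) :
    Internal M fun x => M.InUnit (f x) := by
  unfold Str.InUnit; fun_prop

@[fun_prop] theorem Internal.rAdd {f g : X → M.car .one} (hf : Internal M f) (hg : Internal M g) :
    Internal M fun x => M.rAdd (f x) (g x) :=
  Internal.eval (Internal.env_cons hf (Internal.env_cons hg Internal.env_nil)) _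

@[fun_prop] theorem Internal.finSum {a : X → M.car (.one ⇒ .one)} {n : X → M.car .nat}
    {w : X → M.car .seq} (ha : Internal M a) (hn : Internal M n) (hw : Internal M w) :
    Internal M fun x => M.finSum (a x) (n x) (w x) :=
  Internal.eval (Internal.env_cons ha (Internal.env_cons hn
    (Internal.env_cons hw Internal.env_nil))) _

/-- A positive fraction with denominator d is at least 1/d, which exceeds 2^(-d). The exponent is a
number of the model, so nonstandard models make no difference. -/
theorem exists_eps_le {q : M.Q} (hq : 0 < q) : ∃ m, M.eps m ≤ q := by
  induction q using Frac.ind with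
  | _ a =>
    refine ⟨a.den, not_lt.1 fun h => ?_⟩
    have h₁ := of_mul_eps_lt a.den (0 : M.car .nat)
    have h₂ := Frac.of_mul_mk a
    have h₃ : (0 : M.Q) < Frac.of a.den := by
      rw [← map_zero Frac.of]; exact Frac.of_lt_of.2 a.den_pos
    have h₄ : (Frac.of (a.neg + 1) : M.Q) ≤ Frac.of a.pos :=
      Frac.of_le_of.2 (nat_add_one_le.2 (Frac.mk_pos.1 hq))
    rw [map_add, map_one] at h₄
    rw [zero_add, eps_zero] at h₁
    have h₅ := mul_lt_mul_of_pos_left h h₃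
    linarith

theorem le_of_forall_eps {p q : M.Q} (h : ∀ m, p ≤ q + M.eps m) : p ≤ q := by
  by_contra hpq
  obtain ⟨m, hm⟩ := exists_eps_le (sub_pos.2 (not_le.1 hpq))
  linarith [h (m + 1), eps_succ m, eps_pos (m + 1)]

theorem two_mul_eps_le {m n : M.car .nat} (h : m + 1 ≤ n) : 2 * M.eps n ≤ M.eps m := by
  linarith [eps_anti h, eps_succ m]

theorem Str.IsReal.abs_sub_lt {x : M.car .one} (hx : M.IsReal x) {m n : M.car .nat} (h : m ≤ n) :
    |M.val (x m) - M.val (x n)| < M.eps m := by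
  obtain ⟨c, rfl⟩ := exists_add_of_le h
  exact hx m c

/-- The eventual form, like that in `rEq_iff`, frees estimates from the fixed moduli of the
definition: finitely many of them can be combined at one large index. -/
theorem rLt_iff {x y : M.car .one} (hx : M.IsReal x) (hy : M.IsReal y) :
    M.RLt x y ↔ ∃ m, ∀ᶠ n in atTop, M.val (x n) + M.eps m ≤ M.val (y n) := by
  constructor
  · rintro ⟨k, hk⟩
    obtain ⟨m, hm⟩ := exists_eps_le (sub_pos.2 hk)
    refine ⟨m, (eventually_ge_atTop k).mono fun n hn => ?_⟩
    have h₁ := (abs_lt.1 (hx.abs_sub_lt hn)).1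
    have h₂ := (abs_lt.1 (hy.abs_sub_lt hn)).2
    linarith
  · rintro ⟨m, hm⟩
    obtain ⟨n, hn, hn'⟩ := (hm.and (eventually_ge_atTop (m + 1 + 1))).exists
    refine ⟨n, ?_⟩
    linarith [two_mul_eps_le hn', eps_succ m, eps_pos (m + 1)]

theorem rEq_iff {x y : M.car .one} (hx : M.IsReal x) (hy : M.IsReal y) :
    M.REq x y ↔ ∀ m, ∀ᶠ n in atTop, |M.val (x n) - M.val (y n)| ≤ M.eps m := by
  constructor
  · intro h m
    exact (eventually_ge_atTop (m + 1)).mono fun n hn => (h n).trans (two_mul_eps_le hn)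
  · intro h n
    refine le_of_forall_eps fun m => ?_
    obtain ⟨k, hk, hk'⟩ := ((h m).and (eventually_ge_atTop n)).exists
    have h₁ := abs_lt.1 (hx.abs_sub_lt hk')
    have h₂ := abs_lt.1 (hy.abs_sub_lt hk')
    rw [abs_le] at hk ⊢
    constructor <;> linarith

theorem Str.REq.refl (x : M.car .one) : M.REq x x := fun n => by
  rw [sub_self, abs_zero]; linarith [eps_pos n]

theorem Str.REq.symm {x y : M.car .one} (h : M.REq x y) : M.REq y x := fun n => by
  rw [abs_sub_comm]; exact h n

theorem Str.REq.trans {x y z : M.car .one} (hx : M.IsReal x) (hy : M.IsReal y) (hz : M.IsReal z)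
    (h₁ : M.REq x y) (h₂ : M.REq y z) : M.REq x z := by
  rw [rEq_iff hx hz]
  intro m
  filter_upwards [(rEq_iff hx hy).1 h₁ (m + 1), (rEq_iff hy hz).1 h₂ (m + 1)] with n h₁ h₂
  have := abs_sub_le (M.val (x n)) (M.val (y n)) (M.val (z n))
  linarith [eps_succ m]

theorem isReal_const {x : M.car .one} {q : M.Q} (h : ∀ n, M.val (x n) = q) : M.IsReal x :=
  fun n i => by rw [h, h, sub_self, abs_zero]; exact eps_pos n

theorem Str.IsReal.rAdd {x y : M.car .one} (hx : M.IsReal x) (hy : M.IsReal y) :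
    M.IsReal (M.rAdd x y) := by
  intro n i
  rw [val_rAdd, val_rAdd]
  have h₁ := abs_lt.1 (hx.abs_sub_lt (m := n + 1) (n := n + i + 1)
    (add_le_add_left le_self_add _))
  have h₂ := abs_lt.1 (hy.abs_sub_lt (m := n + 1) (n := n + i + 1)
    (add_le_add_left le_self_add _))
  rw [abs_lt]
  constructor <;> linarith [eps_succ n]

/-- Each of the n summands is off by less than 2^(-(k+n)), so the total error stays below 2^(-k). -/
theorem isReal_finSum {a : M.car (.one ⇒ .one)} {n : M.car .nat} {w : M.car .seq}
    (h : ∀ i < n, M.IsReal (a (w i))) : M.IsReal (M.finSum a n w) := by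
  intro k l
  rw [val_finSum, val_finSum]
  refine (abs_sum_sub_sum_le (c := M.eps (k + n)) (by fun_prop) (by fun_prop)
    fun i hi => ?_).trans_lt (of_mul_eps_lt n k)
  exact ((h i hi).abs_sub_lt (add_le_add_left le_self_add _)).le

end Reals
end HOArith

namespace HOArith
open Filter

section Summable

variable {M : Str Const} [Model M] {Γ : List Ty} {X : Type} [Obj M X]

/-! ### Families of reals indexed by the unit interval -/

/-- Finite sequences of reals in the unit interval without repetitions. -/
def Str.IsFin (M : Str Const) [Model M] (n : M.car .nat) (w : M.car .seq) : Prop :=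
  (∀ i, i < n → M.InUnit (w i)) ∧
    ∀ i j, i < n → j < n → ¬ i = j → ¬ M.REq (w i) (w j)

/-- Inclusion of finite sequences. -/
def Str.IsSub (M : Str Const) [Model M] (n : M.car .nat) (w : M.car .seq) (n' : M.car .nat)
    (w' : M.car .seq) : Prop :=
  ∀ i, i < n → ∃ j, j < n' ∧ M.REq (w i) (w' j)

/-- Functions from the unit interval to the reals. -/
def Str.IsRealFun (M : Str Const) [Model M] (a : M.car (.one ⇒ .one)) : Prop :=
  (∀ x, M.InUnit x → M.IsReal (a x)) ∧
    ∀ x y, M.InUnit x → M.InUnit y → M.REq x y → M.REq (a x) (a y)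

/-- Non-negative functions on the unit interval. -/
def Str.IsNonneg (M : Str Const) [Model M] (a : M.car (.one ⇒ .one)) : Prop :=
  ∀ x, M.InUnit x → ∀ n, 0 ≤ M.val (a x n) + 2 * M.eps n

/-- Limits of the net of the finite sums. -/
def Str.IsNetLimit (M : Str Const) [Model M] (a : M.car (.one ⇒ .one)) (b : M.car .one) : Prop :=
  ∀ r, M.IsReal r → (∃ n, 2 * M.eps n < M.val (r n)) → ∃ n w, M.IsFin n w ∧
    ∀ n' w', M.IsFin n' w' → M.IsSub n w n' w' →
      M.RLt (M.finSum a n' w') (M.rAdd b r) ∧ M.RLt b (M.rAdd (M.finSum a n' w') r)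

theorem sat_isFin (e : Env M Γ) (n : Term Γ .nat) (w : Term Γ .seq) :
    (isFin n w).Sat e ↔ M.IsFin (n.eval e) (w.eval e) := by
  simp [isFin, Str.IsFin]

theorem sat_isSub (e : Env M Γ) (n : Term Γ .nat) (w : Term Γ .seq) (n' : Term Γ .nat)
    (w' : Term Γ .seq) : (isSub n w n' w').Sat e ↔
      M.IsSub (n.eval e) (w.eval e) (n'.eval e) (w'.eval e) := by
  simp [isSub, Str.IsSub]

theorem sat_isRealFun (e : Env M Γ) (a : Term Γ (.one ⇒ .one)) :
    (isRealFun a).Sat e ↔ M.IsRealFun (a.eval e) := by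
  simp [isRealFun, Str.IsRealFun]

theorem sat_isNonneg (e : Env M Γ) (a : Term Γ (.one ⇒ .one)) :
    (isNonneg a).Sat e ↔ M.IsNonneg (a.eval e) := by
  simp [isNonneg, Str.IsNonneg, Str.RLt]

theorem sat_isNetLimit (e : Env M Γ) (a : Term Γ (.one ⇒ .one)) (b : Term Γ .one) :
    (isNetLimit a b).Sat e ↔ M.IsNetLimit (a.eval e) (b.eval e) := by
  simp [isNetLimit, Str.IsNetLimit, Str.RLt, sat_isFin, sat_isSub]

theorem sat_sum' : SUM'.Sat (Env.nil : Env M []) ↔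
    ∀ a : M.car (.one ⇒ .one), M.IsRealFun a → M.IsNonneg a →
      (∃ b, M.IsReal b ∧ M.IsNetLimit a b) →
      ∃ y : M.car .seq, (∀ i, M.InUnit (y i)) ∧ ∀ z, M.InUnit z → (∀ i, ¬ M.REq z (y i)) →
        ∀ n, |M.val (a z n)| ≤ 2 * M.eps n := by
  simp [SUM', isSummable, sat_isRealFun, sat_isNonneg, sat_isNetLimit, Str.REq]

@[fun_prop] theorem Internal.isFin {n : X → M.car .nat} {w : X → M.car .seq} (hn : Internal M n)
    (hw : Internal M w) : Internal M fun x => M.IsFin (n x) (w x) := by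
  unfold Str.IsFin; fun_prop

theorem Str.IsSub.refl (n : M.car .nat) (w : M.car .seq) : M.IsSub n w n w :=
  fun i hi => ⟨i, hi, Str.REq.refl _⟩

/-- The sum of the `k`-th approximations of the summands. -/
noncomputable def Str.approxSum (M : Str Const) [Model M] (a : M.car (.one ⇒ .one))
    (n : M.car .nat) (w : M.car .seq) (k : M.car .nat) : M.Q :=
  M.sum (fun i => M.val (a (w i) k)) n

/-- `finSum` shifts its precision by its own length; in terms of `approxSum`, sums of different
lengths can be compared at a common precision. -/
theorem val_finSum_eq (a : M.car (.one ⇒ .one)) (n : M.car .nat) (w : M.car .seq)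
    (k : M.car .nat) : M.val (M.finSum a n w k) = M.approxSum a n w (k + n) :=
  val_finSum a n w k

theorem abs_approxSum_sub_le {a : M.car (.one ⇒ .one)} {n : M.car .nat} {w : M.car .seq}
    (h : ∀ i < n, M.IsReal (a (w i))) {k l : M.car .nat} (hkl : k ≤ l) :
    |M.approxSum a n w k - M.approxSum a n w l| ≤ Frac.of n * M.eps k :=
  abs_sum_sub_sum_le (by fun_prop) (by fun_prop) fun i hi => ((h i hi).abs_sub_lt hkl).le

theorem eventually_of_mul_eps_le (n r : M.car .nat) :
    ∀ᶠ k in atTop, Frac.of n * M.eps k ≤ M.eps r := by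
  refine (eventually_ge_atTop (r + n)).mono fun k hk => ?_
  have h₀ : (0 : M.Q) ≤ Frac.of n := by rw [← map_zero Frac.of]; exact Frac.of_le_of.2 (nat_zero_le n)
  exact (mul_le_mul_of_nonneg_left (eps_anti hk) h₀).trans (of_mul_eps_lt n r).le

theorem eventually_eps_le (r : M.car .nat) : ∀ᶠ k in atTop, M.eps k ≤ M.eps r :=
  (eventually_ge_atTop r).mono fun _ hk => eps_anti hk

/-- Sending an index to the least index of an equal entry is injective because the entries of `w`
are distinct. Adding 2·2^(-k) to each term of the longer sum makes all its terms non-negative and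
also absorbs the discrepancy between approximations of equal reals; this costs the error term. -/
theorem approxSum_le_of_isSub {a : M.car (.one ⇒ .one)} (ha : M.IsRealFun a) (ha0 : M.IsNonneg a)
    {n n' : M.car .nat} {w w' : M.car .seq} (hw : M.IsFin n w) (hw' : M.IsFin n' w')
    (hsub : M.IsSub n w n' w') (k : M.car .nat) :
    M.approxSum a n w k ≤ M.approxSum a n' w' k + 2 * (Frac.of n' * M.eps k) := by
  obtain ⟨f, hf, hf'⟩ := Internal.exists_least (M := M) (X := M.car .nat)
    (P := fun i j => j < n' ∧ M.REq (w i) (w' j)) (by fun_prop)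
  have hspec : ∀ i < n, f i < n' ∧ M.REq (w i) (w' (f i)) := fun i hi => (hf' i (hsub i hi)).1
  have hs : Internal M fun j => M.val (a (w' j) k) + 2 * M.eps k := by fun_prop
  have h₁ : M.approxSum a n w k ≤ M.sum (fun i => M.val (a (w' (f i)) k) + 2 * M.eps k) n := by
    refine sum_le_sum (by fun_prop) (by fun_prop) fun i hi => ?_
    have := ha.2 _ _ (hw.1 i hi) (hw'.1 _ (hspec i hi).1) (hspec i hi).2 k
    linarith [(abs_le.1 this).2]
  have h₂ := sum_comp_le_of_injOn (n := n) (m := n') hs hf (fun j hj => ha0 _ (hw'.1 j hj) k)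
    (fun i hi => (hspec i hi).1) fun i hi j hj hij => by
      by_contra hne
      refine hw.2 i j hi hj hne ?_
      have hr := fun i hi => (hw.1 i hi).1
      refine Str.REq.trans (hr i hi) (hw'.1 _ (hspec i hi).1).1 (hr j hj) (hspec i hi).2 ?_
      rw [hij]
      exact (hspec j hj).2.symm
  refine (h₁.trans h₂).trans (le_of_eq ?_)
  rw [Str.approxSum, sum_add (by fun_prop) (by fun_prop), sum_const]
  ring

/-- Primitive recursion. -/
theorem Internal.exists_rec {g : M.car .nat → M.car .nat → M.car .nat}
    (hg : Internal M fun p : M.car .nat × M.car .nat => g p.1 p.2) (m : M.car .nat) :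
    ∃ c : M.car .nat → M.car .nat, Internal M c ∧ c 0 = m ∧ ∀ n, c (n + 1) = g n (c n) := by
  obtain ⟨G, hG⟩ := hg.exists_app₂
  exact ⟨fun n => M.recN G m n, by fun_prop, recN_zero _ _, fun n => (recN_succ _ _ _).trans (hG _ _)⟩

/-- Every finite sequence has the same entries as one without repetitions. -/
theorem exists_isFin (u : M.car .seq) (m : M.car .nat) (hu : ∀ i < m, M.InUnit (u i)) :
    ∃ n w, M.IsFin n w ∧ M.IsSub m u n w := by
  classical
  -- Only first occurrences are kept. The function `c` counts the kept indices below its argument,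
  -- and so numbers them consecutively from 0.
  set kept : M.car .nat → Prop := fun i => ∀ j, j < i → ¬ M.REq (u j) (u i) with hkept
  have ikept : Internal M kept := by rw [hkept]; fun_prop
  obtain ⟨c, hc, hc0, hcs⟩ := Internal.exists_rec (M := M)
    (g := fun i r => r + if kept i then 1 else 0) (by fun_prop) 0
  have mono : ∀ {i j}, i ≤ j → c i ≤ c j := by
    intro i j hij
    obtain ⟨d, rfl⟩ := exists_add_of_le hij
    refine nat_induction (P := fun d => c i ≤ c (i + d)) (by fun_prop) (by simp) ?_ d
    intro d hd
    rw [← add_assoc, hcs]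
    exact le_add_right hd
  have strict : ∀ {i j}, kept i → i < j → c i < c j := by
    intro i j hi hij
    refine lt_of_lt_of_le ?_ (mono (nat_add_one_le.2 hij))
    rw [hcs, if_pos hi]
    exact lt_add_one _
  have inj : ∀ {i j}, kept i → kept j → c i = c j → i = j := by
    intro i j hi hj hij
    rcases lt_trichotomy i j with h | h | h
    · exact absurd hij (strict hi h).ne
    · exact h
    · exact absurd hij (strict hj h).ne'
  have surj : ∀ k < c m, ∃ i, i < m ∧ kept i ∧ c i = k := by
    refine nat_induction (P := fun m => ∀ k, k < c m → ∃ i, i < m ∧ kept i ∧ c i = k)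
      (by fun_prop) ?_ ?_ m
    · intro k hk; rw [hc0] at hk; exact (nat_not_lt_zero _ hk).elim
    · intro m ih k hk
      rw [hcs] at hk
      split_ifs at hk with hm
      · rcases (nat_lt_add_one.1 hk).lt_or_eq with h | h
        · obtain ⟨i, hi, h'⟩ := ih k h
          exact ⟨i, hi.trans (lt_add_one m), h'⟩
        · exact ⟨m, lt_add_one m, hm, h.symm⟩
      · rw [add_zero] at hk
        obtain ⟨i, hi, h'⟩ := ih k hk
        exact ⟨i, hi.trans (lt_add_one m), h'⟩
  -- `e k` is the kept index with number `k`.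
  obtain ⟨e, he, he'⟩ := Internal.exists_least (M := M) (X := M.car .nat)
    (P := fun k i => i < m ∧ kept i ∧ c i = k) (by fun_prop)
  have hspec : ∀ k < c m, e k < m ∧ kept (e k) ∧ c (e k) = k := fun k hk => (he' k (surj k hk)).1
  obtain ⟨w, hw⟩ := Internal.exists_app (M := M) (f := fun k => u (e k)) (by fun_prop)
  refine ⟨c m, w, ⟨fun k hk => ?_, fun k l hk hl hkl => ?_⟩, fun i hi => ?_⟩
  · rw [hw]; exact hu _ (hspec k hk).1
  · rw [hw, hw]
    obtain ⟨_, h₁, h₂⟩ := hspec k hk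
    obtain ⟨_, h₃, h₄⟩ := hspec l hl
    rcases lt_trichotomy (e k) (e l) with h | h | h
    · exact h₃ _ h
    · exact absurd (h₂.symm.trans ((congrArg c h).trans h₄)) hkl
    · exact fun h' => h₁ _ h h'.symm
  -- The first index whose entry equals `u i` is kept, by transitivity of equality.
  · obtain ⟨f, -, hf⟩ := Internal.exists_least (M := M) (X := Unit)
      (P := fun _ j => j < i + 1 ∧ M.REq (u j) (u i)) (by fun_prop)
    obtain ⟨⟨h₁, h₂⟩, h₃⟩ := hf () ⟨i, lt_add_one i, Str.REq.refl _⟩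
    set j := f ()
    have hjm : j < m := (nat_lt_add_one.1 h₁).trans_lt hi
    have hj : kept j := by
      intro l hl hlj
      refine h₃ l hl ⟨hl.trans h₁, ?_⟩
      exact Str.REq.trans (hu l (hl.trans hjm)).1 (hu j hjm).1 (hu i hi).1 hlj h₂
    have hlt := strict hj hjm
    obtain ⟨_, h₄, h₅⟩ := hspec _ hlt
    refine ⟨c j, hlt, ?_⟩
    rw [hw, inj h₄ hj h₅]
    exact h₂.symm

theorem exists_const_real (q : M.Q) : ∃ r : M.car .one, ∀ n, M.val (r n) = q := by
  obtain ⟨c, hc⟩ := val_surjective q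
  obtain ⟨r, hr⟩ := Internal.exists_app (M := M) (f := fun _ : M.car .nat => c) (by fun_prop)
  exact ⟨r, fun n => by rw [hr, hc]⟩

/-- The net limit of a non-negative family bounds all finite sums. -/
theorem approxSum_le_of_isNetLimit {a : M.car (.one ⇒ .one)} (ha : M.IsRealFun a)
    (ha0 : M.IsNonneg a) {b : M.car .one} (hb : M.IsReal b) (hab : M.IsNetLimit a b)
    {n : M.car .nat} {w : M.car .seq} (hw : M.IsFin n w) (m : M.car .nat) :
    ∀ᶠ k in atTop, M.approxSum a n w k ≤ M.val (b k) + M.eps m := by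
  classical
  obtain ⟨r, hr⟩ := exists_const_real (M.eps (m + 1))
  have hr' : M.IsReal r := isReal_const hr
  obtain ⟨n₀, w₀, hw₀, H⟩ := hab r hr' ⟨m + 1 + 1 + 1, by
    rw [hr]
    linarith [eps_succ (m + 1), eps_succ (m + 1 + 1), eps_pos (m + 1 + 1 + 1)]⟩
  -- The concatenation of `w₀` and `w`. After repetitions are removed, the result contains `w₀`, so
  -- its sum is close to `b`, and it contains `w`, so its sum dominates that of `w`.
  obtain ⟨u, hu⟩ := Internal.exists_app (M := M)
    (f := fun i => if i < n₀ then w₀ i else w (i - n₀)) (by fun_prop)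
  obtain ⟨n', w', hw', hsub⟩ := exists_isFin u (n₀ + n) fun i hi => by
    rw [hu]
    split_ifs with h
    · exact hw₀.1 i h
    · refine hw.1 _ ?_
      rwa [tsub_lt_iff_left (not_lt.1 h)]
  have hsub₀ : M.IsSub n₀ w₀ n' w' := fun i hi => by
    have := hsub i (hi.trans_le le_self_add)
    rwa [hu, if_pos hi] at this
  have hsub₁ : M.IsSub n w n' w' := fun i hi => by
    have := hsub (n₀ + i) (add_lt_add_right hi n₀)
    rwa [hu, if_neg (not_lt.2 le_self_add), add_tsub_cancel_left] at this
  have hreal : ∀ i < n', M.IsReal (a (w' i)) := fun i hi => ha.1 _ (hw'.1 i hi)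
  obtain ⟨l, hl⟩ := (rLt_iff (isReal_finSum hreal) (hb.rAdd hr')).1 (H n' w' hw' hsub₀).1
  -- Error budget: 2^(-(m+1)) from `r`, and four errors of at most 2^(-(m+3)): two from the
  -- inclusion, one from the change of precision, one from `b`.
  filter_upwards [hl, eventually_of_mul_eps_le n' (m + 1 + 1 + 1), eventually_eps_le (m + 1 + 1 + 1)]
    with k h₁ h₂ h₃
  rw [val_finSum_eq, val_rAdd, hr] at h₁
  have h₄ := approxSum_le_of_isSub ha ha0 hw hw' hsub₁ k
  have h₅ := (abs_le.1 (abs_approxSum_sub_le hreal (le_self_add : k ≤ k + n'))).2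
  have h₆ := (abs_lt.1 (hb.abs_sub_lt (le_self_add : k ≤ k + 1))).1
  linarith [eps_succ m, eps_succ (m + 1), eps_succ (m + 1 + 1), eps_pos l]

/-- Choice for internal predicates, from `QF-AC^{0,1}`. -/
theorem exists_choice (hAC : ∀ φ, QFAC .nat .one φ → φ.Sat (Env.nil : Env M []))
    {P : M.car .nat → M.car .one → Prop}
    (hP : Internal M fun p : M.car .nat × M.car .one => P p.1 p.2) (h : ∀ n, ∃ y, P n y) :
    ∃ Y : M.car .seq, ∀ n, P n (Y n) := by
  obtain ⟨c, hc, hc'⟩ := hP.exists_char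
  obtain ⟨F, hF⟩ := Internal.exists_app₂ (f := fun x y => c (x, y)) hc
  have key : ∀ n y, P n y ↔ F n y = 0 := fun n y => by rw [hF]; exact hc' (n, y)
  -- The characteristic function of `P` enters as a parameter, which leaves an equation as the
  -- quantifier-free matrix.
  have H := (Fm.sat_close _).1 (hAC _ (QFAC.mk (Γ := [.nat ⇒ .one ⇒ .nat])
    (v2 ⬝ v1 ⬝ v0 ≐ zero) trivial)) (Env.cons F Env.nil)
  simp only [acFm, sat_imp, sat_all, sat_ex, sat_eq, Fm.sat_subst, eval_app, eval_var, eval_zero,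
    choiceSubst, cons_zero, cons_succ] at H
  simp only [key] at h ⊢
  exact H h

theorem isFin_append {n : M.car .nat} {w u : M.car .seq} {z : M.car .one} (hw : M.IsFin n w)
    (hz : M.InUnit z) (hne : ∀ i < n, ¬ M.REq z (w i)) (hu : ∀ i < n, u i = w i) (hun : u n = z) :
    M.IsFin (n + 1) u := by
  constructor
  · intro i hi
    rcases (nat_lt_add_one.1 hi).lt_or_eq with h | rfl
    · rw [hu i h]; exact hw.1 i h
    · rwa [hun]
  · intro i j hi hj hij
    rcases (nat_lt_add_one.1 hi).lt_or_eq with h | rfl <;>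
      rcases (nat_lt_add_one.1 hj).lt_or_eq with h' | rfl
    · rw [hu i h, hu j h']; exact hw.2 i j h h' hij
    · rw [hu i h, hun]; exact fun h' => hne i h h'.symm
    · rw [hu j h', hun]; exact hne j h'
    · exact absurd rfl hij

theorem approxSum_append {a : M.car (.one ⇒ .one)} {n : M.car .nat} {w u : M.car .seq}
    (hu : ∀ i < n, u i = w i) (k : M.car .nat) :
    M.approxSum a (n + 1) u k = M.approxSum a n w k + M.val (a (u n) k) := by
  have : M.approxSum a n u k = M.approxSum a n w k :=
    sum_congr (by fun_prop) (by fun_prop) fun i hi => by rw [hu i hi]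
  rw [← this]
  exact sum_succ (by fun_prop) n

/-- `SUM'` in models of `ACA₀^ω + QF-AC^{0,1}`. -/
theorem model_sum' (hAC : ∀ φ, QFAC .nat .one φ → φ.Sat (Env.nil : Env M [])) :
    SUM'.Sat (Env.nil : Env M []) := by
  classical
  rw [sat_sum']
  rintro a ha ha0 ⟨b, hb, hab⟩
  obtain ⟨ce, hce, hce'⟩ := Internal.exists_code (M := M) (X := M.car .nat × M.car .nat)
    (f := fun p => M.eps p.1) (by fun_prop)
  obtain ⟨E, hE⟩ := Internal.exists_app₂ (f := fun n k => ce (n, k)) hce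
  have hEv : ∀ n k, M.val (E n k) = M.eps n := fun n k => by rw [hE]; exact (hce' (n, k)).symm
  have hEr : ∀ n, M.IsReal (E n) := fun n => isReal_const (hEv n)
  -- The choice axiom yields objects of type 1 only, so a finite sequence of reals is packed into
  -- one `y`: the length is `y 0`, and the approximations follow at shifted pair codes, from which
  -- `D` recovers them.
  obtain ⟨D, hD⟩ := Internal.exists_app₃ (M := M) (σ := .one) (τ := .nat) (ρ := .nat)
    (f := fun y i k => y (M.pair i k + 1)) (by fun_prop)
  -- Only the lower estimate for the sum is retained. It is arithmetical, hence internal, whereas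
  -- the full limit condition quantifies over all larger finite sequences.
  obtain ⟨Y, hY⟩ := exists_choice hAC (P := fun n y => M.IsFin (y 0) (D y) ∧
    M.RLt b (M.rAdd (M.finSum a (y 0) (D y)) (E n))) (by fun_prop) (by
      intro n
      obtain ⟨m, w, hw, H⟩ := hab (E n) (hEr n) ⟨n + 1 + 1, by
        rw [hEv]; linarith [eps_succ n, eps_succ (n + 1), eps_pos (n + 1 + 1)]⟩
      obtain ⟨y, hy⟩ := Internal.exists_app (M := M)
        (f := fun c => if c = 0 then m else w (M.fst (M.prd c)) (M.snd (M.prd c))) (by fun_prop)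
      have h0 : y 0 = m := by rw [hy, if_pos rfl]
      have hDy : D y = w := Model.ext₂ fun i k => by
        rw [hD, hy, if_neg (by simp), prd_succ, fst_pair, snd_pair]
      refine ⟨y, ?_⟩
      rw [h0, hDy]
      exact ⟨hw, (H m w hw (Str.IsSub.refl m w)).2⟩)
  obtain ⟨o, ho⟩ := exists_const_real (0 : M.Q)
  have hou : M.InUnit o := ⟨isReal_const ho, fun n => by
    rw [ho]; constructor <;> linarith [eps_pos n]⟩
  -- All entries of all chosen sequences are listed along the pairing function; positions beyond a
  -- length are filled with the real 0.
  obtain ⟨y, hy⟩ := Internal.exists_app (M := M)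
    (f := fun j => if M.snd j < Y (M.fst j) 0 then D (Y (M.fst j)) (M.snd j) else o) (by fun_prop)
  refine ⟨y, fun j => ?_, fun z hz hzy => ?_⟩
  · rw [hy]
    split_ifs with h
    · exact (hY _).1.1 _ h
    · exact hou
  have haz := ha.1 z hz
  suffices h : M.REq (a z) o by
    intro n
    have := h n
    rwa [ho, sub_zero] at this
  rw [rEq_iff haz hou.1]
  intro m
  obtain ⟨hw, hlt⟩ := hY (m + 1)
  set n := Y (m + 1) 0
  set w := D (Y (m + 1))
  have hne : ∀ i < n, ¬ M.REq z (w i) := by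
    intro i hi
    have := hzy (M.pair (m + 1) i)
    rwa [hy, fst_pair, snd_pair, if_pos hi] at this
  obtain ⟨u, hu⟩ := Internal.exists_app (M := M) (f := fun i => if i < n then w i else z)
    (by fun_prop)
  have hu₁ : ∀ i < n, u i = w i := fun i hi => by rw [hu, if_pos hi]
  have hu₂ : u n = z := by rw [hu, if_neg (lt_irrefl _)]
  -- With `z` appended the sum is still at most `b`, while without it the sum exceeds b -
  -- 2^(-(m+1)). This bounds the value at `z`; the remaining errors are two terms 2^(-(m+2)).
  have hub := approxSum_le_of_isNetLimit ha ha0 hb hab (isFin_append hw hz hne hu₁ hu₂)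
    (m + 1 + 1)
  have hreal : ∀ i < n, M.IsReal (a (w i)) := fun i hi => ha.1 _ (hw.1 i hi)
  obtain ⟨l, hl⟩ := (rLt_iff hb ((isReal_finSum hreal).rAdd (hEr _))).1 hlt
  filter_upwards [hub, hl, eventually_of_mul_eps_le n (m + 1 + 1),
    (eventually_ge_atTop (m + 1))] with k h₁ h₂ h₃ h₄
  rw [approxSum_append hu₁, hu₂] at h₁
  rw [val_rAdd, val_finSum_eq, hEv] at h₂
  have h₅ := (abs_le.1 (abs_approxSum_sub_le hreal
    (le_self_add.trans le_self_add : k ≤ k + 1 + n))).1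
  have h₆ := ha0 z hz k
  have h₇ := two_mul_eps_le h₄
  rw [ho, sub_zero, abs_le]
  constructor
  · linarith
  · linarith [eps_succ m, eps_succ (m + 1), eps_pos l]

end Summable
end HOArith

namespace HOArith
open Filter

/-! ### Diagonalization and the family defined from a bijection. -/

section NoBijection

variable {M : Str Const} [Model M] {Γ : List Ty}

/-- The unit interval is not enumerated by any sequence. -/
theorem exists_not_rEq (y : M.car .seq) : ∃ x, M.InUnit x ∧ ∀ n, ¬ M.REq x (y n) := by
  classical
  -- Nested intervals of length 4^(-n) with left endpoint t(n)/4^n. If the approximation of `y n` at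
  -- precision 2n+4 is at most the midpoint, the last quarter is taken, otherwise the first.
  obtain ⟨t, ht, ht0, hts⟩ := Internal.exists_rec (M := M) (g := fun n r => 4 * r +
    if M.val (y n (n + n + 1 + 1 + 1 + 1)) ≤ Frac.of r * M.eps (n + n) + M.eps (n + n + 1)
      then 3 else 0) (by fun_prop) 0
  set l : M.car .nat → M.Q := fun n => Frac.of (t n) * M.eps (n + n) with hl
  have il : Internal M l := by rw [hl]; fun_prop
  have he : ∀ n : M.car .nat, 4 * M.eps (n + 1 + (n + 1)) = M.eps (n + n) := by
    intro n
    rw [show n + 1 + (n + 1) = n + n + 1 + 1 by ring]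
    linarith [eps_succ (n + n), eps_succ (n + n + 1)]
  have hstep : ∀ n, l (n + 1) = l n +
      if M.val (y n (n + n + 1 + 1 + 1 + 1)) ≤ l n + M.eps (n + n + 1)
        then 3 * M.eps (n + 1 + (n + 1)) else 0 := by
    intro n
    simp only [hl]
    rw [hts, ← he n]
    split_ifs <;> simp only [map_add, map_mul, map_ofNat, map_zero] <;> ring
  have hlo : ∀ n, l n ≤ l (n + 1) := by
    intro n
    rw [hstep]
    split_ifs <;> linarith [eps_pos (n + 1 + (n + 1))]
  have hhi : ∀ n, l (n + 1) + M.eps (n + 1 + (n + 1)) ≤ l n + M.eps (n + n) := by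
    intro n
    rw [hstep]
    split_ifs <;> linarith [eps_pos (n + 1 + (n + 1)), he n]
  have hmono : ∀ n i, l n ≤ l (n + i) ∧ l (n + i) + M.eps (n + i + (n + i)) ≤ l n + M.eps (n + n) := by
    intro n
    refine nat_induction (by fun_prop) (by simp) ?_
    rintro i ⟨h₁, h₂⟩
    rw [← add_assoc n i 1]
    exact ⟨h₁.trans (hlo _), (hhi _).trans h₂⟩
  obtain ⟨x, hx⟩ := il.exists_seq
  have h00 : l 0 = 0 := by simp [hl, ht0]
  refine ⟨x, ⟨fun n i => ?_, fun n => ?_⟩, fun n hn => ?_⟩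
  · rw [hx, hx]
    obtain ⟨h₁, h₂⟩ := hmono n i
    have h₃ : M.eps (n + n) ≤ M.eps n := eps_anti le_self_add
    rw [abs_lt]
    constructor <;> linarith [eps_pos (n + i + (n + i)), eps_pos n]
  · rw [hx]
    have h := hmono 0 n
    simp only [zero_add, add_zero, h00, eps_zero] at h
    constructor <;> linarith [eps_pos n, eps_pos (n + n), h.1, h.2]
  -- At precision 2n+4 equality allows a distance of 2^(-(2n+3)), but the chosen quarter is
  -- 2^(-(2n+2)) away from the midpoint, on the side opposite to `y n`.
  · have h := abs_le.1 (hn (n + n + 1 + 1 + 1 + 1))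
    rw [hx] at h
    have h₁ := hmono (n + 1) (n + 1 + 1 + 1)
    rw [show n + 1 + (n + 1 + 1 + 1) = n + n + 1 + 1 + 1 + 1 by ring] at h₁
    have h₂ := eps_pos (n + n + 1 + 1 + 1 + 1 + (n + n + 1 + 1 + 1 + 1))
    have h₃ := he n
    have h₄ := hstep n
    split_ifs at h₄ with hc <;>
      linarith [eps_succ (n + n), eps_succ (n + n + 1), eps_succ (n + n + 1 + 1),
        eps_succ (n + n + 1 + 1 + 1), eps_pos (n + n + 1 + 1 + 1 + 1)]

theorem sum_eps (n : M.car .nat) : M.sum M.eps n = 2 - 2 * M.eps n := by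
  have h : Internal M (M.eps) := Internal.eps Internal.id
  refine nat_induction (P := fun n => M.sum M.eps n = 2 - 2 * M.eps n)
    (by fun_prop) ?_ ?_ n
  · rw [sum_zero h, eps_zero]; ring
  · intro n hn
    rw [sum_succ h, hn]
    linarith [eps_succ n]

/-- Induction for all formulas. -/
theorem nat_induction_formula (hI : ∀ φ, IND φ → φ.Sat (Env.nil : Env M []))
    (A : Formula (.nat :: Γ)) (e : Env M Γ) (h0 : A.Sat (Env.cons 0 e))
    (hs : ∀ n : M.car .nat, A.Sat (Env.cons n e) → A.Sat (Env.cons (n + 1) e)) (n : M.car .nat) :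
    A.Sat (Env.cons n e) := by
  have H := (Fm.sat_close _).1 (hI _ (IND.mk A)) e
  simp only [indFm, sat_imp, sat_all, Fm.sat_subst] at H
  refine H ?_ (fun n hn => ?_) n
  · convert h0 using 1
    funext ρ v; cases v <;> rfl
  · convert hs n hn using 1
    funext ρ v; cases v <;> rfl

/-- Finite choice along a surjection. -/
theorem exists_finite_preimages (hI : ∀ φ, IND φ → φ.Sat (Env.nil : Env M []))
    (Y : M.car .two) (hY : ∀ n, ∃ x, M.InUnit x ∧ Y x = n) (n : M.car .nat) :
    ∃ w : M.car .seq, ∀ i, i < n → M.InUnit (w i) ∧ Y (w i) = i := by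
  classical
  -- The existential quantifier ranges over sequences of reals, which `nat_induction` for internal
  -- predicates does not cover; this is the use of `IND`.
  have H := nat_induction_formula hI (Γ := [.two]) (Fm.ex .seq (Fm.all .nat ((v0 ≺ v2) ⟹
    Fm.and (inUnit (v1 ⬝ v0)) (v3 ⬝ (v1 ⬝ v0) ≐ v0)))) (Env.cons Y Env.nil)
  simp only [sat_ex, sat_all, sat_imp, sat_and, sat_lt, sat_eq, sat_inUnit, eval_app, eval_var,
    cons_zero, cons_succ] at H
  refine H ?_ (fun n ⟨w, hw⟩ => ?_) n
  · obtain ⟨x, _⟩ := hY 0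
    obtain ⟨w, _⟩ := Internal.exists_app (M := M) (f := fun _ : M.car .nat => x) (by fun_prop)
    exact ⟨w, fun i hi => (nat_not_lt_zero _ hi).elim⟩
  · obtain ⟨x, hx⟩ := hY n
    obtain ⟨u, hu⟩ := Internal.exists_app (M := M) (f := fun i => if i = n then x else w i)
      (by fun_prop)
    refine ⟨u, fun i hi => ?_⟩
    rw [hu]
    rcases (nat_lt_add_one.1 hi).lt_or_eq with h | rfl
    · rw [if_neg h.ne]; exact hw i h
    · rw [if_pos rfl]; exact hx

theorem exists_bound {f : M.car .nat → M.car .nat} (hf : Internal M f) (n : M.car .nat) :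
    ∃ J, ∀ i, i < n → f i < J := by
  refine nat_induction (P := fun n => ∃ J, ∀ i, i < n → f i < J) (by fun_prop) ?_ ?_ n
  · exact ⟨0, fun i hi => (nat_not_lt_zero _ hi).elim⟩
  · rintro n ⟨J, hJ⟩
    refine ⟨J + (f n + 1), fun i hi => ?_⟩
    rcases (nat_lt_add_one.1 hi).lt_or_eq with h | rfl
    · exact (hJ i h).trans_le le_self_add
    · exact nat_add_one_le.1 le_add_self

theorem sat_nbi : NBI.Sat (Env.nil : Env M []) ↔ ¬ ∃ Y : M.car .two,
    (∀ x y, M.InUnit x → M.InUnit y → M.REq x y → Y x = Y y) ∧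
    (∀ x y, M.InUnit x → M.InUnit y → Y x = Y y → M.REq x y) ∧
    ∀ n, ∃ x, M.InUnit x ∧ Y x = n := by
  simp [NBI]

/-- The family `2^(-Y(x))` is summable if `Y` is a bijection from the unit interval to `ℕ`. -/
theorem isNetLimit_of_bijection (hI : ∀ φ, IND φ → φ.Sat (Env.nil : Env M []))
    {Y : M.car .two} (hfun : ∀ x y, M.InUnit x → M.InUnit y → M.REq x y → Y x = Y y)
    (hinj : ∀ x y, M.InUnit x → M.InUnit y → Y x = Y y → M.REq x y)
    (hsurj : ∀ n, ∃ x, M.InUnit x ∧ Y x = n) {a : M.car (.one ⇒ .one)}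
    (ha : ∀ x k, M.val (a x k) = M.eps (Y x)) (har : M.IsRealFun a) (ha0 : M.IsNonneg a)
    {b : M.car .one} (hb : ∀ k, M.val (b k) = 2) : M.IsNetLimit a b := by
  rintro r hr ⟨m, hm⟩
  -- With preimages of all numbers below m+3 the sum is 2 - 2^(-(m+2)), well within the positive
  -- real `r`, which is above 2^(-m) at the index used below.
  obtain ⟨w, hw⟩ := exists_finite_preimages hI Y hsurj (m + 1 + 1 + 1)
  have hwf : M.IsFin (m + 1 + 1 + 1) w := ⟨fun i hi => (hw i hi).1, fun i j hi hj hij h => hij (by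
    rw [← (hw i hi).2, ← (hw j hj).2]
    exact hfun _ _ (hw i hi).1 (hw j hj).1 h)⟩
  refine ⟨_, w, hwf, fun n' w' hw' hsub => ?_⟩
  have hsum : ∀ n (w : M.car .seq) k, M.approxSum a n w k = M.sum (fun i => M.eps (Y (w i))) n := by
    intro n w k
    simp only [Str.approxSum, ha]
  have hw₀ : M.sum (fun i => M.eps (Y (w i))) (m + 1 + 1 + 1) = 2 - 2 * M.eps (m + 1 + 1 + 1) := by
    rw [← sum_eps]
    exact sum_congr (by fun_prop) (Internal.eps Internal.id) fun i hi => by rw [(hw i hi).2]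
  -- The approximations are constant in the precision `k`, so the error in the comparison of sums
  -- can be made arbitrarily small.
  have lower : 2 - 2 * M.eps (m + 1 + 1 + 1) ≤ M.sum (fun i => M.eps (Y (w' i))) n' := by
    refine le_of_forall_eps fun l => ?_
    obtain ⟨k, hk⟩ := (eventually_of_mul_eps_le n' (l + 1)).exists
    have := approxSum_le_of_isSub har ha0 hwf hw' hsub k
    rw [hsum, hsum, hw₀] at this
    linarith [eps_succ l]
  have upper : M.sum (fun i => M.eps (Y (w' i))) n' ≤ 2 := by
    -- The numbers `Y (w' i)` are distinct and below `J`, so the sum is bounded by a partial sum of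
    -- the geometric series.
    obtain ⟨J, hJ⟩ := exists_bound (M := M) (f := fun i => Y (w' i)) (by fun_prop) n'
    have := sum_comp_le_of_injOn (s := M.eps) (f := fun i => Y (w' i)) (n := n') (m := J)
      (Internal.eps Internal.id) (by fun_prop) (fun j _ => (eps_pos j).le) hJ
      fun i hi j hj hij => by
        by_contra hne
        exact hw'.2 i j hi hj hne (hinj _ _ (hw'.1 i hi) (hw'.1 j hj) hij)
    rw [sum_eps] at this
    linarith [eps_pos J]
  -- The index is m+4 because the sum of two reals at m+3 reads its summands one place further.
  have hrm := (abs_lt.1 (hr.abs_sub_lt (m := m) (n := m + 1 + 1 + 1 + 1)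
    (le_self_add.trans (le_self_add.trans (le_self_add.trans le_self_add))))).2
  constructor
  · refine ⟨m + 1 + 1 + 1, ?_⟩
    rw [val_finSum_eq, hsum, val_rAdd, hb]
    linarith [eps_succ m, eps_succ (m + 1), eps_succ (m + 1 + 1), eps_pos (m + 1 + 1 + 1)]
  · refine ⟨m + 1 + 1 + 1, ?_⟩
    rw [val_rAdd, val_finSum_eq, hsum, hb]
    linarith [eps_succ m, eps_succ (m + 1), eps_succ (m + 1 + 1), eps_pos (m + 1 + 1 + 1)]

/-- `SUM' → NBI` in models of `ACA₀^ω + IND`. -/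
theorem model_nbi (hI : ∀ φ, IND φ → φ.Sat (Env.nil : Env M []))
    (hsum : SUM'.Sat (Env.nil : Env M [])) : NBI.Sat (Env.nil : Env M []) := by
  rw [sat_sum'] at hsum
  rw [sat_nbi]
  rintro ⟨Y, hfun, hinj, hsurj⟩
  obtain ⟨c, hc, hc'⟩ := Internal.exists_code (M := M) (X := M.car .one × M.car .nat)
    (f := fun p => M.eps (Y p.1)) (by fun_prop)
  obtain ⟨a, ha⟩ := Internal.exists_app₂ (f := fun x k => c (x, k)) hc
  have hav : ∀ x k, M.val (a x k) = M.eps (Y x) := fun x k => by rw [ha]; exact (hc' (x, k)).symm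
  have har : M.IsRealFun a := ⟨fun x _ => isReal_const (hav x), fun x y hx hy hxy n => by
    rw [hav, hav, hfun x y hx hy hxy, sub_self, abs_zero]
    linarith [eps_pos n]⟩
  have ha0 : M.IsNonneg a := fun x _ n => by rw [hav]; linarith [eps_pos n, eps_pos (Y x)]
  obtain ⟨b, hb⟩ := exists_const_real (2 : M.Q)
  obtain ⟨y, -, hy⟩ := hsum a har ha0 ⟨b, isReal_const hb,
    isNetLimit_of_bijection hI hfun hinj hsurj hav har ha0 hb⟩
  obtain ⟨z, hz, hzy⟩ := exists_not_rEq y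
  -- At precision Y(z)+2 the vanishing of the family at `z` would give 2^(-Y(z)) ≤ 2^(-Y(z)-1).
  have h := (abs_le.1 (hy z hz hzy (Y z + 1 + 1))).2
  rw [hav] at h
  linarith [eps_succ (Y z), eps_succ (Y z + 1), eps_pos (Y z + 1 + 1)]

end NoBijection

/-! ### From truth in all models to derivability. -/

theorem nonempty_closed_term (ρ : Ty) : Nonempty (Term [] ρ) := by
  induction ρ with
  | nat => exact ⟨zero⟩
  | arr σ τ _ ih => exact ⟨K τ σ ⬝ ih.some⟩

/-- A theory that extends `ACA₀^ω` proves what holds in all its extensional models. -/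
theorem proves_of_model {T : Set Sentence} (hT : ACA0 ⊆ T) (φ : Sentence)
    (h : ∀ (M : Str Const) [Model M], (∀ ψ ∈ T, ψ.Sat (Env.nil : Env M [])) →
      φ.Sat (Env.nil : Env M [])) : Proves T φ :=
  proves_of_sat nonempty_closed_term (fun ρ τ => hT (Or.inl (RCA0.ext ρ τ))) φ
    fun M hM hsat =>
      haveI : Model M := ⟨hM, fun ψ hψ => hsat ψ (hT hψ)⟩
      h M hsat

end HOArith

/-- `ACA₀^ω + IND` proves `SUM' → NBI`, and `ACA₀^ω + QF-AC^{0,1}` proves `SUM'`. -/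
theorem theorem3p6 :
    HOArith.Proves (HOArith.ACA0 ∪ {φ | HOArith.IND φ}) (HOArith.Fm.imp HOArith.SUM' HOArith.NBI) ∧
    HOArith.Proves (HOArith.ACA0 ∪ {φ | HOArith.QFAC HOArith.Ty.nat HOArith.Ty.one φ})
      HOArith.SUM' :=
  ⟨HOArith.proves_of_model Set.subset_union_left _ fun _ _ h hsum =>
      HOArith.model_nbi (fun φ hφ => h φ (Or.inr hφ)) hsum,
    HOArith.proves_of_model Set.subset_union_left _ fun _ _ h =>
      HOArith.model_sum' fun φ hφ => h φ (Or.inr hφ)⟩
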